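/- There is a polynomial-time randomized algorithm for the maximum independent set problem that achieves canonical recoverable value $\rho=7/3$. That is, there is a randomized algorithm which, given any finite simple undirected graph $G=(V,E)$ (by its adjacency matrix), always halts after a number of steps bounded by a fixed polynomial in $|V|$, always outputs an independent set $A$ of $G$, and satisfies $$\mathbb{E}\,|A|\;\ge\;\max_{I}\;\sum_{v\in I}\min\Bigl[1,\ \frac{7/3}{d(v)+1}\Bigr],$$ where $I$ ranges over all independent sets of $G$, $d(v)$ is the number of neighbours of $v$ in $G$, and the expectation is over the random choices of the algorithm only. Here an algorithm is a single program for a random access machine over the natural numbers with unit-cost constants, comparison, addition, (truncated) subtraction and indirect addressing, which can also draw, in one step, a uniformly random element of $\{0,1,\dots,k\}$ for a computed number $k$. -/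

import Mathlib

/-! ### Randomized random access machines

A machine has natural-number registers and natural-number arrays. In one step it evaluates one
fixed expression, built from constants, register reads, array reads (indirect addressing),
addition, truncated subtraction and comparisons, and assigns the value, branches on it, or draws
a uniformly random number below a bound. There is no multiplication, so `t` steps of a fixed
program only produce numbers with `O(t + log (input))` bits, and the number of steps is the usual
measure of running time, up to a polynomial. -/

namespace RAM

/-- The contents of the registers and of the arrays; both are addressed by numbers. -/
structure State where
  reg : ℕ → ℕ
  arr : ℕ → ℕ → ℕ

/-- Put the value `y` into register `x`. -/
def State.setReg (s : State) (x y : ℕ) : State :=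
  { s with reg := Function.update s.reg x y }

/-- Put the value `y` into cell `i` of array `a`. -/
def State.setArr (s : State) (a i y : ℕ) : State :=
  { s with arr := Function.update s.arr a (Function.update (s.arr a) i y) }

/-- Expressions of the programming language of the machine. -/
inductive Exp where
  | const (k : ℕ)
  | reg (x : ℕ)
  | get (a : ℕ) (i : Exp)
  | add (e f : Exp)
  | sub (e f : Exp)
  | lt (e f : Exp)
  | eq (e f : Exp)

/-- The value of an expression; comparisons have value `1` or `0`. -/
def Exp.eval (s : State) : Exp → ℕ
  | .const k => k
  | .reg x => s.reg x
  | .get a i => s.arr a (i.eval s)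
  | .add e f => e.eval s + f.eval s
  | .sub e f => e.eval s - f.eval s
  | .lt e f => if e.eval s < f.eval s then 1 else 0
  | .eq e f => if e.eval s = f.eval s then 1 else 0

/-- Programs: `assign x e` is `x := e`; `store a i e` is `a[i] := e`; `draw x e` puts into `x` a
uniformly random element of `{0, …, e}`, independent of everything before; `branch b c d` is
`if b ≠ 0 then c else d`; `loop b c` is `while b ≠ 0 do c`. -/
inductive Cmd where
  | skip
  | assign (x : ℕ) (e : Exp)
  | store (a : ℕ) (i e : Exp)
  | draw (x : ℕ) (e : Exp)
  | seq (c d : Cmd)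
  | branch (b : Exp) (c d : Cmd)
  | loop (b : Exp) (c : Cmd)

/-- A configuration: the commands that remain to be executed, in order, and the memory. The
machine has halted when no command remains. -/
structure Config where
  todo : List Cmd
  state : State

/-- The configuration has no remaining command. -/
def Config.Halted (C : Config) : Prop := C.todo = []

/-- The distribution of the configuration one step later. -/
noncomputable def step : Config → PMF Config
  | ⟨[], s⟩ => PMF.pure ⟨[], s⟩
  | ⟨.skip :: k, s⟩ => PMF.pure ⟨k, s⟩
  | ⟨.assign x e :: k, s⟩ => PMF.pure ⟨k, s.setReg x (e.eval s)⟩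
  | ⟨.store a i e :: k, s⟩ => PMF.pure ⟨k, s.setArr a (i.eval s) (e.eval s)⟩
  | ⟨.draw x e :: k, s⟩ =>
      PMF.map (fun r : Fin (e.eval s + 1) => ⟨k, s.setReg x (r : ℕ)⟩)
        (PMF.uniformOfFintype (Fin (e.eval s + 1)))
  | ⟨.seq c d :: k, s⟩ => PMF.pure ⟨c :: d :: k, s⟩
  | ⟨.branch b c d :: k, s⟩ =>
      PMF.pure (if b.eval s ≠ 0 then ⟨c :: k, s⟩ else ⟨d :: k, s⟩)
  | ⟨.loop b c :: k, s⟩ =>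
      PMF.pure (if b.eval s ≠ 0 then ⟨c :: .loop b c :: k, s⟩ else ⟨k, s⟩)

/-- The distribution of the configuration after `t` steps, started from the program `c` in the
state `s`. -/
noncomputable def run (c : Cmd) (s : State) : ℕ → PMF Config
  | 0 => PMF.pure ⟨[c], s⟩
  | t + 1 => (run c s t).bind step

end RAM

/-! ### Randomized algorithms that return a set of vertices -/

/-- The input: register `0` holds the number `n` of vertices, array `0` holds the `n × n`
adjacency matrix row by row, and everything else is `0`. -/
def graphInput {n : ℕ} (G : SimpleGraph (Fin n)) [DecidableRel G.Adj] : RAM.State where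
  reg x := if x = 0 then n else 0
  arr a i := if a = 0 ∧ ∃ u v : Fin n, i = u * n + v ∧ G.Adj u v then 1 else 0

/-- The set of vertices that is returned: those whose cell in array `1` is nonzero. -/
def vertexOutput (n : ℕ) (s : RAM.State) : Finset (Fin n) :=
  Finset.univ.filter fun v => s.arr 1 v ≠ 0

/-- On every graph with `n` vertices, `c` halts within `t n` steps, whatever the random draws. -/
def HaltsWithin (c : RAM.Cmd) (t : ℕ → ℕ) : Prop :=
  ∀ (n : ℕ) (G : SimpleGraph (Fin n)) [DecidableRel G.Adj],
    ∀ C ∈ (RAM.run c (graphInput G) (t n)).support, C.Halted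

/-- The distribution of the set of vertices that array `1` holds after `t` steps of `c`. Once `c`
has halted this is the distribution of its output. -/
noncomputable def outputDist (c : RAM.Cmd) {n : ℕ} (G : SimpleGraph (Fin n))
    [DecidableRel G.Adj] (t : ℕ) : PMF (Finset (Fin n)) :=
  (RAM.run c (graphInput G) t).map fun C => vertexOutput n C.state

/-- The expected size of a random set of vertices. -/
noncomputable def expectedSize {n : ℕ} (μ : PMF (Finset (Fin n))) : ℝ :=
  ∑ S : Finset (Fin n), (μ S).toReal * (S.card : ℝ)

/-- The canonical value `min [1, ρ / (d + 1)]` to be recovered from a vertex of degree `d`. -/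
noncomputable def canonicalValue (ρ : ℝ) (d : ℕ) : ℝ := min 1 (ρ / ((d : ℝ) + 1))

/-! The algorithm has a deterministic and a random half. With weights proportional to 1/(d(v)+1), an
auction produces a persistent partition in the sense of Nemhauser and Trotter: a taken set V1, a
rejected set V0 and an undecided set H. All neighbours of V1 lie in V0, so V1 is independent and can
be joined to any independent set of H. The vertices are then ordered at random; those of H with at
most one earlier neighbour in H induce a forest, where a greedy pass in reverse order is optimal.

Fix an independent set I. In H the output is at least as large as `rootsAndMembers`: the forest
vertices of I, and the roots outside I (vertices before all their neighbours in H) without a child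
in I. A vertex of positive degree d in H lies in the forest with probability at least 2/(d+1), and a
vertex of degree d is a root with probability 1/(d+1). The crux is
`permProb_first_and_exists_child`: that u outside I is a root with a child in I has probability at
most (1/3+δ)/(d(u)+1) plus a charge of about 1/(3d(d+1)) to each neighbour in I of degree d ≥ 2. It
combines a second-moment bound for unions (`ind_exists_le`), the probabilities of relative orders,
and `powerSum_ineq`. A vertex of I is charged by its d neighbours, about 1/(3(d+1)) in all, and
keeps (5/3)/(d+1); each u in H \ I contributes (2/3)/(d(u)+1). Persistency says that I ∩ H weighs no
more than H \ I (`unitCount_inter_undecided_le`), so the second contribution can be credited to I,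
and 5/3 + 2/3 = 7/3.

Outside H, the vertices of I ∩ V1 are in the output, and those of I ∩ V0 are paid for by V1 \ I
through a Hall-type inequality (`sum_canonicalValue_rejected_le`). The integral weights `400 * n ^ 2
/ (d + 1)` are realised as that many units of a vertex, and δ = 1/(400n) pays for the rounding. Only
the shuffle draws random numbers, so all other programs are verified in a deterministic logic
(`Wp`), and the shuffle is replaced by one uniform permutation. -/

open Finset

/-! ### Relative orders under a uniformly random permutation -/

section RandomOrder

variable {n : ℕ}

/-- The average of `f` over all permutations. -/
noncomputable def permMean (f : Equiv.Perm (Fin n) → ℝ) : ℝ :=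
  (∑ σ, f σ) / (n.factorial : ℝ)

open Classical in
/-- The indicator of a proposition. -/
noncomputable def ind (p : Prop) : ℝ := if p then 1 else 0

theorem ind_true {p : Prop} (h : p) : ind p = 1 := if_pos h

theorem ind_false {p : Prop} (h : ¬ p) : ind p = 0 := if_neg h

theorem ind_nonneg (p : Prop) : 0 ≤ ind p := by
  unfold ind; split_ifs <;> simp

theorem ind_le_one (p : Prop) : ind p ≤ 1 := by
  unfold ind; split_ifs <;> simp

theorem ind_mono {p q : Prop} (h : p → q) : ind p ≤ ind q := by
  by_cases hp : p
  · rw [ind_true hp, ind_true (h hp)]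
  · rw [ind_false hp]; exact ind_nonneg q

theorem ind_mul (p q : Prop) : ind p * ind q = ind (p ∧ q) := by
  by_cases hp : p <;> by_cases hq : q <;> simp [ind, hp, hq]

/-- The probability of an event under a uniformly random permutation. -/
noncomputable def permProb (Q : Equiv.Perm (Fin n) → Prop) : ℝ :=
  permMean fun σ => ind (Q σ)

/-- The vertex `v` comes before all other elements of `A`. -/
def IsFirst (σ : Equiv.Perm (Fin n)) (A : Finset (Fin n)) (v : Fin n) : Prop :=
  ∀ a ∈ A, a ≠ v → σ v < σ a

theorem permMean_mono {f g : Equiv.Perm (Fin n) → ℝ} (h : ∀ σ, f σ ≤ g σ) :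
    permMean f ≤ permMean g := by
  unfold permMean
  gcongr
  exact h _

theorem permMean_add (f g : Equiv.Perm (Fin n) → ℝ) :
    permMean (fun σ => f σ + g σ) = permMean f + permMean g := by
  unfold permMean
  rw [sum_add_distrib, add_div]

theorem permMean_sub (f g : Equiv.Perm (Fin n) → ℝ) :
    permMean (fun σ => f σ - g σ) = permMean f - permMean g := by
  unfold permMean
  rw [sum_sub_distrib, sub_div]

theorem permMean_sum {ι : Type*} (s : Finset ι) (f : ι → Equiv.Perm (Fin n) → ℝ) :
    permMean (fun σ => ∑ i ∈ s, f i σ) = ∑ i ∈ s, permMean (f i) := by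
  unfold permMean
  rw [sum_comm, sum_div]

theorem permMean_const_mul (c : ℝ) (f : Equiv.Perm (Fin n) → ℝ) :
    permMean (fun σ => c * f σ) = c * permMean f := by
  unfold permMean
  rw [← mul_sum, mul_div_assoc]

theorem permMean_const (c : ℝ) : permMean (fun _ : Equiv.Perm (Fin n) => c) = c := by
  unfold permMean
  have : (n.factorial : ℝ) ≠ 0 := by positivity
  simp [Fintype.card_perm]
  field_simp

theorem permProb_mono {P Q : Equiv.Perm (Fin n) → Prop} (h : ∀ σ, P σ → Q σ) :
    permProb P ≤ permProb Q := by
  exact permMean_mono fun σ => ind_mono (h σ)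

theorem permProb_congr {P Q : Equiv.Perm (Fin n) → Prop} (h : ∀ σ, P σ ↔ Q σ) :
    permProb P = permProb Q := by
  rw [show P = Q from funext fun σ => propext (h σ)]

theorem permProb_true : permProb (fun _ : Equiv.Perm (Fin n) => True) = 1 := by
  simp [permProb, permMean_const, ind]

theorem permProb_or {P Q : Equiv.Perm (Fin n) → Prop} (h : ∀ σ, P σ → ¬ Q σ) :
    permProb (fun σ => P σ ∨ Q σ) = permProb P + permProb Q := by
  unfold permProb
  rw [← permMean_add]
  congr 1
  ext σ
  by_cases hP : P σ <;> by_cases hQ : Q σ <;> simp [ind, hP, hQ]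
  exact h σ hP hQ

theorem exists_isFirst (σ : Equiv.Perm (Fin n)) {A : Finset (Fin n)} (hA : A.Nonempty) :
    ∃ v ∈ A, IsFirst σ A v := by
  obtain ⟨v, hv, h⟩ := A.exists_min_image σ hA
  exact ⟨v, hv, fun a ha hne => lt_of_le_of_ne (h a ha) fun h' => hne (σ.injective h').symm⟩

theorem IsFirst.unique {σ : Equiv.Perm (Fin n)} {A : Finset (Fin n)} {v w : Fin n}
    (hv : v ∈ A) (hw : w ∈ A) (h : IsFirst σ A v) (h' : IsFirst σ A w) : v = w := by
  by_contra hne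
  exact lt_asymm (h w hw (Ne.symm hne)) (h' v hv hne)

theorem IsFirst.mono {σ : Equiv.Perm (Fin n)} {A B : Finset (Fin n)} {v : Fin n}
    (h : IsFirst σ B v) (hAB : A ⊆ B) : IsFirst σ A v := fun a ha => h a (hAB ha)

theorem swap_mem_iff {A : Finset (Fin n)} {v w : Fin n} (hv : v ∈ A) (hw : w ∈ A) (x : Fin n) :
    Equiv.swap v w x ∈ A ↔ x ∈ A := by
  by_cases h1 : x = v
  · subst h1; simp [hv, hw]
  by_cases h2 : x = w
  · subst h2; simp [hv, hw]
  rw [Equiv.swap_apply_of_ne_of_ne h1 h2]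

/-- Swapping two elements of `A` does not affect who is first in `A`, up to the swap. -/
theorem isFirst_mul_swap {A : Finset (Fin n)} {v w : Fin n} (hv : v ∈ A) (hw : w ∈ A)
    (σ : Equiv.Perm (Fin n)) (x : Fin n) :
    IsFirst (σ * Equiv.swap v w) A x ↔ IsFirst σ A (Equiv.swap v w x) := by
  constructor
  · intro h a ha hne
    have := h (Equiv.swap v w a) ((swap_mem_iff hv hw a).2 ha)
      (fun h' => hne (by rw [← h', Equiv.swap_apply_self]))
    simpa using this
  · intro h a ha hne
    exact h _ ((swap_mem_iff hv hw a).2 ha) (fun h' => hne ((Equiv.swap v w).injective h'))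

theorem permMean_comp_mul (τ : Equiv.Perm (Fin n)) (f : Equiv.Perm (Fin n) → ℝ) :
    permMean (fun σ => f (σ * τ)) = permMean f := by
  unfold permMean
  congr 1
  exact Equiv.sum_comp (Equiv.mulRight τ) f

theorem permProb_comp_mul (τ : Equiv.Perm (Fin n)) (Q : Equiv.Perm (Fin n) → Prop) :
    permProb (fun σ => Q (σ * τ)) = permProb Q :=
  permMean_comp_mul τ fun σ => ind (Q σ)

/-- If an event does not change when elements of `A` are swapped, then, conditionally on it, all
elements of `A` are equally likely to be first in `A`. -/
theorem permProb_and_isFirst {A : Finset (Fin n)} {v : Fin n} (hv : v ∈ A)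
    (Q : Equiv.Perm (Fin n) → Prop)
    (hQ : ∀ a ∈ A, ∀ σ, Q (σ * Equiv.swap v a) ↔ Q σ) :
    permProb (fun σ => Q σ ∧ IsFirst σ A v) = permProb Q / (#A : ℝ) := by
  -- Multiplying by the transposition of `v` and `a` preserves the uniform measure, fixes `Q` and
  -- exchanges the two candidates.
  have key : ∀ a ∈ A, permProb (fun σ => Q σ ∧ IsFirst σ A a) =
      permProb (fun σ => Q σ ∧ IsFirst σ A v) := by
    intro a ha
    rw [← permProb_comp_mul (Equiv.swap v a) fun σ => Q σ ∧ IsFirst σ A v]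
    refine permProb_congr fun σ => ?_
    simp only [hQ a ha σ, isFirst_mul_swap hv ha, Equiv.swap_apply_left]
  have hsum : permProb Q = ∑ a ∈ A, permProb (fun σ => Q σ ∧ IsFirst σ A a) := by
    unfold permProb
    rw [← permMean_sum]
    congr 1
    ext σ
    by_cases h : Q σ
    · obtain ⟨w, hw, hf⟩ := exists_isFirst σ ⟨v, hv⟩
      rw [sum_eq_single w]
      · simp [ind, h, hf]
      · intro b hb hbw
        refine ind_false ?_
        exact fun h' => hbw (h'.2.unique hb hw hf)
      · exact fun h' => absurd hw h'
    · simp [ind, h]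
  rw [hsum, sum_congr rfl key, sum_const, nsmul_eq_mul]
  have : (#A : ℝ) ≠ 0 := by
    simpa using (show A.Nonempty from ⟨v, hv⟩).ne_empty
  field_simp

theorem permProb_isFirst {A : Finset (Fin n)} {v : Fin n} (hv : v ∈ A) :
    permProb (fun σ => IsFirst σ A v) = 1 / (#A : ℝ) := by
  have := permProb_and_isFirst hv (fun _ => True) (by simp)
  simpa [permProb_true] using this

/-- A swap inside `A` permutes `U` and fixes `u`. This is the invariance that lets
`permProb_and_isFirst` be iterated along nested sets. -/
theorem isFirst_mul_swap_of_mem {A U : Finset (Fin n)} (hAU : A ⊆ U) {u v a : Fin n}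
    (hu : u ∉ A) (hv : v ∈ A) (ha : a ∈ A) (σ : Equiv.Perm (Fin n)) :
    IsFirst (σ * Equiv.swap v a) U u ↔ IsFirst σ U u := by
  rw [isFirst_mul_swap (hAU hv) (hAU ha), Equiv.swap_apply_of_ne_of_ne]
  · rintro rfl; exact hu hv
  · rintro rfl; exact hu ha

theorem permProb_isFirst_isFirst {A U : Finset (Fin n)} (hAU : A ⊆ U) {u v : Fin n}
    (huU : u ∈ U) (hu : u ∉ A) (hv : v ∈ A) :
    permProb (fun σ => IsFirst σ U u ∧ IsFirst σ A v) = 1 / ((#U : ℝ) * #A) := by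
  rw [permProb_and_isFirst hv (fun σ => IsFirst σ U u)
    (fun a ha σ => isFirst_mul_swap_of_mem hAU hu hv ha σ), permProb_isFirst huU, div_div]

/-- Each leader lies outside the next smaller set, so the earlier events ignore swaps in that set
and the probabilities multiply. -/
theorem permProb_isFirst_three {A B U : Finset (Fin n)} (hAU : A ⊆ U) (hBA : B ⊆ A)
    {u v w : Fin n} (huU : u ∈ U) (hu : u ∉ A) (hv : v ∈ A) (hvB : v ∉ B) (hw : w ∈ B) :
    permProb (fun σ => (IsFirst σ U u ∧ IsFirst σ A v) ∧ IsFirst σ B w) =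
      1 / ((#U : ℝ) * #A * #B) := by
  rw [permProb_and_isFirst hw (fun σ => IsFirst σ U u ∧ IsFirst σ A v),
    permProb_isFirst_isFirst hAU huU hu hv, div_div]
  intro a ha σ
  rw [isFirst_mul_swap_of_mem (hBA.trans hAU) (fun h => hu (hBA h)) hw ha,
    isFirst_mul_swap_of_mem hBA hvB hw ha]

end RandomOrder

/-! ### An inequality between power sums -/

section PowerSums

variable {ι : Type*}

theorem two_thirds_sq_le {x : ℝ} (h0 : 0 ≤ x) (h1 : x ≤ 1 / 2) :
    2 / 3 * x ^ 2 ≤ x ^ 2 / (1 + x) := by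
  rw [le_div_iff₀ (by linarith)]
  nlinarith [mul_nonneg (sq_nonneg x) (sub_nonneg.2 h1)]

theorem sum_sq_div_ge (M : Finset ι) (e : ι → ℝ) (h0 : ∀ v ∈ M, 0 ≤ e v) :
    (∑ v ∈ M, e v) ^ 2 / (#M + ∑ v ∈ M, e v) ≤ ∑ v ∈ M, e v ^ 2 / (1 + e v) := by
  have h := sq_sum_div_le_sum_sq_div M e (g := fun v => 1 + e v)
    (fun v hv => by linarith [h0 v hv])
  simpa [sum_add_distrib] using h

/-- The analytic core of the union bound, applied to `e v = N / (d v * c v)`. The positive left-hand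
side is slack that later absorbs the terms in δ. -/
theorem powerSum_ineq (M : Finset ι) (e : ι → ℝ) (h0 : ∀ v ∈ M, 0 ≤ e v)
    (h1 : ∀ v ∈ M, e v ≤ 1 / 2) (hM : 2 ≤ #M) :
    1 / (20 * #M : ℝ) ≤ 1 - 2 * ∑ v ∈ M, e v + (#M - 1) * ∑ v ∈ M, e v ^ 2 / (1 + e v)
      + 3 / #M * ((∑ v ∈ M, e v) ^ 2 - ∑ v ∈ M, e v ^ 2) := by
  set s := ∑ v ∈ M, e v with hs
  set q := ∑ v ∈ M, e v ^ 2 with hq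
  set t := ∑ v ∈ M, e v ^ 2 / (1 + e v) with ht
  have hs0 : 0 ≤ s := sum_nonneg h0
  have hsM : s ≤ #M / 2 := by
    calc s ≤ ∑ v ∈ M, (1 / 2 : ℝ) := sum_le_sum h1
      _ = _ := by simp; ring
  have hqs : q ≤ s / 2 := by
    rw [hq, hs, sum_div]
    exact sum_le_sum fun v hv => by nlinarith [h0 v hv, h1 v hv]
  have hsq : s ^ 2 ≤ #M * q := sq_sum_le_card_mul_sum_sq
  have htq : 2 / 3 * q ≤ t := by
    rw [hq, ht, mul_sum]
    exact sum_le_sum fun v hv => two_thirds_sq_le (h0 v hv) (h1 v hv)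
  have hts : s ^ 2 / (#M + s) ≤ t := sum_sq_div_ge M e h0
  have hqt : q ≤ 3 / 2 * t := by linarith
  clear_value s q t
  obtain hm | hm | hm : #M = 2 ∨ #M = 3 ∨ 4 ≤ #M := by omega
  · rw [hm] at hsq ⊢
    push_cast at hsq ⊢
    -- By `2/3 * q ≤ t` and `q ≤ s / 2` the right-hand side is at least 1 - 29/12 s + 3/2 s², whose
    -- minimum 23/864 > 1/40 is at 29/36.
    nlinarith [sq_nonneg (s - 29 / 36)]
  · rw [hm] at hsq ⊢
    push_cast at hsq ⊢
    -- By `2/3 * q ≤ t` and `s ^ 2 ≤ 3 * q` it is at least 1 - 2s + 10/9 s², whose minimum 1/10 is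
    -- at 9/10.
    nlinarith [sq_nonneg (s - 9 / 10)]
  · have hmR : (4 : ℝ) ≤ #M := by exact_mod_cast hm
    generalize (#M : ℝ) = m at *
    have hm0 : 0 < m := by linarith
    have hc : 0 ≤ m - 1 - 9 / (2 * m) := by
      have : 9 / (2 * m) ≤ 9 / 8 := by
        rw [div_le_div_iff₀ (by linarith) (by norm_num)]; linarith
      linarith
    -- The loss in `q` is charged to `t`; the coefficient left is nonnegative for `m ≥ 4`, so the
    -- Cauchy–Schwarz bound for `t` can be inserted.
    have h2 : (m - 1 - 9 / (2 * m)) * (s ^ 2 / (m + s)) ≤ (m - 1) * t - 3 / m * q := by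
      have h3 : 3 / m * q ≤ 9 / (2 * m) * t := by
        have : 9 / (2 * m) * t = 3 / m * (3 / 2 * t) := by field_simp; ring
        rw [this]; gcongr
      have h4 := mul_le_mul_of_nonneg_left hts hc
      nlinarith
    have h5 : 1 / (20 * m) ≤ 1 - 2 * s + 3 / m * s ^ 2
        + (m - 1 - 9 / (2 * m)) * (s ^ 2 / (m + s)) := by
      have hms : 0 < m + s := by linarith
      have h6 : 1 - 2 * s + 3 / m * s ^ 2 + (m - 1 - 9 / (2 * m)) * (s ^ 2 / (m + s))
          = (m ^ 2 * (1 - s) ^ 2 + s * (m - 9 / 2 * s + 3 * s ^ 2)) / (m * (m + s)) := by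
        field_simp
        ring
      rw [h6, div_le_div_iff₀ (by positivity) (by positivity)]
      have h7 : m / 2 ≤ m - 9 / 2 * s + 3 * s ^ 2 := by nlinarith [sq_nonneg (s - 3 / 4)]
      have h8 : s * (m / 2) ≤ s * (m - 9 / 2 * s + 3 * s ^ 2) :=
        mul_le_mul_of_nonneg_left h7 hs0
      suffices (m + s) ≤ 20 * (m ^ 2 * (1 - s) ^ 2 + s * (m / 2)) by nlinarith
      rcases le_total s (1 / 2) with h | h
      · have : 1 / 4 ≤ (1 - s) ^ 2 := by nlinarith
        nlinarith [mul_nonneg hs0 hm0.le]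
      · nlinarith [mul_nonneg (sq_nonneg m) (sq_nonneg (1 - s)), mul_nonneg hm0.le (sub_nonneg.2 h)]
    nlinarith
-- For e = N/(dc), `N ≤ c` gives ed ≤ 1, hence e/(1+e) ≤ 1/(d+1), while c exceeds d+1 by at least
-- m-1. This trades the terms of `powerSum_ineq` for the quantity that is charged.
theorem excess_le {d c N m : ℝ} (hd : 2 ≤ d) (hN : 0 < N) (hcN : N ≤ c) (hm : 1 ≤ m)
    (hc : m + d ≤ c) :
    N / (d * c) + (m - 1) * ((N / (d * c)) ^ 2 / (1 + N / (d * c))) ≤ N / (d * (d + 1)) := by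
  have hd0 : 0 < d := by linarith
  have hc0 : 0 < c := by linarith
  set e := N / (d * c) with he
  have he0 : 0 < e := by positivity
  have hed : e * d ≤ 1 := by
    rw [he, div_mul_eq_mul_div, div_le_one (by positivity)]
    nlinarith
  have h1 : e / (1 + e) ≤ 1 / (d + 1) := by
    rw [div_le_div_iff₀ (by linarith) (by linarith)]
    linarith
  have h2 : N / (d * (d + 1)) = e * (c / (d + 1)) := by
    rw [he]; field_simp
  have h3 : (m + d) / (d + 1) ≤ c / (d + 1) := by gcongr
  have h4 : (m + d) / (d + 1) = 1 + (m - 1) * (1 / (d + 1)) := by field_simp; ring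
  rw [h2]
  calc e + (m - 1) * (e ^ 2 / (1 + e)) = e * (1 + (m - 1) * (e / (1 + e))) := by
        field_simp
    _ ≤ e * (1 + (m - 1) * (1 / (d + 1))) := by
        gcongr
    _ ≤ e * (c / (d + 1)) := by
        gcongr
        linarith

/-- A single event leaves no pairs to subtract. For d ≥ 3 the first summand suffices. For d = 2
equality occurs at c = N = 3, and the coefficients 1 and -2 of δ are balanced so that it survives:
1/3 + δ + (1/3 - 2δ)/2 = 1/2. -/
theorem prob_union_bound_of_one {d c N P δ : ℝ} (hd : 2 ≤ d) (hd' : d = 2 ∨ 3 ≤ d) (hN : 0 < N)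
    (hcN : N ≤ c) (hc : 1 + d ≤ c) (hδ0 : 0 ≤ δ) (hδ : δ ≤ 1 / 400) (hP : P ≤ 1 / (d * c)) :
    P ≤ (1 / 3 + δ) / N + (1 / 3 - 2 * δ) / (d * (d + 1)) := by
  refine hP.trans ?_
  have hc0 : 0 < c := by linarith
  have hd0 : 0 < d := by linarith
  suffices h : N / (d * c) ≤ 1 / 3 + δ + (1 / 3 - 2 * δ) * (N / (d * (d + 1))) by
    have h2 := mul_le_mul_of_nonneg_left h (inv_pos.2 hN).le
    calc 1 / (d * c) = N⁻¹ * (N / (d * c)) := by field_simp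
      _ ≤ _ := h2
      _ = _ := by field_simp
  have hb : 0 ≤ N / (d * (d + 1)) := by positivity
  rcases hd' with rfl | h3
  · have h1 : N / (2 * c) ≤ 1 / 2 := by
      rw [div_le_div_iff₀ (by positivity) (by norm_num)]; linarith
    have h2 : N / (2 * c) ≤ N / (2 * (2 + 1)) := by
      gcongr; linarith
    generalize N / (2 * c) = e at *
    generalize N / (2 * (2 + 1)) = b at *
    rcases le_total (1 / 2) b with h | h <;> nlinarith
  · have h1 : N / (d * c) ≤ 1 / 3 := by
      rw [div_le_div_iff₀ (by positivity) (by norm_num)]; nlinarith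
    nlinarith

/-- The bound for the probability of a union that makes the analysis work: `M` indexes the events,
`c v` and `d v` are the sizes of the sets on which they depend. -/
theorem prob_union_bound [DecidableEq ι] (M : Finset ι) (hM : M.Nonempty) (d c : ι → ℕ) (N : ℕ) {P δ : ℝ}
    (hN : 0 < N) (hd : ∀ v ∈ M, 2 ≤ d v) (hcN : ∀ v ∈ M, N ≤ c v)
    (hc : ∀ v ∈ M, #M + d v ≤ c v) (hδ0 : 0 ≤ δ) (hδ : δ ≤ 1 / 400) (hδM : δ ≤ 1 / (200 * #M))
    (hP1 : P ≤ 1 / N)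
    (hP2 : P ≤ ∑ v ∈ M, 1 / ((d v : ℝ) * c v) -
      1 / #M * ∑ v ∈ M, ∑ w ∈ M, if v = w then 0 else
        1 / ((d v : ℝ) * d w * (c v + c w - N))) :
    P ≤ (1 / 3 + δ) / N + ∑ v ∈ M, (1 / 3 - 2 * δ) / ((d v : ℝ) * (d v + 1)) := by
  have hNR : (0 : ℝ) < N := by exact_mod_cast hN
  have hdR : ∀ v ∈ M, (2 : ℝ) ≤ d v := fun v hv => by exact_mod_cast hd v hv
  have hcNR : ∀ v ∈ M, (N : ℝ) ≤ c v := fun v hv => by exact_mod_cast hcN v hv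
  have hcR : ∀ v ∈ M, (#M : ℝ) + d v ≤ c v := fun v hv => by exact_mod_cast hc v hv
  have hM1 : 1 ≤ #M := card_pos.2 hM
  have hmR : (1 : ℝ) ≤ #M := by exact_mod_cast hM1
  rcases hM1.eq_or_lt with h1 | h2
  · obtain ⟨v, rfl⟩ := card_eq_one.1 h1.symm
    simp only [sum_singleton, card_singleton] at *
    have := hd v (by simp)
    exact prob_union_bound_of_one (hdR v (by simp))
      (by rcases this.eq_or_lt with h | h
          · left; exact_mod_cast h.symm
          · right; exact_mod_cast h) hNR (hcNR v (by simp))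
      (by simpa using hcR v (by simp)) hδ0 hδ (by simpa using hP2)
  -- The event probabilities scaled by `N`; they are at most 1/2 since `N ≤ c v` and `2 ≤ d v`.
  set e : ι → ℝ := fun v => N / (d v * c v) with he
  have hdp : ∀ v ∈ M, (0 : ℝ) < d v := fun v hv => by linarith [hdR v hv]
  have hcp : ∀ v ∈ M, (0 : ℝ) < c v := fun v hv => by linarith [hcNR v hv]
  have he0 : ∀ v ∈ M, 0 ≤ e v := fun v hv => by
    have := hdp v hv; have := hcp v hv; positivity
  have he1 : ∀ v ∈ M, e v ≤ 1 / 2 := fun v hv => by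
    have := hdp v hv; have := hcp v hv
    simp only [he]
    rw [div_le_div_iff₀ (by positivity) (by norm_num)]
    nlinarith [hdR v hv, hcNR v hv]
  have hps := powerSum_ineq M e he0 he1 h2
  set b : ℝ := ∑ v ∈ M, N / ((d v : ℝ) * (d v + 1)) with hb
  have hexc : ∑ v ∈ M, e v + (#M - 1) * ∑ v ∈ M, e v ^ 2 / (1 + e v) ≤ b := by
    rw [mul_sum, ← sum_add_distrib]
    exact sum_le_sum fun v hv => excess_le (hdR v hv) hNR (hcNR v hv) hmR (hcR v hv)
  have hNP : N * P ≤ ∑ v ∈ M, e v - 1 / #M * ((∑ v ∈ M, e v) ^ 2 - ∑ v ∈ M, e v ^ 2) := by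
    have h3 := mul_le_mul_of_nonneg_left hP2 hNR.le
    rw [mul_sub, mul_sum, mul_left_comm, mul_sum] at h3
    refine h3.trans ?_
    have h4 : ∑ v ∈ M, (N : ℝ) * (1 / ((d v : ℝ) * c v)) = ∑ v ∈ M, e v :=
      sum_congr rfl fun v hv => by simp only [he]; ring
    rw [h4]
    have h5 : (∑ v ∈ M, e v) ^ 2 - ∑ v ∈ M, e v ^ 2 =
        ∑ v ∈ M, ∑ w ∈ M, if v = w then 0 else e v * e w := by
      rw [sq, sum_mul_sum, ← sum_sub_distrib]
      refine sum_congr rfl fun v hv => ?_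
      rw [sub_eq_iff_eq_add, ← add_sum_erase _ _ hv, ← add_sum_erase M (fun w => ite _ _ _) hv]
      rw [if_pos rfl, sum_congr rfl fun w hw => (if_neg (ne_of_mem_erase hw).symm)]
      ring
    rw [h5]
    gcongr with v hv
    rw [mul_sum]
    gcongr with w hw
    split_ifs with hvw
    · simp
    have h6 := hdp v hv; have h7 := hdp w hw
    have h8 := hcp v hv; have h9 := hcp w hw
    have h10 : (0 : ℝ) < c v + c w - N := by linarith [hcNR v hv]
    simp only [he]
    rw [div_mul_div_comm, mul_one_div, div_le_div_iff₀ (by positivity) (by positivity)]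
    -- Equivalent to (c v - N)(c w - N) ≥ 0; it lets products `e v * e w` replace the scaled pair
    -- probabilities.
    have : (N : ℝ) * (c v + c w - N) ≤ c v * c w := by
      nlinarith [mul_nonneg (sub_nonneg.2 (hcNR v hv)) (sub_nonneg.2 (hcNR w hw))]
    calc (N : ℝ) * N * (d v * d w * (c v + c w - N))
        = N * d v * d w * (N * (c v + c w - N)) := by ring
      _ ≤ N * d v * d w * (c v * c w) := by gcongr
      _ = _ := by ring
  -- Of three copies of the linear sum, `powerSum_ineq` absorbs two at the price of the term in
  -- e²/(1+e), which `hexc` bounds together with the third.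
  have hT : 3 * (N * P) ≤ 1 + b - 10 * δ := by
    have : 10 * δ ≤ 1 / (20 * #M) := by
      calc 10 * δ ≤ 10 * (1 / (200 * #M)) := by linarith
        _ = _ := by field_simp; norm_num
    have h3 : 3 / (#M : ℝ) * ((∑ v ∈ M, e v) ^ 2 - ∑ v ∈ M, e v ^ 2) =
      3 * (1 / #M * ((∑ v ∈ M, e v) ^ 2 - ∑ v ∈ M, e v ^ 2)) := by ring
    linarith
  have hNP1 : N * P ≤ 1 := by
    calc N * P ≤ N * (1 / N) := by gcongr
      _ = 1 := by field_simp
  have hfin : N * P ≤ 1 / 3 + δ + (1 / 3 - 2 * δ) * b := by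
    -- Up to 13/6 the slack 10δ/3 covers δ(2b - 1); beyond it the trivial bound `N * P ≤ 1` is
    -- enough.
    rcases le_total b (13 / 6) with h | h <;> nlinarith
  have h3 := mul_le_mul_of_nonneg_left hfin (inv_pos.2 hNR).le
  calc P = (N : ℝ)⁻¹ * (N * P) := by field_simp
    _ ≤ _ := h3
    _ = _ := by
      rw [mul_add, hb, mul_sum, mul_sum]
      congr 1
      · field_simp
      · refine sum_congr rfl fun v hv => ?_
        field_simp

end PowerSums

/-! ### A forest in a randomly ordered graph -/

section RandomForest

variable {n : ℕ} (G : SimpleGraph (Fin n)) (H : Finset (Fin n))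

open Classical in
/-- The neighbours of `v` in `H`. -/
noncomputable def nbrIn (v : Fin n) : Finset (Fin n) := {w ∈ H | G.Adj v w}

/-- The closed neighbourhood of `v` in `H`. -/
noncomputable def closedNbrIn (v : Fin n) : Finset (Fin n) := insert v (nbrIn G H v)

/-- The neighbours of `v` in `H` that come before `v`. -/
noncomputable def earlierNbrIn (σ : Equiv.Perm (Fin n)) (v : Fin n) : Finset (Fin n) :=
  {w ∈ nbrIn G H v | σ w < σ v}

/-- Among `v` and its neighbours in `H`, `u` is the first and `v` is the second. -/
def IsChild (u v : Fin n) (σ : Equiv.Perm (Fin n)) : Prop :=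
  IsFirst σ (closedNbrIn G H v) u ∧ IsFirst σ ((closedNbrIn G H v).erase u) v

variable {G H}

theorem mem_nbrIn {v w : Fin n} : w ∈ nbrIn G H v ↔ w ∈ H ∧ G.Adj v w := by
  classical
  simp [nbrIn]

theorem mem_closedNbrIn {v w : Fin n} :
    w ∈ closedNbrIn G H v ↔ w = v ∨ w ∈ H ∧ G.Adj v w := by
  simp [closedNbrIn, mem_nbrIn]

theorem self_mem_closedNbrIn (v : Fin n) : v ∈ closedNbrIn G H v := by
  simp [closedNbrIn]

theorem card_closedNbrIn (v : Fin n) : #(closedNbrIn G H v) = #(nbrIn G H v) + 1 := by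
  rw [closedNbrIn, card_insert_of_notMem]
  simp [mem_nbrIn]

theorem mem_closedNbrIn_of_mem_nbrIn {u v : Fin n} (h : u ∈ nbrIn G H v) :
    u ∈ closedNbrIn G H v := mem_insert_of_mem h

theorem card_closedNbrIn_erase {u v : Fin n} (h : u ∈ closedNbrIn G H v) :
    #((closedNbrIn G H v).erase u) = #(nbrIn G H v) := by
  rw [card_erase_of_mem h, card_closedNbrIn, Nat.add_sub_cancel]

theorem mem_nbrIn_symm {u v : Fin n} (hu : u ∈ H) (h : v ∈ nbrIn G H u) : u ∈ nbrIn G H v :=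
  mem_nbrIn.2 ⟨hu, (mem_nbrIn.1 h).2.symm⟩

theorem mem_earlierNbrIn {σ : Equiv.Perm (Fin n)} {v w : Fin n} :
    w ∈ earlierNbrIn G H σ v ↔ (w ∈ H ∧ G.Adj v w) ∧ σ w < σ v := by
  simp [earlierNbrIn, mem_nbrIn]

theorem isFirst_union {σ : Equiv.Perm (Fin n)} {A B : Finset (Fin n)} {v : Fin n} :
    IsFirst σ (A ∪ B) v ↔ IsFirst σ A v ∧ IsFirst σ B v := by
  constructor
  · exact fun h => ⟨h.mono subset_union_left, h.mono subset_union_right⟩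
  · rintro ⟨h1, h2⟩ a ha hne
    rcases mem_union.1 ha with h | h
    exacts [h1 a h hne, h2 a h hne]

theorem permProb_isChild {u v : Fin n} (hu : u ∈ nbrIn G H v) :
    permProb (IsChild G H u v) = 1 / (((#(nbrIn G H v) : ℝ) + 1) * #(nbrIn G H v)) := by
  have hu' := mem_closedNbrIn_of_mem_nbrIn hu
  have := permProb_isFirst_isFirst (A := (closedNbrIn G H v).erase u) (v := v)
    (erase_subset _ _) hu' (by simp)
    (mem_erase.2 ⟨(mem_nbrIn.1 hu).2.ne, self_mem_closedNbrIn v⟩)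
  rw [card_closedNbrIn_erase hu', card_closedNbrIn] at this
  rw [← Nat.cast_add_one, ← this]
  rfl

theorem card_earlierNbrIn_le_of_isFirst {σ : Equiv.Perm (Fin n)} {v : Fin n}
    (h : IsFirst σ (closedNbrIn G H v) v) : #(earlierNbrIn G H σ v) = 0 := by
  rw [card_eq_zero, eq_empty_iff_forall_notMem]
  intro w hw
  obtain ⟨h1, h2⟩ := mem_earlierNbrIn.1 hw
  exact lt_asymm h2 (h w (mem_closedNbrIn.2 (Or.inr h1)) h1.2.ne.symm)

theorem card_earlierNbrIn_le_of_isChild {σ : Equiv.Perm (Fin n)} {u v : Fin n}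
    (h : IsChild G H u v σ) : #(earlierNbrIn G H σ v) ≤ 1 := by
  rw [card_le_one]
  suffices ∀ w ∈ earlierNbrIn G H σ v, w = u from
    fun a ha b hb => (this a ha).trans (this b hb).symm
  intro w hw
  obtain ⟨h1, h2⟩ := mem_earlierNbrIn.1 hw
  by_contra hne
  exact lt_asymm h2 (h.2 w (mem_erase.2 ⟨hne, mem_closedNbrIn.2 (Or.inr h1)⟩) h1.2.ne.symm)

theorem isChild_of_card_earlierNbrIn {σ : Equiv.Perm (Fin n)} {u v : Fin n}
    (hu : u ∈ nbrIn G H v) (huv : σ u < σ v) (h : #(earlierNbrIn G H σ v) ≤ 1) :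
    IsChild G H u v σ := by
  have hu' : u ∈ earlierNbrIn G H σ v := mem_earlierNbrIn.2 ⟨mem_nbrIn.1 hu, huv⟩
  have key : ∀ w ∈ closedNbrIn G H v, w ≠ u → w ≠ v → σ v < σ w := by
    intro w hw hwu hwv
    rcases mem_closedNbrIn.1 hw with rfl | hw
    · exact absurd rfl hwv
    · by_contra hlt
      have hlt' : σ w < σ v := lt_of_le_of_ne (not_lt.1 hlt) fun h => hwv (σ.injective h)
      exact hwu (card_le_one.1 h w (mem_earlierNbrIn.2 ⟨hw, hlt'⟩) u hu')
  refine ⟨fun w hw hwu => ?_, fun w hw hwv => ?_⟩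
  · by_cases hwv : w = v
    · rwa [hwv]
    · exact huv.trans (key w hw hwu hwv)
  · exact key w (mem_of_mem_erase hw) (ne_of_mem_erase hw) hwv

/-- The probability that `v` has at most one earlier neighbour. -/
theorem permProb_card_earlierNbrIn_le_one (v : Fin n) (hd : 0 < #(nbrIn G H v)) :
    2 / ((#(nbrIn G H v) : ℝ) + 1) ≤ permProb fun σ => #(earlierNbrIn G H σ v) ≤ 1 := by
  -- Either `v` leads its closed neighbourhood or it comes second after a neighbour. These events
  -- are disjoint: 1/(d+1) + d · 1/((d+1)d) = 2/(d+1).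
  have h1 : permProb (fun σ => IsFirst σ (closedNbrIn G H v) v) +
      ∑ u ∈ nbrIn G H v, permProb (IsChild G H u v) ≤
        permProb fun σ => #(earlierNbrIn G H σ v) ≤ 1 := by
    unfold permProb
    rw [← permMean_sum, ← permMean_add]
    refine permMean_mono fun σ => ?_
    by_cases hf : IsFirst σ (closedNbrIn G H v) v
    · rw [ind_true hf, sum_eq_zero,
        ind_true ((card_earlierNbrIn_le_of_isFirst hf).le.trans zero_le_one), add_zero]
      intro u hu
      refine ind_false fun hc => (mem_nbrIn.1 hu).2.ne ?_
      exact hf.unique (self_mem_closedNbrIn v) (mem_closedNbrIn_of_mem_nbrIn hu) hc.1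
    · rw [ind_false hf, zero_add]
      by_cases hex : ∃ u ∈ nbrIn G H v, IsChild G H u v σ
      · obtain ⟨u, hu, hc⟩ := hex
        rw [sum_eq_single u, ind_true hc, ind_true (card_earlierNbrIn_le_of_isChild hc)]
        · intro w hw hwu
          exact ind_false fun hc' => hwu (hc'.1.unique (mem_closedNbrIn_of_mem_nbrIn hw)
            (mem_closedNbrIn_of_mem_nbrIn hu) hc.1)
        · exact fun h => absurd hu h
      · rw [sum_eq_zero fun u hu => ind_false fun hc => hex ⟨u, hu, hc⟩]
        exact ind_nonneg _
  refine le_trans (le_of_eq ?_) h1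
  rw [permProb_isFirst (self_mem_closedNbrIn v), sum_congr rfl fun u hu => permProb_isChild hu,
    sum_const, nsmul_eq_mul, card_closedNbrIn]
  have : (0 : ℝ) < #(nbrIn G H v) := by exact_mod_cast hd
  push_cast
  field_simp
  norm_num

theorem permProb_card_earlierNbrIn_eq_one {v : Fin n} (hd : #(nbrIn G H v) ≤ 1) :
    permProb (fun σ => #(earlierNbrIn G H σ v) ≤ 1) = 1 := by
  rw [← permProb_true (n := n)]
  refine permProb_congr fun σ => iff_true_intro ?_
  exact (card_le_card (filter_subset _ _)).trans hd

variable {I : Finset (Fin n)}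

/-- No neighbour of `v` lies in `I`, so the two counted sets are disjoint. This provides the
hypothesis `#M + d v ≤ c v` of `prob_union_bound`. -/
theorem card_add_card_le_card_union {u v : Fin n} (hI : G.IsIndepSet (I : Set (Fin n)))
    (hv : v ∈ I ∩ nbrIn G H u) :
    #(I ∩ nbrIn G H u) + #(nbrIn G H v) ≤ #(closedNbrIn G H u ∪ closedNbrIn G H v) := by
  have hdisj : Disjoint (I ∩ nbrIn G H u) (nbrIn G H v) := by
    rw [disjoint_left]
    intro w hw hw'
    have hadj := (mem_nbrIn.1 hw').2
    exact hI (mem_coe.2 (mem_of_mem_inter_left hv)) (mem_coe.2 (mem_of_mem_inter_left hw))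
      hadj.ne hadj
  rw [← card_union_of_disjoint hdisj]
  refine card_le_card (union_subset_union ?_ ?_)
  · exact fun w hw => mem_closedNbrIn_of_mem_nbrIn (mem_of_mem_inter_right hw)
  · exact fun w hw => mem_closedNbrIn_of_mem_nbrIn hw

/-- Jointly the events say that `u` leads the union and `v` leads its closed neighbourhood without
`u`, a set with as many elements as `v` has neighbours. -/
theorem permProb_first_and_child {u v : Fin n} (hu : u ∈ nbrIn G H v) :
    permProb (fun σ => IsFirst σ (closedNbrIn G H u) u ∧ IsChild G H u v σ) =
      1 / ((#(nbrIn G H v) : ℝ) * #(closedNbrIn G H u ∪ closedNbrIn G H v)) := by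
  have hu' := mem_closedNbrIn_of_mem_nbrIn hu
  have := permProb_isFirst_isFirst (U := closedNbrIn G H u ∪ closedNbrIn G H v)
    (A := (closedNbrIn G H v).erase u) (v := v)
    ((erase_subset _ _).trans subset_union_right) (mem_union_right _ hu') (by simp)
    (mem_erase.2 ⟨(mem_nbrIn.1 hu).2.ne, self_mem_closedNbrIn v⟩)
  rw [card_closedNbrIn_erase hu', mul_comm] at this
  rw [← this]
  refine permProb_congr fun σ => ?_
  rw [isFirst_union, IsChild, and_assoc]

/-- Let A and B be the closed neighbourhoods of `v` and `w` without `u`. Split by which of `v`, `w`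
leads A ∪ B; non-adjacency gives v ∉ B and w ∉ A, so both cases are chains of nested sets. The sum
(|A|+|B|)/(|U||A∪B||A||B|) is at least 1/(|U||A||B|). -/
theorem permProb_first_and_two_children {u v w : Fin n} (hu : u ∈ nbrIn G H v)
    (hu' : u ∈ nbrIn G H w) (hvw : v ≠ w) (hadj : ¬ G.Adj v w) :
    1 / ((#(nbrIn G H v) : ℝ) * #(nbrIn G H w) *
      (#(closedNbrIn G H u ∪ closedNbrIn G H v) + #(closedNbrIn G H u ∪ closedNbrIn G H w)
        - #(closedNbrIn G H u))) ≤
      permProb fun σ => (IsFirst σ (closedNbrIn G H u) u ∧ IsChild G H u v σ) ∧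
        (IsFirst σ (closedNbrIn G H u) u ∧ IsChild G H u w σ) := by
  set X := closedNbrIn G H u
  set Y := closedNbrIn G H v
  set Z := closedNbrIn G H w
  set A := Y.erase u with hA
  set B := Z.erase u with hB
  have hvA : v ∈ A := mem_erase.2 ⟨(mem_nbrIn.1 hu).2.ne, self_mem_closedNbrIn v⟩
  have hwB : w ∈ B := mem_erase.2 ⟨(mem_nbrIn.1 hu').2.ne, self_mem_closedNbrIn w⟩
  have hvB : v ∉ B := fun h => by
    rcases mem_closedNbrIn.1 (mem_of_mem_erase h) with h | h
    exacts [hvw h, hadj h.2.symm]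
  have hwA : w ∉ A := fun h => by
    rcases mem_closedNbrIn.1 (mem_of_mem_erase h) with h | h
    exacts [hvw h.symm, hadj h.2]
  have huY : u ∈ Y := mem_closedNbrIn_of_mem_nbrIn hu
  have huZ : u ∈ Z := mem_closedNbrIn_of_mem_nbrIn hu'
  set U := (X ∪ Y) ∪ (X ∪ Z) with hU
  have huU : u ∈ U := by simp [hU, huY]
  have hABU : A ∪ B ⊆ U := by
    refine union_subset_union ?_ ?_
    exacts [(erase_subset _ _).trans subset_union_right, (erase_subset _ _).trans subset_union_right]
  have huAB : u ∉ A ∪ B := by simp [hA, hB]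
  have hcA : #A = #(nbrIn G H v) := card_closedNbrIn_erase huY
  have hcB : #B = #(nbrIn G H w) := card_closedNbrIn_erase huZ
  have p1 := permProb_isFirst_three hABU (subset_union_right (s₁ := A) (s₂ := B)) huU huAB
    (mem_union_left _ hvA) hvB hwB
  have p2 := permProb_isFirst_three hABU (subset_union_left (s₁ := A) (s₂ := B)) huU huAB
    (mem_union_right _ hwB) hwA hvA
  have hor := permProb_or (n := n)
    (P := fun σ => (IsFirst σ U u ∧ IsFirst σ (A ∪ B) v) ∧ IsFirst σ B w)
    (Q := fun σ => (IsFirst σ U u ∧ IsFirst σ (A ∪ B) w) ∧ IsFirst σ A v) (by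
      rintro σ ⟨⟨_, h1⟩, _⟩ ⟨⟨_, h2⟩, _⟩
      exact hvw (h1.unique (mem_union_left _ hvA) (mem_union_right _ hwB) h2))
  rw [p1, p2] at hor
  have hsub : permProb (fun σ => ((IsFirst σ U u ∧ IsFirst σ (A ∪ B) v) ∧ IsFirst σ B w) ∨
      ((IsFirst σ U u ∧ IsFirst σ (A ∪ B) w) ∧ IsFirst σ A v)) ≤
      permProb fun σ => (IsFirst σ X u ∧ IsChild G H u v σ) ∧
        (IsFirst σ X u ∧ IsChild G H u w σ) := by
    refine permProb_mono fun σ hσ => ?_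
    simp only [hU, isFirst_union] at hσ
    unfold IsChild
    tauto
  refine le_trans ?_ (hor.symm.le.trans hsub)
  have hA0 : (0 : ℝ) < #A := by exact_mod_cast card_pos.2 ⟨v, hvA⟩
  have hB0 : (0 : ℝ) < #B := by exact_mod_cast card_pos.2 ⟨w, hwB⟩
  have hAB0 : (0 : ℝ) < #(A ∪ B) := by exact_mod_cast card_pos.2 ⟨v, mem_union_left _ hvA⟩
  have hU0 : (0 : ℝ) < #U := by exact_mod_cast card_pos.2 ⟨u, huU⟩
  have hABle : (#(A ∪ B) : ℝ) ≤ #A + #B := by exact_mod_cast card_union_le A B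
  have hUle : (#U : ℝ) ≤ #(X ∪ Y) + #(X ∪ Z) - #X := by
    have h1 := card_union_add_card_inter (X ∪ Y) (X ∪ Z)
    have h2 : #X ≤ #((X ∪ Y) ∩ (X ∪ Z)) :=
      card_le_card (subset_inter subset_union_left subset_union_left)
    have h3 : (#U : ℝ) + #((X ∪ Y) ∩ (X ∪ Z)) = #(X ∪ Y) + #(X ∪ Z) := by exact_mod_cast h1
    have h4 : (#X : ℝ) ≤ #((X ∪ Y) ∩ (X ∪ Z)) := by exact_mod_cast h2
    linarith
  rw [← hcA, ← hcB]
  calc 1 / ((#A : ℝ) * #B * (#(X ∪ Y) + #(X ∪ Z) - #X)) ≤ 1 / (#A * #B * #U) := by gcongr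
    _ = #(A ∪ B) / (#U * #(A ∪ B) * #B * #A) := by field_simp
    _ ≤ (#A + #B) / (#U * #(A ∪ B) * #B * #A) := by gcongr
    _ = 1 / (#U * #(A ∪ B) * #B) + 1 / (#U * #(A ∪ B) * #A) := by field_simp

/-- If k ≥ 1 of the m events hold, the right-hand side is k - (k²-k)/m, and this is at least 1
because (k-1)(m-k) ≥ 0. -/
theorem ind_exists_le (M : Finset (Fin n)) (A : Fin n → Prop) (hM : M.Nonempty) :
    ind (∃ v ∈ M, A v) ≤ ∑ v ∈ M, ind (A v) -
      1 / #M * ∑ v ∈ M, ∑ w ∈ M, if v = w then 0 else ind (A v ∧ A w) := by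
  set k := ∑ v ∈ M, ind (A v) with hk
  have h1 : ∑ v ∈ M, ∑ w ∈ M, (if v = w then 0 else ind (A v ∧ A w)) = k ^ 2 - k := by
    rw [sq, hk, sum_mul_sum, ← sum_sub_distrib]
    refine sum_congr rfl fun v hv => ?_
    rw [eq_sub_iff_add_eq, ← add_sum_erase _ _ hv, ← add_sum_erase M (fun w => _ * _) hv]
    rw [if_pos rfl, sum_congr rfl fun w hw => if_neg (ne_of_mem_erase hw).symm]
    simp only [ind_mul, and_self]
    ring
  rw [h1]
  have hkm : k ≤ #M := by
    calc k ≤ ∑ v ∈ M, (1 : ℝ) := sum_le_sum fun v _ => ind_le_one _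
      _ = #M := by simp
  have hm : (0 : ℝ) < #M := by exact_mod_cast card_pos.2 hM
  by_cases h : ∃ v ∈ M, A v
  · rw [ind_true h]
    obtain ⟨v, hv, hA⟩ := h
    have hk1 : 1 ≤ k := by
      have := single_le_sum (f := fun v => ind (A v)) (fun w _ => ind_nonneg _) hv
      rwa [ind_true hA] at this
    rw [one_div, inv_mul_eq_div, le_sub_iff_add_le, ← le_sub_iff_add_le', div_le_iff₀ hm]
    nlinarith
  · have : k = 0 := sum_eq_zero fun v hv => ind_false fun hA => h ⟨v, hv, hA⟩
    simp [this, ind_false h]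

/-- The share of the probability of an unwanted event that is charged to a neighbour of
degree `d`. -/
noncomputable def chargeBound (δ : ℝ) (d : ℕ) : ℝ :=
  if d = 1 then 1 / 3 - δ / 2 else (1 / 3 - 2 * δ) / ((d : ℝ) * (d + 1))

theorem chargeBound_nonneg {δ : ℝ} (hδ : δ ≤ 1 / 400) (d : ℕ) : 0 ≤ chargeBound δ d := by
  unfold chargeBound
  split_ifs
  · linarith
  · have : 0 ≤ 1 / 3 - 2 * δ := by linarith
    positivity

/-- The probability that `u` comes before all its neighbours and some vertex of the independent
set `I` is a child of `u`. -/
theorem permProb_first_and_exists_child (hI : G.IsIndepSet (I : Set (Fin n))) {u : Fin n}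
    (hu : u ∈ H) {δ : ℝ} (hδ0 : 0 ≤ δ) (hδ : δ ≤ 1 / 400) (hδn : δ ≤ 1 / (200 * n)) :
    permProb (fun σ => IsFirst σ (closedNbrIn G H u) u ∧
      ∃ v ∈ I ∩ nbrIn G H u, IsChild G H u v σ) ≤
      (1 / 3 + δ) / ((#(nbrIn G H u) : ℝ) + 1) +
        ∑ v ∈ I ∩ nbrIn G H u, chargeBound δ #(nbrIn G H v) := by
  set M := I ∩ nbrIn G H u with hM
  have hN : ((#(nbrIn G H u) : ℝ) + 1) = ((#(closedNbrIn G H u) : ℕ) : ℝ) := by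
    rw [card_closedNbrIn]; push_cast; rfl
  have huM : ∀ v ∈ M, u ∈ nbrIn G H v := fun v hv => mem_nbrIn_symm hu (mem_of_mem_inter_right hv)
  have hdpos : ∀ v ∈ M, 0 < #(nbrIn G H v) := fun v hv => card_pos.2 ⟨u, huM v hv⟩
  have hP1 : permProb (fun σ => IsFirst σ (closedNbrIn G H u) u ∧
      ∃ v ∈ M, IsChild G H u v σ) ≤ 1 / (#(closedNbrIn G H u) : ℝ) := by
    rw [← permProb_isFirst (self_mem_closedNbrIn u)]
    exact permProb_mono fun σ h => h.1
  rw [hN]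
  rcases M.eq_empty_or_nonempty with hE | hne
  · rw [hE]
    simp only [notMem_empty, false_and, exists_false, and_false, sum_empty, add_zero]
    simp only [permProb, ind_false not_false, permMean_const]
    positivity
  have hcard : 2 ≤ #(closedNbrIn G H u) := by
    obtain ⟨v, hv⟩ := hne
    have : 0 < #(nbrIn G H u) := card_pos.2 ⟨v, mem_of_mem_inter_right hv⟩
    rw [card_closedNbrIn]; omega
  by_cases h1 : ∃ v ∈ M, #(nbrIn G H v) = 1
  · obtain ⟨v, hv, hv1⟩ := h1
    have h2 : chargeBound δ #(nbrIn G H v) ≤ ∑ v ∈ M, chargeBound δ #(nbrIn G H v) :=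
      single_le_sum (f := fun v => chargeBound δ #(nbrIn G H v))
        (fun w _ => chargeBound_nonneg hδ _) hv
    rw [chargeBound, if_pos hv1] at h2
    refine hP1.trans ?_
    have h3 : (2 : ℝ) ≤ #(closedNbrIn G H u) := by exact_mod_cast hcard
    -- A neighbour of degree one is charged enough for the trivial bound, with equality when `u` has
    -- a single neighbour.
    have h4 : 1 / (#(closedNbrIn G H u) : ℝ) ≤
        (1 / 3 + δ) / #(closedNbrIn G H u) + (1 / 3 - δ / 2) := by
      have h5 : (1 / 3 + δ) / (#(closedNbrIn G H u) : ℝ) + (1 / 3 - δ / 2) =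
          ((1 / 3 + δ) + (1 / 3 - δ / 2) * #(closedNbrIn G H u)) / #(closedNbrIn G H u) := by
        field_simp
      rw [h5]
      gcongr
      nlinarith
    linarith
  · push Not at h1
    have hd : ∀ v ∈ M, 2 ≤ #(nbrIn G H v) := fun v hv => by
      have := hdpos v hv; have := h1 v hv; omega
    have hsum : ∑ v ∈ M, chargeBound δ #(nbrIn G H v) =
        ∑ v ∈ M, (1 / 3 - 2 * δ) / ((#(nbrIn G H v) : ℝ) * (#(nbrIn G H v) + 1)) :=
      sum_congr rfl fun v hv => by rw [chargeBound, if_neg (h1 v hv)]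
    rw [hsum]
    refine prob_union_bound M hne (fun v => #(nbrIn G H v))
      (fun v => #(closedNbrIn G H u ∪ closedNbrIn G H v)) _ (by omega) hd
      (fun v _ => card_le_card subset_union_left)
      (fun v hv => card_add_card_le_card_union hI hv) hδ0 hδ ?_ hP1 ?_
    · refine hδn.trans ?_
      have h2 : #M ≤ n := (card_le_univ M).trans (by simp)
      have h3 : 0 < #M := card_pos.2 hne
      have h2' : (#M : ℝ) ≤ n := by exact_mod_cast h2
      have h3' : (0 : ℝ) < #M := by exact_mod_cast h3
      gcongr
    · have h2 : permProb (fun σ => IsFirst σ (closedNbrIn G H u) u ∧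
          ∃ v ∈ M, IsChild G H u v σ) ≤
          ∑ v ∈ M, permProb (fun σ => IsFirst σ (closedNbrIn G H u) u ∧ IsChild G H u v σ) -
          1 / #M * ∑ v ∈ M, ∑ w ∈ M, if v = w then 0 else
            permProb fun σ => (IsFirst σ (closedNbrIn G H u) u ∧ IsChild G H u v σ) ∧
              (IsFirst σ (closedNbrIn G H u) u ∧ IsChild G H u w σ) := by
        have h3 : ∀ v w, (if v = w then 0 else
            permProb fun σ => (IsFirst σ (closedNbrIn G H u) u ∧ IsChild G H u v σ) ∧
              (IsFirst σ (closedNbrIn G H u) u ∧ IsChild G H u w σ)) =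
            permMean fun σ => if v = w then 0 else
              ind ((IsFirst σ (closedNbrIn G H u) u ∧ IsChild G H u v σ) ∧
              (IsFirst σ (closedNbrIn G H u) u ∧ IsChild G H u w σ)) := by
          intro v w
          by_cases h : v = w
          · simp only [h, if_true, permMean_const]
          · simp only [h, if_false, permProb]
        simp only [h3]
        unfold permProb
        simp only [← permMean_sum, ← permMean_const_mul, ← permMean_sub]
        refine permMean_mono fun σ => ?_
        refine le_trans (ind_mono ?_) (ind_exists_le M
          (fun v => IsFirst σ (closedNbrIn G H u) u ∧ IsChild G H u v σ) hne)
        rintro ⟨h1, v, hv, h2⟩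
        exact ⟨v, hv, h1, h2⟩
      refine h2.trans ?_
      gcongr with v hv v hv w hw
      · exact (permProb_first_and_child (huM v hv)).le
      · split_ifs with hvw
        · rfl
        · exact permProb_first_and_two_children (huM v hv) (huM w hw) hvw
            (hI (mem_coe.2 (mem_of_mem_inter_left hv)) (mem_coe.2 (mem_of_mem_inter_left hw)) hvw)

end RandomForest

/-! ### Independent sets in the random forest and their expected size -/

section RandomForestSize

variable {n : ℕ} {G : SimpleGraph (Fin n)} {H I : Finset (Fin n)}

open Classical in
/-- An independent set in the forest of the vertices with at most one earlier neighbour: it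
consists of the vertices of `I` and of the roots outside `I` that have no child in `I`. -/
noncomputable def rootsAndMembers (G : SimpleGraph (Fin n)) (H I : Finset (Fin n))
    (σ : Equiv.Perm (Fin n)) : Finset (Fin n) :=
  {v ∈ I ∩ H | #(earlierNbrIn G H σ v) ≤ 1} ∪
    {u ∈ H \ I | IsFirst σ (closedNbrIn G H u) u ∧ ¬ ∃ v ∈ I ∩ nbrIn G H u, IsChild G H u v σ}

theorem mem_rootsAndMembers {σ : Equiv.Perm (Fin n)} {v : Fin n} :
    v ∈ rootsAndMembers G H I σ ↔ v ∈ H ∧ (v ∈ I ∧ #(earlierNbrIn G H σ v) ≤ 1 ∨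
      v ∉ I ∧ IsFirst σ (closedNbrIn G H v) v ∧
        ¬ ∃ w ∈ I ∩ nbrIn G H v, IsChild G H v w σ) := by
  simp only [rootsAndMembers, mem_union, mem_filter, mem_inter, mem_sdiff]
  tauto

/-- Adjacent roots would each precede the other, and a forest vertex of `I` adjacent to a root is
its child, in which case that root was left out. -/
theorem not_adj_rootsAndMembers (hI : G.IsIndepSet (I : Set (Fin n))) {σ : Equiv.Perm (Fin n)}
    {v w : Fin n} (hv : v ∈ rootsAndMembers G H I σ) (hw : w ∈ rootsAndMembers G H I σ) :
    ¬ G.Adj v w := by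
  have mixed : ∀ v w, v ∈ H → w ∈ H → v ∈ I → #(earlierNbrIn G H σ v) ≤ 1 →
      IsFirst σ (closedNbrIn G H w) w → (¬ ∃ x ∈ I ∩ nbrIn G H w, IsChild G H w x σ) →
      ¬ G.Adj v w := by
    intro v w hvH hwH hvI hv1 hw hno hadj
    refine hno ⟨v, mem_inter.2 ⟨hvI, mem_nbrIn.2 ⟨hvH, hadj.symm⟩⟩, ?_⟩
    exact isChild_of_card_earlierNbrIn (mem_nbrIn.2 ⟨hwH, hadj⟩)
      (hw v (mem_closedNbrIn.2 (Or.inr ⟨hvH, hadj.symm⟩)) hadj.ne) hv1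
  obtain ⟨hvH, hv⟩ := mem_rootsAndMembers.1 hv
  obtain ⟨hwH, hw⟩ := mem_rootsAndMembers.1 hw
  rcases hv with ⟨hvI, hv1⟩ | ⟨-, hvf, hvn⟩ <;> rcases hw with ⟨hwI, hw1⟩ | ⟨-, hwf, hwn⟩
  · exact fun hadj => hI (mem_coe.2 hvI) (mem_coe.2 hwI) hadj.ne hadj
  · exact mixed v w hvH hwH hvI hv1 hwf hwn
  · exact fun hadj => mixed w v hwH hvH hwI hw1 hvf hvn hadj.symm
  · intro hadj
    exact lt_asymm (hvf w (mem_closedNbrIn.2 (Or.inr ⟨hwH, hadj⟩)) hadj.ne.symm)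
      (hwf v (mem_closedNbrIn.2 (Or.inr ⟨hvH, hadj.symm⟩)) hadj.ne)

theorem card_earlierNbrIn_of_mem_rootsAndMembers {σ : Equiv.Perm (Fin n)} {v : Fin n}
    (hv : v ∈ rootsAndMembers G H I σ) : #(earlierNbrIn G H σ v) ≤ 1 := by
  obtain ⟨-, ⟨-, h⟩ | ⟨-, h, -⟩⟩ := mem_rootsAndMembers.1 hv
  · exact h
  · exact (card_earlierNbrIn_le_of_isFirst h).le.trans zero_le_one

/-- A set that contains every vertex of the forest without a later neighbour in the set is at
least as large as any independent set of the forest. -/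
theorem card_rootsAndMembers_le (hI : G.IsIndepSet (I : Set (Fin n)))
    {σ : Equiv.Perm (Fin n)} {S : Finset (Fin n)}
    (hS : ∀ v ∈ H, #(earlierNbrIn G H σ v) ≤ 1 → v ∉ S →
      ∃ c ∈ S, c ∈ H ∧ G.Adj v c ∧ σ v < σ c ∧ #(earlierNbrIn G H σ c) ≤ 1) :
    #(rootsAndMembers G H I σ) ≤ #(S ∩ H) := by
  have hex : ∀ v ∈ rootsAndMembers G H I σ, ∃ c ∈ S ∩ H, v = c ∨
      v ∉ S ∧ G.Adj v c ∧ σ v < σ c ∧ #(earlierNbrIn G H σ c) ≤ 1 := by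
    intro v hv
    have hvH := (mem_rootsAndMembers.1 hv).1
    by_cases hvS : v ∈ S
    · exact ⟨v, mem_inter.2 ⟨hvS, hvH⟩, Or.inl rfl⟩
    · obtain ⟨c, hc, hcH, h⟩ := hS v hvH (card_earlierNbrIn_of_mem_rootsAndMembers hv) hvS
      exact ⟨c, mem_inter.2 ⟨hc, hcH⟩, Or.inr ⟨hvS, h⟩⟩
  -- `f` keeps a vertex of `S` and sends any other to a child in `S`. A child has only one earlier
  -- neighbour, and no two selected vertices are adjacent, so `f` is injective.
  choose! f hf hf' using hex
  refine card_le_card_of_injOn f (fun v hv => hf v hv) ?_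
  intro v hv w hw hvw
  rcases hf' v hv with h | ⟨-, h1, h2, h3⟩ <;> rcases hf' w hw with h' | ⟨-, h1', h2', h3'⟩
  · rw [h, h', hvw]
  · rw [← hvw, ← h] at h1'
    exact absurd h1' (not_adj_rootsAndMembers hI hw hv)
  · rw [hvw, ← h'] at h1
    exact absurd h1 (not_adj_rootsAndMembers hI hv hw)
  · rw [← hvw] at h1' h2'
    exact card_le_one.1 h3 v
      (mem_earlierNbrIn.2 ⟨⟨(mem_rootsAndMembers.1 hv).1, h1.symm⟩, h2⟩) w
      (mem_earlierNbrIn.2 ⟨⟨(mem_rootsAndMembers.1 hw).1, h1'.symm⟩, h2'⟩)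

/-- The contribution of a vertex of degree `d` of the independent set. -/
noncomputable def vertexGain (δ : ℝ) (d : ℕ) : ℝ :=
  if d = 0 then 1 else if d = 1 then 2 / 3 + δ / 2 else (5 / 3 + 2 * δ) / ((d : ℝ) + 1)

/-- The charge is paid once per neighbour; for d ≥ 2 this leaves 2/(d+1) - (1/3 - 2δ)/(d+1). -/
theorem vertexGain_le (δ : ℝ) (v : Fin n) :
    vertexGain δ #(nbrIn G H v) ≤ permProb (fun σ => #(earlierNbrIn G H σ v) ≤ 1) -
      #(nbrIn G H v) * chargeBound δ #(nbrIn G H v) := by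
  unfold vertexGain chargeBound
  split_ifs with h0 h1 h1
  · omega
  · rw [permProb_card_earlierNbrIn_eq_one (by omega), h0]; simp
  · rw [permProb_card_earlierNbrIn_eq_one h1.le, h1]; push_cast; linarith
  · have hpos : 0 < #(nbrIn G H v) := Nat.pos_of_ne_zero h0
    refine le_trans (le_of_eq ?_)
      (sub_le_sub_right (permProb_card_earlierNbrIn_le_one v hpos) _)
    have : (0 : ℝ) < #(nbrIn G H v) := by exact_mod_cast hpos
    field_simp
    ring

/-- The expected size of a maximum independent set in the random forest. -/
theorem sum_vertexGain_le_permMean (hI : G.IsIndepSet (I : Set (Fin n)))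
    {S : Equiv.Perm (Fin n) → Finset (Fin n)}
    (hS : ∀ σ, ∀ v ∈ H, #(earlierNbrIn G H σ v) ≤ 1 → v ∉ S σ →
      ∃ c ∈ S σ, c ∈ H ∧ G.Adj v c ∧ σ v < σ c ∧ #(earlierNbrIn G H σ c) ≤ 1)
    {δ : ℝ} (hδ0 : 0 ≤ δ) (hδ : δ ≤ 1 / 400) (hδn : δ ≤ 1 / (200 * n)) :
    ∑ v ∈ I ∩ H, vertexGain δ #(nbrIn G H v) +
      ∑ u ∈ H \ I, (2 / 3 - δ) / ((#(nbrIn G H u) : ℝ) + 1) ≤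
      permMean fun σ => (#(S σ ∩ H) : ℝ) := by
  classical
  have h1 : ∑ v ∈ I ∩ H, permProb (fun σ => #(earlierNbrIn G H σ v) ≤ 1) +
      ∑ u ∈ H \ I, (permProb (fun σ => IsFirst σ (closedNbrIn G H u) u) -
        permProb (fun σ => IsFirst σ (closedNbrIn G H u) u ∧
          ∃ v ∈ I ∩ nbrIn G H u, IsChild G H u v σ)) ≤
      permMean fun σ => (#(S σ ∩ H) : ℝ) := by
    unfold permProb
    simp only [← permMean_sum, ← permMean_sub, ← permMean_add]
    refine permMean_mono fun σ => ?_
    have h2 : (#(rootsAndMembers G H I σ) : ℝ) ≤ #(S σ ∩ H) := by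
      exact_mod_cast card_rootsAndMembers_le hI (hS σ)
    refine le_trans (le_of_eq ?_) h2
    rw [rootsAndMembers, card_union_of_disjoint]
    · rw [Nat.cast_add, ← sum_boole, ← sum_boole]
      congr 1
      · refine sum_congr rfl fun v _ => ?_
        unfold ind; congr
      · refine sum_congr rfl fun v _ => ?_
        unfold ind
        split_ifs <;> simp_all
    · refine disjoint_filter_filter ?_
      exact disjoint_sdiff.mono_left inter_subset_left
  refine le_trans ?_ h1
  -- Double counting: by independence every neighbour in `H` of a vertex of `I` lies in `H \ I`.
  have h3 : ∑ u ∈ H \ I, ∑ v ∈ I ∩ nbrIn G H u, chargeBound δ #(nbrIn G H v) =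
      ∑ v ∈ I ∩ H, #(nbrIn G H v) * chargeBound δ #(nbrIn G H v) := by
    rw [sum_comm' (s' := fun v => nbrIn G H v) (t' := I ∩ H)]
    · simp
    · intro u v
      simp only [mem_sdiff, mem_inter, mem_nbrIn]
      constructor
      · rintro ⟨⟨h1, h2⟩, h3, h4, h5⟩
        exact ⟨⟨h1, h5.symm⟩, h3, h4⟩
      · rintro ⟨⟨h1, h5⟩, h3, h4⟩
        exact ⟨⟨h1, fun h => hI (mem_coe.2 h) (mem_coe.2 h3) h5.ne.symm h5.symm⟩, h3, h4, h5.symm⟩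
  have h4 : ∀ u ∈ H \ I, (2 / 3 - δ) / ((#(nbrIn G H u) : ℝ) + 1) -
      ∑ v ∈ I ∩ nbrIn G H u, chargeBound δ #(nbrIn G H v) ≤
      permProb (fun σ => IsFirst σ (closedNbrIn G H u) u) -
        permProb (fun σ => IsFirst σ (closedNbrIn G H u) u ∧
          ∃ v ∈ I ∩ nbrIn G H u, IsChild G H u v σ) := by
    intro u hu
    have h5 := permProb_first_and_exists_child hI (mem_sdiff.1 hu).1 hδ0 hδ hδn
    rw [permProb_isFirst (self_mem_closedNbrIn u), card_closedNbrIn]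
    push_cast
    have h6 : (2 / 3 - δ) / ((#(nbrIn G H u) : ℝ) + 1) =
        1 / ((#(nbrIn G H u) : ℝ) + 1) - (1 / 3 + δ) / ((#(nbrIn G H u) : ℝ) + 1) := by
      rw [← sub_div]; congr 1; ring
    linarith
  have h5 := sum_le_sum h4
  rw [sum_sub_distrib, h3] at h5
  have h6 := sum_le_sum fun v (_ : v ∈ I ∩ H) => vertexGain_le (G := G) (H := H) δ v
  rw [sum_sub_distrib] at h6
  linarith

end RandomForestSize

/-! ### Persistency from a stable assignment -/

section Persistency

variable {n M : ℕ}

/-- An assignment of units to slots with prices. Each vertex has several units and equally many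
slots; a unit may only own a slot of a neighbouring vertex, at a price that exceeds the price of
any other slot it could own by at most one, slots of positive price are owned, units that own
nothing face prices of at least `g + 2`, and no slot has price `g` or `g + 1`. -/
structure IsStableAssignment (G : SimpleGraph (Fin n)) (vert : Fin M → Fin n) (price : Fin M → ℕ)
    (Owns : Fin M → Fin M → Prop) (g : ℕ) : Prop where
  surj : ∀ v, ∃ x, vert x = v
  left_unique : ∀ x x' y, Owns x y → Owns x' y → x = x'
  right_unique : ∀ x y y', Owns x y → Owns x y' → y = y'
  adj : ∀ x y, Owns x y → G.Adj (vert x) (vert y)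
  price_le : ∀ x y y', Owns x y → G.Adj (vert x) (vert y') → price y ≤ price y' + 1
  owned : ∀ y, 0 < price y → ∃ x, Owns x y
  free : ∀ x y, (∀ z, ¬ Owns x z) → G.Adj (vert x) (vert y) → g + 2 ≤ price y
  pos : 1 ≤ g
  gap : ∀ y, price y ≠ g ∧ price y ≠ g + 1

/-- The vertices with a slot of price at least `g`. -/
def IsHigh (vert : Fin M → Fin n) (price : Fin M → ℕ) (g : ℕ) (v : Fin n) : Prop :=
  ∃ y, vert y = v ∧ g ≤ price y

/-- The vertices with a unit that owns no slot of price less than `g`. -/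
def IsPoor (vert : Fin M → Fin n) (price : Fin M → ℕ) (Owns : Fin M → Fin M → Prop) (g : ℕ)
    (v : Fin n) : Prop :=
  ∃ x, vert x = v ∧ ∀ y, Owns x y → g ≤ price y

variable {G : SimpleGraph (Fin n)} {vert : Fin M → Fin n} {price : Fin M → ℕ}
  {Owns : Fin M → Fin M → Prop} {g : ℕ}

theorem IsStableAssignment.two_le (h : IsStableAssignment G vert price Owns g) {y : Fin M}
    (hy : g ≤ price y) : g + 2 ≤ price y := by
  have := h.gap y; omega

/-- Slots of one vertex are open to the same units, so the owner of a high slot forces the others to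
within one of its price; the gap then makes all of them high. -/
theorem IsStableAssignment.high_slots (h : IsStableAssignment G vert price Owns g) {y : Fin M}
    (hy : IsHigh vert price g (vert y)) : g + 2 ≤ price y := by
  obtain ⟨z, hz, hgz⟩ := hy
  have h1 := h.two_le hgz
  obtain ⟨x, hx⟩ := h.owned z (by omega)
  have h2 := h.price_le x z y hx (by rw [← hz]; exact h.adj x z hx)
  exact h.two_le (by omega)

theorem IsStableAssignment.nbr_slots (h : IsStableAssignment G vert price Owns g) {v : Fin n}
    (hv : IsPoor vert price Owns g v) {y : Fin M} (hy : G.Adj v (vert y)) : g + 2 ≤ price y := by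
  obtain ⟨x, rfl, hx⟩ := hv
  by_cases hfree : ∀ z, ¬ Owns x z
  · exact h.free x y hfree hy
  · push Not at hfree
    obtain ⟨z, hz⟩ := hfree
    have h1 := h.two_le (hx z hz)
    have h2 := h.price_le x z y hz hy
    exact h.two_le (by omega)

theorem IsStableAssignment.high_of_adj (h : IsStableAssignment G vert price Owns g) {v w : Fin n}
    (hv : IsPoor vert price Owns g v) (hvw : G.Adj v w) : IsHigh vert price g w := by
  obtain ⟨y, rfl⟩ := h.surj w
  exact ⟨y, rfl, by have := h.nbr_slots hv hvw; omega⟩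

/-- With `exists_owner` this is complementary slackness in the bipartite double cover: poor vertices
on the unit side and non-high vertices on the slot side form an independent set of maximum weight.
-/
theorem IsStableAssignment.exists_owns (h : IsStableAssignment G vert price Owns g) {x : Fin M}
    (hx : ¬ IsPoor vert price Owns g (vert x)) :
    ∃ y, Owns x y ∧ ¬ IsHigh vert price g (vert y) := by
  by_contra hcon
  push Not at hcon
  exact hx ⟨x, rfl, fun y hy => by have := h.high_slots (hcon y hy); omega⟩

theorem IsStableAssignment.exists_owner (h : IsStableAssignment G vert price Owns g) {y : Fin M}
    (hy : IsHigh vert price g (vert y)) :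
    ∃ x, Owns x y ∧ IsPoor vert price Owns g (vert x) := by
  have h1 := h.high_slots hy
  obtain ⟨x, hx⟩ := h.owned y (by omega)
  exact ⟨x, hx, x, rfl, fun z hz => by rw [h.right_unique x z y hz hx]; omega⟩

/-- The number of units of the vertices in a set. -/
def unitCount (vert : Fin M → Fin n) (S : Finset (Fin n)) : ℕ := #{x | vert x ∈ S}

theorem unitCount_eq_sum (S : Finset (Fin n)) :
    unitCount vert S = ∑ v ∈ S, #{x | vert x = v} := by
  classical
  rw [unitCount, card_eq_sum_card_fiberwise (f := vert) (t := S)]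
  · refine sum_congr rfl fun v hv => ?_
    congr 1
    ext x
    simp only [mem_filter, mem_univ, true_and]
    exact ⟨fun h => h.2, fun h => ⟨h ▸ hv, h⟩⟩
  · intro x hx
    simpa using hx

open Classical in
/-- The vertices outside both parts of the persistent solution. -/
noncomputable def undecided (vert : Fin M → Fin n) (price : Fin M → ℕ)
    (Owns : Fin M → Fin M → Prop) (g : ℕ) : Finset (Fin n) :=
  {v | IsPoor vert price Owns g v ↔ IsHigh vert price g v}

open Classical in
/-- The vertices that the persistent solution takes. -/
noncomputable def takenPart (vert : Fin M → Fin n) (price : Fin M → ℕ)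
    (Owns : Fin M → Fin M → Prop) (g : ℕ) : Finset (Fin n) :=
  {v | IsPoor vert price Owns g v ∧ ¬ IsHigh vert price g v}

open Classical in
/-- The vertices that the persistent solution rejects. -/
noncomputable def rejectedPart (vert : Fin M → Fin n) (price : Fin M → ℕ)
    (Owns : Fin M → Fin M → Prop) (g : ℕ) : Finset (Fin n) :=
  {v | ¬ IsPoor vert price Owns g v ∧ IsHigh vert price g v}

theorem mem_undecided {v : Fin n} : v ∈ undecided vert price Owns g ↔
    (IsPoor vert price Owns g v ↔ IsHigh vert price g v) := by
  simp [undecided]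

theorem mem_takenPart {v : Fin n} : v ∈ takenPart vert price Owns g ↔
    IsPoor vert price Owns g v ∧ ¬ IsHigh vert price g v := by
  simp [takenPart]

theorem mem_rejectedPart {v : Fin n} : v ∈ rejectedPart vert price Owns g ↔
    ¬ IsPoor vert price Owns g v ∧ IsHigh vert price g v := by
  simp [rejectedPart]

theorem IsStableAssignment.rejected_of_adj (h : IsStableAssignment G vert price Owns g)
    {v w : Fin n} (hv : v ∈ takenPart vert price Owns g) (hvw : G.Adj v w) :
    w ∈ rejectedPart vert price Owns g := by
  rw [mem_takenPart] at hv
  exact mem_rejectedPart.2 ⟨fun hw => hv.2 (h.high_of_adj hw hvw.symm), h.high_of_adj hv.1 hvw⟩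

/-- An undecided vertex is both poor and high or neither. In the first case send a unit to the owner
of the slot with the same index, otherwise to the slot that it owns. The image stays undecided and
leaves `I` by adjacency; whether it is poor reveals which rule was used, so the map is injective. -/
theorem IsStableAssignment.unitCount_inter_undecided_le
    (h : IsStableAssignment G vert price Owns g) {I : Finset (Fin n)}
    (hI : G.IsIndepSet (I : Set (Fin n))) :
    unitCount vert (I ∩ undecided vert price Owns g) ≤
      unitCount vert (undecided vert price Owns g \ I) := by
  classical
  have hnI : ∀ {v w}, v ∈ I → G.Adj v w → w ∉ I := fun hv hvw hw =>
    hI (mem_coe.2 hv) (mem_coe.2 hw) hvw.ne hvw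
  have hex : ∀ x, vert x ∈ I ∩ undecided vert price Owns g → ∃ z,
      vert z ∈ undecided vert price Owns g \ I ∧
      ((Owns x z ∧ ¬ IsPoor vert price Owns g (vert z)) ∨
        (Owns z x ∧ IsPoor vert price Owns g (vert z))) := by
    intro x hx
    rw [mem_inter, mem_undecided] at hx
    obtain ⟨hxI, hx⟩ := hx
    by_cases hp : IsPoor vert price Owns g (vert x)
    · obtain ⟨z, hz, hzp⟩ := h.exists_owner (hx.1 hp)
      have hadj := h.adj z x hz
      exact ⟨z, mem_sdiff.2 ⟨mem_undecided.2 (iff_of_true hzp (h.high_of_adj hp hadj.symm)),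
        hnI hxI hadj.symm⟩, Or.inr ⟨hz, hzp⟩⟩
    · obtain ⟨z, hz, hzh⟩ := h.exists_owns hp
      have hadj := h.adj x z hz
      have hzp : ¬ IsPoor vert price Owns g (vert z) := fun hzp =>
        hp (hx.2 (h.high_of_adj hzp hadj.symm))
      exact ⟨z, mem_sdiff.2 ⟨mem_undecided.2 (iff_of_false hzp hzh), hnI hxI hadj⟩,
        Or.inl ⟨hz, hzp⟩⟩
  choose! f hf hf' using hex
  refine card_le_card_of_injOn f (fun x hx => ?_) ?_
  · simpa using hf x (by simpa using hx)
  · intro x hx x' hx' hxx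
    have hx := hf' x (by simpa using hx)
    have hx' := hf' x' (by simpa using hx')
    rw [← hxx] at hx'
    rcases hx with ⟨h1, h2⟩ | ⟨h1, h2⟩ <;> rcases hx' with ⟨h3, h4⟩ | ⟨h3, h4⟩
    · exact h.left_unique _ _ _ h1 h3
    · exact absurd h4 h2
    · exact absurd h2 h4
    · exact h.right_unique _ _ _ h1 h3

-- High slots are owned by distinct units of poor vertices, and free units belong to poor vertices
-- too. Vertices that are both poor and high cancel from the comparison.
open Classical in
theorem IsStableAssignment.unitCount_rejectedPart_add_le
    (h : IsStableAssignment G vert price Owns g) :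
    unitCount vert (rejectedPart vert price Owns g) + #{x | ∀ y, ¬ Owns x y} ≤
      unitCount vert (takenPart vert price Owns g) := by
  set B : Finset (Fin M) := {x | IsPoor vert price Owns g (vert x) ∧
    IsHigh vert price g (vert x)} with hB
  suffices unitCount vert (rejectedPart vert price Owns g) + #B + #{x | ∀ y, ¬ Owns x y} ≤
      unitCount vert (takenPart vert price Owns g) + #B by omega
  have h1 : unitCount vert (rejectedPart vert price Owns g) + #B =
      #{y | IsHigh vert price g (vert y)} := by
    rw [unitCount, ← card_union_of_disjoint]
    · congr 1
      ext x
      simp only [hB, mem_union, mem_filter, mem_univ, true_and, mem_rejectedPart]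
      tauto
    · rw [disjoint_left]
      intro x
      simp only [hB, mem_filter, mem_univ, true_and, mem_rejectedPart]
      tauto
  have h2 : unitCount vert (takenPart vert price Owns g) + #B =
      #{y | IsPoor vert price Owns g (vert y)} := by
    rw [unitCount, ← card_union_of_disjoint]
    · congr 1
      ext x
      simp only [hB, mem_union, mem_filter, mem_univ, true_and, mem_takenPart]
      tauto
    · rw [disjoint_left]
      intro x
      simp only [hB, mem_filter, mem_univ, true_and, mem_takenPart]
      tauto
  rw [h1, h2]
  have hex : ∀ y, IsHigh vert price g (vert y) → ∃ x, Owns x y ∧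
      IsPoor vert price Owns g (vert x) := fun y hy => h.exists_owner hy
  choose! f hf hf' using hex
  have h3 : #{y | IsHigh vert price g (vert y)} =
      #(({y | IsHigh vert price g (vert y)} : Finset (Fin M)).image f) := by
    rw [card_image_of_injOn]
    intro y hy y' hy' hyy
    have h4 := hf y (by simpa using hy)
    have h5 := hf y' (by simpa using hy')
    rw [← hyy] at h5
    exact h.right_unique _ _ _ h4 h5
  rw [h3, ← card_union_of_disjoint]
  · refine card_le_card fun x hx => ?_
    rw [mem_filter]
    refine ⟨mem_univ _, ?_⟩
    rcases mem_union.1 hx with hx | hx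
    · obtain ⟨y, hy, rfl⟩ := mem_image.1 hx
      exact hf' y (by simpa using hy)
    · have hx : ∀ y, ¬ Owns x y := by simpa using hx
      exact ⟨x, rfl, fun y hy => absurd hy (hx y)⟩
  · rw [disjoint_left]
    intro x hx hx'
    obtain ⟨y, hy, rfl⟩ := mem_image.1 hx
    have hx' : ∀ z, ¬ Owns (f y) z := by simpa using hx'
    exact hx' y (hf y (by simpa using hy))

open Classical in
/-- Rejected vertices have at least their own weight of neighbours among the taken ones. -/
theorem IsStableAssignment.unitCount_le_of_subset_rejectedPart
    (h : IsStableAssignment G vert price Owns g) {S : Finset (Fin n)}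
    (hS : S ⊆ rejectedPart vert price Owns g) :
    unitCount vert S ≤
      unitCount vert {u ∈ takenPart vert price Owns g | ∃ v ∈ S, G.Adj v u} := by
  have h1 := h.unitCount_rejectedPart_add_le
  set V0 := rejectedPart vert price Owns g
  set V1 := takenPart vert price Owns g
  set T : Finset (Fin n) := {u ∈ V1 | ∃ v ∈ S, G.Adj v u} with hT
  have hsplit : ∀ A B : Finset (Fin n), A ⊆ B →
      unitCount vert A + unitCount vert (B \ A) = unitCount vert B := by
    intro A B hAB
    simp only [unitCount_eq_sum]
    rw [add_comm, sum_sdiff hAB]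
  have h2 := hsplit S V0 hS
  have h3 := hsplit T V1 (filter_subset _ _)
  -- A unit of a taken vertex outside `T` is free or owns a slot of a rejected vertex, which cannot
  -- be in `S`. Subtracting this from `h1` gives the claim.
  have h4 : unitCount vert (V1 \ T) ≤
      unitCount vert (V0 \ S) + #{x | ∀ y, ¬ Owns x y} := by
    have hex : ∀ x, vert x ∈ V1 \ T → ¬ (∀ y, ¬ Owns x y) → ∃ y, Owns x y ∧
        vert y ∈ V0 \ S := by
      intro x hx hno
      push Not at hno
      obtain ⟨y, hy⟩ := hno
      have hadj := h.adj x y hy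
      refine ⟨y, hy, mem_sdiff.2 ⟨h.rejected_of_adj (mem_sdiff.1 hx).1 hadj, fun hyS => ?_⟩⟩
      exact (mem_sdiff.1 hx).2 (mem_filter.2 ⟨(mem_sdiff.1 hx).1, _, hyS, hadj.symm⟩)
    choose! f hf hf' using hex
    rw [unitCount, ← card_filter_add_card_filter_not (fun x => ¬ ∀ y, ¬ Owns x y)]
    refine add_le_add ?_ ?_
    · refine card_le_card_of_injOn f (fun x hx => ?_) ?_
      · simp only [coe_filter, mem_filter, mem_univ, true_and, Set.mem_ofPred_eq] at hx ⊢
        exact hf' x hx.1 hx.2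
      · intro x hx x' hx' hxx
        simp only [coe_filter, mem_filter, mem_univ, true_and, Set.mem_ofPred_eq] at hx hx'
        have h5 := hf x hx.1 hx.2
        have h6 := hf x' hx'.1 hx'.2
        rw [← hxx] at h6
        exact h.left_unique _ _ _ h5 h6
    · refine card_le_card fun x hx => ?_
      simp only [mem_filter, mem_univ, true_and, not_not] at hx ⊢
      exact hx.2
  omega

end Persistency

/-! ### The value of the combined solution -/

section CombinedValue

theorem canonicalValue_le_one (ρ : ℝ) (d : ℕ) : canonicalValue ρ d ≤ 1 := min_le_left _ _

theorem canonicalValue_le_div (ρ : ℝ) (d : ℕ) : canonicalValue ρ d ≤ ρ / ((d : ℝ) + 1) :=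
  min_le_right _ _

theorem natDiv_bounds (K d : ℕ) :
    (K : ℝ) / ((d : ℝ) + 1) - 1 ≤ ((K / (d + 1) : ℕ) : ℝ) ∧
      ((K / (d + 1) : ℕ) : ℝ) ≤ (K : ℝ) / ((d : ℝ) + 1) := by
  have h0 : (0 : ℝ) < (d : ℝ) + 1 := by positivity
  constructor
  · have h1 : K < (K / (d + 1) + 1) * (d + 1) := by
      have := Nat.div_add_mod K (d + 1)
      have := Nat.mod_lt K (Nat.succ_pos d)
      nlinarith
    have h2 : (K : ℝ) < (((K / (d + 1) : ℕ) : ℝ) + 1) * ((d : ℝ) + 1) := by exact_mod_cast h1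
    rw [sub_le_iff_le_add, div_le_iff₀ h0]
    exact h2.le
  · rw [le_div_iff₀ h0]
    have := Nat.div_mul_le_self K (d + 1)
    exact_mod_cast this

/-- Here `d` is a degree in the graph and `e` one in the undecided part. The coefficients add up to
7/3 + δ, and δ/(d+1) ≥ 1/(400n²) pays for rounding the weight down. For d = e = 1 the terms in δ
cancel and the sum is exactly 1. -/
theorem canonicalValue_le_vertexGain {n d e : ℕ} (hd : d + 1 ≤ n) (he : e ≤ d) {δ : ℝ}
    (hδ : δ = 1 / (400 * n)) :
    canonicalValue (7 / 3) d ≤ vertexGain δ e +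
      (2 / 3 - δ) * (((400 * n ^ 2 / (d + 1) : ℕ) : ℝ) / (400 * (n : ℝ) ^ 2)) := by
  have hn : (1 : ℝ) ≤ n := by exact_mod_cast (by omega : 1 ≤ n)
  have hδ0 : 0 < δ := by rw [hδ]; positivity
  have hδ1 : δ ≤ 1 / 400 := by
    rw [hδ]
    gcongr
    linarith
  have hK : (0 : ℝ) < 400 * (n : ℝ) ^ 2 := by positivity
  have hW := (natDiv_bounds (400 * n ^ 2) d).1
  have hW0 : (0 : ℝ) ≤ ((400 * n ^ 2 / (d + 1) : ℕ) : ℝ) := by positivity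
  have hc : 0 ≤ 2 / 3 - δ := by linarith
  obtain rfl | rfl | hd2 : d = 0 ∨ d = 1 ∨ 2 ≤ d := by omega
  · obtain rfl : e = 0 := by omega
    have h1 := canonicalValue_le_one (7 / 3) 0
    have : vertexGain δ 0 = 1 := by simp [vertexGain]
    rw [this]
    have := mul_nonneg hc (div_nonneg hW0 hK.le)
    linarith
  · have h1 := canonicalValue_le_one (7 / 3) 1
    have h2 : ((400 * n ^ 2 / (1 + 1) : ℕ) : ℝ) = 200 * (n : ℝ) ^ 2 := by
      rw [show 400 * n ^ 2 / (1 + 1) = 200 * n ^ 2 by omega]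
      push_cast; ring
    have h3 : (200 * (n : ℝ) ^ 2) / (400 * (n : ℝ) ^ 2) = 1 / 2 := by
      field_simp; norm_num
    rw [h2, h3]
    have h4 : 2 / 3 + δ / 2 ≤ vertexGain δ e := by
      obtain rfl | rfl : e = 0 ∨ e = 1 := by omega
      · simp only [vertexGain, if_true]; linarith
      · simp [vertexGain]
    linarith
  · refine (canonicalValue_le_div _ _).trans ?_
    have hd0 : (0 : ℝ) < (d : ℝ) + 1 := by positivity
    have hd2' : (2 : ℝ) ≤ d := by exact_mod_cast hd2
    have hdn : (d : ℝ) + 1 ≤ n := by exact_mod_cast hd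
    have h1 : (5 / 3 + 2 * δ) / ((d : ℝ) + 1) ≤ vertexGain δ e := by
      have h3 : (5 / 3 + 2 * δ) / ((d : ℝ) + 1) ≤ (5 / 3 + 2 * δ) / 3 := by
        gcongr; linarith
      unfold vertexGain
      split_ifs
      · linarith
      · linarith
      · gcongr
    have h2 : 1 / ((d : ℝ) + 1) - 1 / (400 * (n : ℝ) ^ 2) ≤
        ((400 * n ^ 2 / (d + 1) : ℕ) : ℝ) / (400 * (n : ℝ) ^ 2) := by
      rw [le_div_iff₀ hK]
      refine le_trans (le_of_eq ?_) hW
      push_cast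
      field_simp
    have h3 := mul_le_mul_of_nonneg_left h2 hc
    have h4 : 2 / 3 * (1 / (400 * (n : ℝ) ^ 2)) ≤ δ * (1 / ((d : ℝ) + 1)) := by
      calc 2 / 3 * (1 / (400 * (n : ℝ) ^ 2)) ≤ 1 * (1 / (400 * (n : ℝ) ^ 2)) := by
            gcongr; norm_num
        _ = δ * (1 / n) := by rw [hδ]; field_simp
        _ ≤ _ := by gcongr
    have h5 : (5 / 3 + 2 * δ) / ((d : ℝ) + 1) = (5 / 3 + 2 * δ) * (1 / ((d : ℝ) + 1)) := by ring
    have h6 : 7 / 3 / ((d : ℝ) + 1) = 7 / 3 * (1 / ((d : ℝ) + 1)) := by ring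
    have h7 : 0 ≤ δ * (1 / (400 * (n : ℝ) ^ 2)) := by positivity
    rw [h6]
    rw [h5] at h1
    nlinarith

/-- The factor 3 instead of 7/3 leaves (2/3)/(d+1) for the rounding. It is affordable since the
vertices that pay have degree at least two and hence weight at most a third of 400n². -/
theorem canonicalValue_le_weight {n d : ℕ} (hd : d + 1 ≤ n) :
    canonicalValue (7 / 3) d ≤
      3 / (400 * (n : ℝ) ^ 2) * ((400 * n ^ 2 / (d + 1) : ℕ) : ℝ) := by
  have hn : (1 : ℝ) ≤ n := by exact_mod_cast (by omega : 1 ≤ n)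
  have hdn : (d : ℝ) + 1 ≤ n := by exact_mod_cast hd
  have hd0 : (0 : ℝ) < (d : ℝ) + 1 := by positivity
  have hW := (natDiv_bounds (400 * n ^ 2) d).1
  refine (canonicalValue_le_div _ _).trans ?_
  have hK : (0 : ℝ) < 400 * (n : ℝ) ^ 2 := by positivity
  have h1 : 3 / (400 * (n : ℝ) ^ 2) * (((400 * n ^ 2 : ℕ) : ℝ) / ((d : ℝ) + 1) - 1) ≤
      3 / (400 * (n : ℝ) ^ 2) * ((400 * n ^ 2 / (d + 1) : ℕ) : ℝ) := by gcongr
  refine le_trans ?_ h1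
  have h2 : 3 / (400 * (n : ℝ) ^ 2) * (((400 * n ^ 2 : ℕ) : ℝ) / ((d : ℝ) + 1) - 1) =
      3 / ((d : ℝ) + 1) - 3 / (400 * (n : ℝ) ^ 2) := by
    push_cast
    field_simp
  rw [h2]
  have h3 : 3 / (400 * (n : ℝ) ^ 2) ≤ (2 / 3) / ((d : ℝ) + 1) := by
    rw [div_le_div_iff₀ hK hd0]
    nlinarith
  have h4 : 3 / ((d : ℝ) + 1) = 7 / 3 / ((d : ℝ) + 1) + (2 / 3) / ((d : ℝ) + 1) := by
    rw [← add_div]; norm_num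
  linarith

variable {n M : ℕ} {G : SimpleGraph (Fin n)} [DecidableRel G.Adj] {vert : Fin M → Fin n}
  {price : Fin M → ℕ} {Owns : Fin M → Fin M → Prop} {g : ℕ} {I : Finset (Fin n)}

theorem card_nbrIn_le_degree (H : Finset (Fin n)) (v : Fin n) : #(nbrIn G H v) ≤ G.degree v := by
  rw [← G.card_neighborFinset_eq_degree]
  refine card_le_card fun w hw => ?_
  rw [SimpleGraph.mem_neighborFinset]
  exact (mem_nbrIn.1 hw).2

theorem degree_succ_le (v : Fin n) : G.degree v + 1 ≤ n := by
  have := G.degree_lt_card_verts v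
  simpa using this

theorem IsStableAssignment.sum_canonicalValue_undecided_le
    (h : IsStableAssignment G vert price Owns g)
    (hW : ∀ v, #{x | vert x = v} = 400 * n ^ 2 / (G.degree v + 1))
    (hI : G.IsIndepSet (I : Set (Fin n))) {S : Equiv.Perm (Fin n) → Finset (Fin n)}
    (hS : ∀ σ, ∀ v ∈ undecided vert price Owns g,
      #(earlierNbrIn G (undecided vert price Owns g) σ v) ≤ 1 → v ∉ S σ →
      ∃ c ∈ S σ, c ∈ undecided vert price Owns g ∧ G.Adj v c ∧ σ v < σ c ∧
        #(earlierNbrIn G (undecided vert price Owns g) σ c) ≤ 1) :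
    ∑ v ∈ I ∩ undecided vert price Owns g, canonicalValue (7 / 3) (G.degree v) ≤
      permMean fun σ => (#(S σ ∩ undecided vert price Owns g) : ℝ) := by
  have hle := h.unitCount_inter_undecided_le hI
  set H := undecided vert price Owns g
  rcases Nat.eq_zero_or_pos n with rfl | hn
  · have : I ∩ H = ∅ := by
      ext x; exact x.elim0
    rw [this, sum_empty]
    have := permMean_mono (n := 0) (f := fun _ => 0) (g := fun σ => (#(S σ ∩ H) : ℝ))
      (fun σ => by positivity)
    rwa [permMean_const] at this
  have hn1 : (1 : ℝ) ≤ n := by exact_mod_cast hn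
  set δ : ℝ := 1 / (400 * n) with hδ
  have hδ0 : 0 ≤ δ := by positivity
  have hδ1 : δ ≤ 1 / 400 := by
    rw [hδ]; gcongr; linarith
  have hδ2 : δ ≤ 1 / (200 * n) := by
    rw [hδ]; gcongr; norm_num
  refine le_trans ?_ (sum_vertexGain_le_permMean hI hS hδ0 hδ1 hδ2)
  have hK : (0 : ℝ) < 400 * (n : ℝ) ^ 2 := by positivity
  have hc : 0 ≤ 2 / 3 - δ := by linarith
  have h1 : ∑ v ∈ I ∩ H, ((400 * n ^ 2 / (G.degree v + 1) : ℕ) : ℝ) ≤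
      ∑ v ∈ H \ I, ((400 * n ^ 2 / (G.degree v + 1) : ℕ) : ℝ) := by
    simp only [unitCount_eq_sum, hW] at hle
    exact_mod_cast hle
  -- On this side rounding down helps, and so does passing to the smaller degree in `H`.
  have h2 : ∀ u ∈ H \ I, (2 / 3 - δ) / (400 * (n : ℝ) ^ 2) *
      ((400 * n ^ 2 / (G.degree u + 1) : ℕ) : ℝ) ≤
      (2 / 3 - δ) / ((#(nbrIn G H u) : ℝ) + 1) := by
    intro u _
    have h3 := (natDiv_bounds (400 * n ^ 2) (G.degree u)).2
    have h4 : (#(nbrIn G H u) : ℝ) ≤ G.degree u := by exact_mod_cast card_nbrIn_le_degree H u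
    calc (2 / 3 - δ) / (400 * (n : ℝ) ^ 2) * ((400 * n ^ 2 / (G.degree u + 1) : ℕ) : ℝ)
        ≤ (2 / 3 - δ) / (400 * (n : ℝ) ^ 2) *
          (((400 * n ^ 2 : ℕ) : ℝ) / ((G.degree u : ℝ) + 1)) := by gcongr
      _ = (2 / 3 - δ) / ((G.degree u : ℝ) + 1) := by push_cast; field_simp
      _ ≤ _ := by gcongr
  have h3 := sum_le_sum h2
  rw [← mul_sum] at h3
  have h4 := mul_le_mul_of_nonneg_left h1 (div_nonneg hc hK.le)
  have h5 := sum_le_sum fun v (_ : v ∈ I ∩ H) =>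
    canonicalValue_le_vertexGain (degree_succ_le (G := G) v) (card_nbrIn_le_degree H v) hδ
  rw [sum_add_distrib] at h5
  have h6 : ∑ v ∈ I ∩ H, (2 / 3 - δ) *
      (((400 * n ^ 2 / (G.degree v + 1) : ℕ) : ℝ) / (400 * (n : ℝ) ^ 2)) =
      (2 / 3 - δ) / (400 * (n : ℝ) ^ 2) *
        ∑ v ∈ I ∩ H, ((400 * n ^ 2 / (G.degree v + 1) : ℕ) : ℝ) := by
    rw [mul_sum]
    exact sum_congr rfl fun v _ => by ring
  linarith

/-- A vertex with a neighbour of degree one in V1 \ I is paid for by that neighbour, which has no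
other to pay for. The remaining ones only have taken neighbours of degree at least two, so
`unitCount_le_of_subset_rejectedPart` converts weight into cardinality. The two groups of payers are
disjoint. -/
theorem IsStableAssignment.sum_canonicalValue_rejected_le
    (h : IsStableAssignment G vert price Owns g)
    (hW : ∀ v, #{x | vert x = v} = 400 * n ^ 2 / (G.degree v + 1))
    (hI : G.IsIndepSet (I : Set (Fin n))) :
    ∑ v ∈ I ∩ rejectedPart vert price Owns g, canonicalValue (7 / 3) (G.degree v) ≤
      #(takenPart vert price Owns g \ I) := by
  classical
  set V0 := rejectedPart vert price Owns g with hV0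
  set V1 := takenPart vert price Owns g with hV1
  set T : Finset (Fin n) := {u ∈ V1 \ I | G.degree u = 1} with hT
  set S1 : Finset (Fin n) := {v ∈ I ∩ V0 | ∃ u ∈ T, G.Adj u v} with hS1
  set S2 : Finset (Fin n) := {v ∈ I ∩ V0 | ¬ ∃ u ∈ T, G.Adj u v} with hS2
  have hsplit : ∑ v ∈ I ∩ V0, canonicalValue (7 / 3) (G.degree v) =
      ∑ v ∈ S1, canonicalValue (7 / 3) (G.degree v) +
        ∑ v ∈ S2, canonicalValue (7 / 3) (G.degree v) :=
    (sum_filter_add_sum_filter_not _ _ _).symm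
  have hS1le : ∑ v ∈ S1, canonicalValue (7 / 3) (G.degree v) ≤ #T := by
    have h1 : #S1 ≤ #T := by
      have hex : ∀ v ∈ S1, ∃ u ∈ T, G.Adj u v := fun v hv => (mem_filter.1 hv).2
      choose! f hf hf' using hex
      refine card_le_card_of_injOn f (fun v hv => hf v hv) ?_
      intro v hv w hw hvw
      have h2 : #(G.neighborFinset (f v)) = 1 := by
        rw [G.card_neighborFinset_eq_degree]
        exact (mem_filter.1 (hf v hv)).2
      have h3 := hf' w hw
      rw [← hvw] at h3
      exact card_le_one.1 h2.le v ((G.mem_neighborFinset _ _).2 (hf' v hv)) w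
        ((G.mem_neighborFinset _ _).2 h3)
    calc ∑ v ∈ S1, canonicalValue (7 / 3) (G.degree v) ≤ ∑ v ∈ S1, (1 : ℝ) :=
          sum_le_sum fun v _ => canonicalValue_le_one _ _
      _ = #S1 := by simp
      _ ≤ #T := by exact_mod_cast h1
  set T2 : Finset (Fin n) := {u ∈ V1 | ∃ v ∈ S2, G.Adj v u} with hT2
  have hle : unitCount vert S2 ≤ unitCount vert T2 := by
    refine (h.unitCount_le_of_subset_rejectedPart
      ((filter_subset _ _).trans inter_subset_right)).trans (le_of_eq ?_)
    congr!
  have hS2le : ∑ v ∈ S2, canonicalValue (7 / 3) (G.degree v) ≤ #T2 := by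
    simp only [unitCount_eq_sum, hW] at hle
    have hle' : ∑ v ∈ S2, ((400 * n ^ 2 / (G.degree v + 1) : ℕ) : ℝ) ≤
      ∑ v ∈ T2, ((400 * n ^ 2 / (G.degree v + 1) : ℕ) : ℝ) := by exact_mod_cast hle
    have h1 := sum_le_sum fun v (_ : v ∈ S2) =>
      canonicalValue_le_weight (degree_succ_le (G := G) v)
    rw [← mul_sum] at h1
    have h2 : ∀ u ∈ T2, 3 / (400 * (n : ℝ) ^ 2) *
        ((400 * n ^ 2 / (G.degree u + 1) : ℕ) : ℝ) ≤ 1 := by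
      intro u hu
      obtain ⟨huV, v, hv, hadj⟩ := mem_filter.1 hu
      have hn : (1 : ℝ) ≤ n := by exact_mod_cast (by have := u.2; omega : 1 ≤ n)
      obtain ⟨hvI, hvn⟩ := mem_filter.1 hv
      have huI : u ∉ I := fun hu' =>
        hI (mem_coe.2 (mem_inter.1 hvI).1) (mem_coe.2 hu') hadj.ne hadj
      have hd1 : G.degree u ≠ 1 := fun hd =>
        hvn ⟨u, mem_filter.2 ⟨mem_sdiff.2 ⟨huV, huI⟩, hd⟩, hadj.symm⟩
      have hd0 : 0 < G.degree u := (G.degree_pos_iff_exists_adj u).2 ⟨v, hadj.symm⟩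
      have hd : (2 : ℝ) ≤ G.degree u := by exact_mod_cast (by omega : 2 ≤ G.degree u)
      have h3 := (natDiv_bounds (400 * n ^ 2) (G.degree u)).2
      calc 3 / (400 * (n : ℝ) ^ 2) * ((400 * n ^ 2 / (G.degree u + 1) : ℕ) : ℝ)
          ≤ 3 / (400 * (n : ℝ) ^ 2) * (((400 * n ^ 2 : ℕ) : ℝ) / ((G.degree u : ℝ) + 1)) := by
            gcongr
        _ = 3 / ((G.degree u : ℝ) + 1) := by push_cast; field_simp
        _ ≤ 1 := by
          rw [div_le_one (by positivity)]; linarith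
    have h3 := sum_le_sum h2
    rw [← mul_sum] at h3
    have h4 : 3 / (400 * (n : ℝ) ^ 2) * ∑ v ∈ S2, ((400 * n ^ 2 / (G.degree v + 1) : ℕ) : ℝ) ≤
        3 / (400 * (n : ℝ) ^ 2) * ∑ v ∈ T2, ((400 * n ^ 2 / (G.degree v + 1) : ℕ) : ℝ) := by
      gcongr
    have h5 : ∑ u ∈ T2, (1 : ℝ) = #T2 := by simp
    linarith
  have hcard : #T + #T2 ≤ #(V1 \ I) := by
    rw [← card_union_of_disjoint]
    · refine card_le_card (union_subset (filter_subset _ _) fun u hu => ?_)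
      obtain ⟨huV, v, hv, hadj⟩ := mem_filter.1 hu
      refine mem_sdiff.2 ⟨huV, fun hu' => ?_⟩
      exact hI (mem_coe.2 (mem_inter.1 (mem_filter.1 hv).1).1) (mem_coe.2 hu') hadj.ne hadj
    · rw [disjoint_left]
      intro u hu hu2
      obtain ⟨-, v, hv, hadj⟩ := mem_filter.1 hu2
      exact (mem_filter.1 hv).2 ⟨u, hu, hadj.symm⟩
  have hcard' : (#T : ℝ) + #T2 ≤ #(V1 \ I) := by exact_mod_cast hcard
  linarith

/-- The persistent part together with a maximum independent set of the random forest in the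
undecided part recovers the canonical value. -/
theorem IsStableAssignment.sum_canonicalValue_le
    (h : IsStableAssignment G vert price Owns g)
    (hW : ∀ v, #{x | vert x = v} = 400 * n ^ 2 / (G.degree v + 1))
    (hI : G.IsIndepSet (I : Set (Fin n))) {S : Equiv.Perm (Fin n) → Finset (Fin n)}
    (hS : ∀ σ, ∀ v ∈ undecided vert price Owns g,
      #(earlierNbrIn G (undecided vert price Owns g) σ v) ≤ 1 → v ∉ S σ →
      ∃ c ∈ S σ, c ∈ undecided vert price Owns g ∧ G.Adj v c ∧ σ v < σ c ∧
        #(earlierNbrIn G (undecided vert price Owns g) σ c) ≤ 1)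
    (hV : ∀ σ, takenPart vert price Owns g ⊆ S σ) :
    ∑ v ∈ I, canonicalValue (7 / 3) (G.degree v) ≤ permMean fun σ => (#(S σ) : ℝ) := by
  classical
  set V0 := rejectedPart vert price Owns g with hV0
  set V1 := takenPart vert price Owns g with hV1
  set H := undecided vert price Owns g with hH
  have hun := h.sum_canonicalValue_undecided_le hW hI hS
  have hrej := h.sum_canonicalValue_rejected_le hW hI
  have h1 : ∑ v ∈ I, canonicalValue (7 / 3) (G.degree v) =
      ∑ v ∈ I ∩ H, canonicalValue (7 / 3) (G.degree v) +
      ∑ v ∈ I ∩ V0, canonicalValue (7 / 3) (G.degree v) +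
      ∑ v ∈ I ∩ V1, canonicalValue (7 / 3) (G.degree v) := by
    rw [← sum_union, ← sum_union]
    · refine sum_congr ?_ fun _ _ => rfl
      ext v
      simp only [mem_union, mem_inter, hH, hV0, hV1, mem_undecided, mem_rejectedPart,
        mem_takenPart]
      tauto
    all_goals
      rw [disjoint_left]
      intro v
      simp only [mem_union, mem_inter, hH, hV0, hV1, mem_undecided, mem_rejectedPart,
        mem_takenPart]
      tauto
  have h2 : ∑ v ∈ I ∩ V1, canonicalValue (7 / 3) (G.degree v) ≤ #(V1 ∩ I) := by
    rw [inter_comm V1 I]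
    calc _ ≤ ∑ v ∈ I ∩ V1, (1 : ℝ) := sum_le_sum fun v _ => canonicalValue_le_one _ _
      _ = _ := by simp
  have h3 : (#(V1 \ I) : ℝ) + #(V1 ∩ I) = #V1 := by
    exact_mod_cast card_sdiff_add_card_inter V1 I
  have h4 : (permMean fun σ => (#(S σ ∩ H) : ℝ)) + #V1 ≤ permMean fun σ => (#(S σ) : ℝ) := by
    rw [← permMean_const (n := n) (#V1 : ℝ), ← permMean_add]
    refine permMean_mono fun σ => ?_
    have h5 : #(S σ ∩ H) + #V1 ≤ #(S σ) := by
      rw [← card_union_of_disjoint]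
      · exact card_le_card (union_subset inter_subset_left (hV σ))
      · rw [disjoint_left]
        intro v
        simp only [mem_inter, hH, hV1, mem_undecided, mem_takenPart]
        tauto
    exact_mod_cast h5
  linarith

end CombinedValue

/-! ### Reasoning about programs without random draws -/

namespace RAM

/-- The distribution of the configuration `t` steps after the configuration `C`. -/
noncomputable def runFrom (C : Config) : ℕ → PMF Config
  | 0 => PMF.pure C
  | t + 1 => (step C).bind fun D => runFrom D t

/-- `run` adds steps at the end while `runFrom` peels them off at the front, the form needed for
symbolic execution. -/
theorem runFrom_succ_eq_bind (C : Config) (t : ℕ) :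
    runFrom C (t + 1) = (runFrom C t).bind step := by
  induction t generalizing C with
  | zero => simp [runFrom]
  | succ t ih =>
    rw [runFrom, funext ih]
    conv_rhs => rw [runFrom]
    rw [PMF.bind_bind]

theorem run_eq_runFrom (c : Cmd) (s : State) (t : ℕ) : run c s t = runFrom ⟨[c], s⟩ t := by
  induction t with
  | zero => rfl
  | succ t ih => rw [run, ih, runFrom_succ_eq_bind]

theorem runFrom_of_step {C D : Config} (h : step C = PMF.pure D) (t : ℕ) :
    runFrom C (t + 1) = runFrom D t := by
  rw [runFrom, h, PMF.pure_bind]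

theorem runFrom_halted (s : State) (t : ℕ) : runFrom ⟨[], s⟩ t = PMF.pure ⟨[], s⟩ := by
  induction t with
  | zero => rfl
  | succ t ih => rw [runFrom_of_step (by rfl), ih]

@[simp] theorem setReg_reg (s : State) (x y z : ℕ) :
    (s.setReg x y).reg z = if z = x then y else s.reg z := by
  simp [State.setReg, Function.update_apply]

@[simp] theorem setReg_arr (s : State) (x y : ℕ) : (s.setReg x y).arr = s.arr := rfl

@[simp] theorem setArr_reg (s : State) (a i y : ℕ) : (s.setArr a i y).reg = s.reg := rfl

@[simp] theorem setArr_arr (s : State) (a i y b : ℕ) :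
    (s.setArr a i y).arr b = if b = a then Function.update (s.arr a) i y else s.arr b := by
  simp [State.setArr, Function.update_apply]

/-- `Exec c s s' t`: from the state `s` the program `c`, which draws nothing, ends in the state
`s'` after `t` steps. -/
inductive Exec : Cmd → State → State → ℕ → Prop where
  | skip (s) : Exec .skip s s 1
  | assign (s x e) : Exec (.assign x e) s (s.setReg x (e.eval s)) 1
  | store (s a i e) : Exec (.store a i e) s (s.setArr a (i.eval s) (e.eval s)) 1
  | seq {s s' s'' c d t t'} (h : Exec c s s' t) (h' : Exec d s' s'' t') :
      Exec (.seq c d) s s'' (t + t' + 1)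
  | branch_true {s s' b c d t} (hb : Exp.eval s b ≠ 0) (h : Exec c s s' t) :
      Exec (.branch b c d) s s' (t + 1)
  | branch_false {s s' b c d t} (hb : Exp.eval s b = 0) (h : Exec d s s' t) :
      Exec (.branch b c d) s s' (t + 1)
  | loop_true {s s' s'' b c t t'} (hb : Exp.eval s b ≠ 0) (h : Exec c s s' t)
      (h' : Exec (.loop b c) s' s'' t') : Exec (.loop b c) s s'' (t + t' + 1)
  | loop_false {s b c} (hb : Exp.eval s b = 0) : Exec (.loop b c) s s 1

/-- The continuation and the spare time are arbitrary, so a deterministic piece can be spliced into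
a randomized run. -/
theorem Exec.runFrom_eq {c : Cmd} {s s' : State} {t : ℕ} (h : Exec c s s' t) (k : List Cmd)
    (T : ℕ) : runFrom ⟨c :: k, s⟩ (t + T) = runFrom ⟨k, s'⟩ T := by
  induction h generalizing k T with
  | skip s => rw [add_comm, runFrom_of_step (by rfl)]
  | assign s x e => rw [add_comm, runFrom_of_step (by rfl)]
  | store s a i e => rw [add_comm, runFrom_of_step (by rfl)]
  | @seq s s' s'' c d t t' h h' ih ih' =>
    rw [show t + t' + 1 + T = t + (t' + T) + 1 by ring, runFrom_of_step (by rfl), ih, ih']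
  | @branch_true s s' b c d t hb h ih =>
    rw [show t + 1 + T = t + T + 1 by ring, runFrom_of_step (D := ⟨c :: k, s⟩) (by simp [step, hb]),
      ih]
  | @branch_false s s' b c d t hb h ih =>
    rw [show t + 1 + T = t + T + 1 by ring, runFrom_of_step (D := ⟨d :: k, s⟩) (by simp [step, hb]),
      ih]
  | @loop_true s s' s'' b c t t' hb h h' ih ih' =>
    rw [show t + t' + 1 + T = t + (t' + T) + 1 by ring,
      runFrom_of_step (D := ⟨c :: .loop b c :: k, s⟩) (by simp [step, hb]), ih, ih']
  | @loop_false s b c hb =>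
    rw [add_comm, runFrom_of_step (D := ⟨k, s⟩) (by simp [step, hb])]

/-- The program may write register `r`. -/
def Cmd.writesReg (r : ℕ) : Cmd → Bool
  | .skip => false
  | .assign x _ => r == x
  | .store _ _ _ => false
  | .draw x _ => r == x
  | .seq c d => c.writesReg r || d.writesReg r
  | .branch _ c d => c.writesReg r || d.writesReg r
  | .loop _ c => c.writesReg r

/-- The program may write array `a`. -/
def Cmd.writesArr (a : ℕ) : Cmd → Bool
  | .skip => false
  | .assign _ _ => false
  | .store b _ _ => a == b
  | .draw _ _ => false
  | .seq c d => c.writesArr a || d.writesArr a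
  | .branch _ c d => c.writesArr a || d.writesArr a
  | .loop _ c => c.writesArr a

/-- The states agree on everything that the program `c` does not write. -/
def Frame (c : Cmd) (s s' : State) : Prop :=
  (∀ r, c.writesReg r = false → s'.reg r = s.reg r) ∧
    ∀ a, c.writesArr a = false → s'.arr a = s.arr a

theorem Frame.refl (c : Cmd) (s : State) : Frame c s s := ⟨fun _ _ => rfl, fun _ _ => rfl⟩

theorem Frame.trans {c : Cmd} {s s' s'' : State} (h : Frame c s s') (h' : Frame c s' s'') :
    Frame c s s'' :=
  ⟨fun r hr => (h'.1 r hr).trans (h.1 r hr), fun a ha => (h'.2 a ha).trans (h.2 a ha)⟩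

theorem Frame.mono {c d : Cmd} {s s' : State} (h : Frame c s s')
    (hr : ∀ r, d.writesReg r = false → c.writesReg r = false)
    (ha : ∀ a, d.writesArr a = false → c.writesArr a = false) : Frame d s s' :=
  ⟨fun r h' => h.1 r (hr r h'), fun a h' => h.2 a (ha a h')⟩

theorem Exec.frame {c : Cmd} {s s' : State} {t : ℕ} (h : Exec c s s' t) : Frame c s s' := by
  induction h with
  | skip s => exact Frame.refl _ _
  | assign s x e =>
    refine ⟨fun r hr => ?_, fun a _ => rfl⟩
    simp only [Cmd.writesReg, beq_eq_false_iff_ne] at hr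
    simp [hr]
  | store s a i e =>
    refine ⟨fun r _ => rfl, fun b hb => ?_⟩
    simp only [Cmd.writesArr, beq_eq_false_iff_ne] at hb
    simp [hb]
  | seq h h' ih ih' =>
    refine (ih.mono ?_ ?_).trans (ih'.mono ?_ ?_) <;> intro r hr <;>
      simp only [Cmd.writesReg, Cmd.writesArr, Bool.or_eq_false_iff] at hr <;>
      first | exact hr.1 | exact hr.2
  | branch_true hb h ih =>
    refine ih.mono ?_ ?_ <;> intro r hr <;>
      simp only [Cmd.writesReg, Cmd.writesArr, Bool.or_eq_false_iff] at hr <;> exact hr.1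
  | branch_false hb h ih =>
    refine ih.mono ?_ ?_ <;> intro r hr <;>
      simp only [Cmd.writesReg, Cmd.writesArr, Bool.or_eq_false_iff] at hr <;> exact hr.2
  | loop_true hb h h' ih ih' => exact (ih.mono (fun _ => id) fun _ => id).trans ih'
  | loop_false hb => exact Frame.refl _ _

/-- A bound for the number of steps, as a polynomial in a bound for the number of iterations of
each of the loops. -/
noncomputable def Cmd.cost : Cmd → Polynomial ℕ
  | .skip => 1
  | .assign _ _ => 1
  | .store _ _ _ => 1
  | .draw _ _ => 1
  | .seq c d => c.cost + d.cost + 1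
  | .branch _ c d => c.cost + d.cost + 1
  | .loop _ c => Polynomial.X * (c.cost + 1) + 1

/-- From the state `s` the program `c` ends in a state that satisfies `Q`, in the time that its
cost gives if no loop has more than `N` iterations. -/
def Wp (N : ℕ) (c : Cmd) (Q : State → Prop) (s : State) : Prop :=
  ∃ s' t, Exec c s s' t ∧ t ≤ c.cost.eval N ∧ Q s'

variable {N : ℕ} {c d : Cmd} {Q R : State → Prop} {s : State} {b : Exp}

/-- The continuation also receives the frame, so specifications only mention what a program changes.
-/
theorem Wp.mono (h : Wp N c Q s) (hQ : ∀ s', Frame c s s' → Q s' → R s') : Wp N c R s := by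
  obtain ⟨s', t, h1, h2, h3⟩ := h
  exact ⟨s', t, h1, h2, hQ s' h1.frame h3⟩

theorem Wp.skip (h : Q s) : Wp N .skip Q s := ⟨s, 1, .skip s, by simp [Cmd.cost], h⟩

theorem Wp.assign {x : ℕ} {e : Exp} (h : Q (s.setReg x (e.eval s))) : Wp N (.assign x e) Q s :=
  ⟨_, 1, .assign s x e, by simp [Cmd.cost], h⟩

theorem Wp.store {a : ℕ} {i e : Exp} (h : Q (s.setArr a (i.eval s) (e.eval s))) :
    Wp N (.store a i e) Q s :=
  ⟨_, 1, .store s a i e, by simp [Cmd.cost], h⟩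

theorem Wp.seq (h : Wp N c (fun s' => Wp N d Q s') s) : Wp N (.seq c d) Q s := by
  obtain ⟨s', t, h1, h2, s'', t', h1', h2', h3⟩ := h
  exact ⟨s'', _, h1.seq h1', by simp only [Cmd.cost, Polynomial.eval_add, Polynomial.eval_one]; omega,
    h3⟩

theorem Wp.branch (h1 : b.eval s ≠ 0 → Wp N c Q s) (h2 : b.eval s = 0 → Wp N d Q s) :
    Wp N (.branch b c d) Q s := by
  by_cases hb : b.eval s = 0
  · obtain ⟨s', t, h3, h4, h5⟩ := h2 hb
    exact ⟨s', _, .branch_false hb h3,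
      by simp only [Cmd.cost, Polynomial.eval_add, Polynomial.eval_one]; omega, h5⟩
  · obtain ⟨s', t, h3, h4, h5⟩ := h1 hb
    exact ⟨s', _, .branch_true hb h3,
      by simp only [Cmd.cost, Polynomial.eval_add, Polynomial.eval_one]; omega, h5⟩

/-- A loop with exactly `T` iterations: `Inv i` holds after `i` of them. -/
theorem Wp.loop (T : ℕ) (Inv : ℕ → State → Prop) (hT : T ≤ N) (h0 : Inv 0 s)
    (hstep : ∀ i < T, ∀ s', Frame c s s' → Inv i s' → b.eval s' ≠ 0 ∧ Wp N c (Inv (i + 1)) s')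
    (hend : ∀ s', Frame c s s' → Inv T s' → b.eval s' = 0 ∧ Q s') : Wp N (.loop b c) Q s := by
  -- Induction on the number `j` of iterations still to come, carrying the frame from the start.
  have key : ∀ j i, i + j = T → ∀ s', Frame c s s' → Inv i s' →
      ∃ s'' t, Exec (.loop b c) s' s'' t ∧ t ≤ j * (c.cost.eval N + 1) + 1 ∧ Q s'' := by
    intro j
    induction j with
    | zero =>
      rintro i rfl s' hf hi
      obtain ⟨hb, hq⟩ := hend s' hf hi
      exact ⟨s', 1, .loop_false hb, by simp, hq⟩
    | succ j ih =>
      intro i hij s' hf hi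
      obtain ⟨hb, s1, t1, he, ht, hi'⟩ := hstep i (by omega) s' hf hi
      obtain ⟨s2, t2, he2, ht2, hq⟩ := ih (i + 1) (by omega) s1 (hf.trans he.frame) hi'
      exact ⟨s2, _, .loop_true hb he he2, by rw [add_mul]; omega, hq⟩
  obtain ⟨s', t, he, ht, hq⟩ := key T 0 (by simp) s (Frame.refl _ _) h0
  refine ⟨s', t, he, ht.trans ?_, hq⟩
  simp only [Cmd.cost, Polynomial.eval_add, Polynomial.eval_one, Polynomial.eval_mul,
    Polynomial.eval_X]
  gcongr

/-- `for x := 0 to m - 1 do c`, where `m` is a register. -/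
def Cmd.forTo (x m : ℕ) (c : Cmd) : Cmd :=
  .seq (.assign x (.const 0)) (.loop (.lt (.reg x) (.reg m))
    (.seq c (.assign x (.add (.reg x) (.const 1)))))

/-- The rule for counting loops: `Inv i` holds after `i` iterations. -/
theorem Wp.forTo {x m : ℕ} (Inv : ℕ → State → Prop) (hN : s.reg m ≤ N)
    (hx : c.writesReg x = false) (hm : (Cmd.forTo x m c).writesReg m = false)
    (h0 : Inv 0 (s.setReg x 0))
    (hstep : ∀ i < s.reg m, ∀ s', Frame (Cmd.forTo x m c) s s' → s'.reg x = i → Inv i s' →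
      Wp N c (fun s'' => Inv (i + 1) (s''.setReg x (i + 1))) s')
    (hend : ∀ s', Frame (Cmd.forTo x m c) s s' → Inv (s.reg m) s' → Q s') :
    Wp N (Cmd.forTo x m c) Q s := by
  have hframe : ∀ s', Frame (.seq c (.assign x (.add (.reg x) (.const 1)))) (s.setReg x 0) s' →
      Frame (Cmd.forTo x m c) s s' := by
    intro s' h
    refine Frame.trans (s' := s.setReg x 0) (Frame.mono (c := .assign x (.const 0))
      (Exec.assign s x (.const 0)).frame ?_ ?_) (h.mono ?_ ?_) <;> intro r hr <;>
      simp_all [Cmd.forTo, Cmd.writesReg, Cmd.writesArr]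
  refine Wp.seq (Wp.assign (Wp.loop (s.reg m) (fun i s' => s'.reg x = i ∧ Inv i s') hN
    ⟨by simp [Exp.eval], h0⟩ ?_ ?_))
  · rintro i hi s' hf ⟨hxi, hinv⟩
    have hf' := hframe s' hf
    refine ⟨by simp [Exp.eval, hxi, hf'.1 m hm, hi], Wp.seq ((hstep i hi s' hf' hxi hinv).mono ?_)⟩
    intro s'' hf'' hi'
    have : s''.reg x = i := (hf''.1 x hx).trans hxi
    refine Wp.assign ⟨by simp [Exp.eval, this], ?_⟩
    simpa [Exp.eval, this] using hi'
  · rintro s' hf ⟨hxi, hinv⟩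
    have hf' := hframe s' hf
    exact ⟨by simp [Exp.eval, hxi, hf'.1 m hm], hend s' hf' hinv⟩

end RAM

/-! ### The weights of the vertices and the list of their units

The programs share the following memory. Registers: `0` the number of vertices, `1` the total
weight, `5` the number of units, `8` the maximal price, `16` the gap. Arrays: `0` the adjacency
matrix, `1` the output, `2` the position of each vertex in the random order, `3` the vertex of each
unit, `5` the price of each slot, `6` its owner, `7` the assigned units, `8` and `9` the two marks
of the vertices that define the persistent solution, `10` the offsets of the rows. -/

namespace RAM

variable {N n : ℕ} {s : State}

/-- Compute `400 n²`. -/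
def totalCmd : Cmd := .forTo 20 0 (.forTo 21 0 (.assign 1 (.add (.reg 1) (.const 400))))

theorem wp_totalCmd (h0 : s.reg 0 ≤ N) (h1 : s.reg 1 = 0) :
    Wp N totalCmd (fun s' => s'.reg 1 = 400 * s.reg 0 ^ 2) s := by
  refine Wp.forTo (fun i s' => s'.reg 1 = 400 * (i * s.reg 0)) h0 rfl rfl (by simpa) ?_ ?_
  · intro i hi s1 hf1 hx1 hi1
    have e0 : s1.reg 0 = s.reg 0 := hf1.1 0 rfl
    refine Wp.forTo (fun j s' => s'.reg 1 = 400 * (i * s.reg 0 + j)) (e0 ▸ h0) rfl rfl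
      (by simpa using hi1) ?_ ?_
    · intro j hj s2 hf2 hx2 hi2
      refine Wp.assign ?_
      simp only [setReg_reg, Exp.eval, hi2]
      norm_num
      ring
    · intro s2 hf2 hi2
      simp only [setReg_reg, hi2, e0]
      norm_num
      ring
  · intro s1 hf1 hi1
    rw [hi1]; ring

/-- Compute the offsets of the rows of the adjacency matrix. -/
def rowsCmd : Cmd :=
  .forTo 22 0 (.seq (.store 10 (.reg 22) (.reg 2)) (.assign 2 (.add (.reg 2) (.reg 0))))

theorem wp_rowsCmd (h0 : s.reg 0 ≤ N) (h2 : s.reg 2 = 0) :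
    Wp N rowsCmd (fun s' => ∀ v < s.reg 0, s'.arr 10 v = v * s.reg 0) s := by
  refine Wp.forTo (fun i s' => s'.reg 2 = i * s.reg 0 ∧ ∀ v < i, s'.arr 10 v = v * s.reg 0)
    h0 rfl rfl (by simpa) ?_ ?_
  · rintro i hi s1 hf1 hx1 ⟨hi1, hi1'⟩
    have e0 : s1.reg 0 = s.reg 0 := hf1.1 0 rfl
    refine Wp.seq (Wp.store (Wp.assign ⟨?_, ?_⟩))
    · simp [Exp.eval, hi1, e0, add_mul]
    · intro v hv
      simp only [Exp.eval, setReg_arr, setArr_arr, if_true, hx1, hi1, Function.update_apply]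
      split_ifs with hvi
      · rw [hvi]
      · exact hi1' v (by omega)
  · rintro s1 hf1 ⟨hi1, hi1'⟩
    exact hi1'

/-- The number of the first `M` entries of a list that are equal to `v`. -/
def entryCount (f : ℕ → ℕ) (M v : ℕ) : ℕ := #{x ∈ range M | f x = v}

theorem entryCount_succ_update (f : ℕ → ℕ) (M u v : ℕ) :
    entryCount (Function.update f M u) (M + 1) v = entryCount f M v + if u = v then 1 else 0 := by
  have h : {x ∈ range M | Function.update f M u x = v} = {x ∈ range M | f x = v} := by
    refine filter_congr fun x hx => ?_
    rw [Function.update_of_ne (by have := mem_range.1 hx; omega)]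
  rw [entryCount, entryCount, range_add_one, filter_insert, Function.update_self, h]
  split_ifs
  · rw [card_insert_of_notMem (by simp)]
  · rfl

/-- The number of neighbours of `v` according to the adjacency matrix `A`. -/
def rowSum (A : ℕ → ℕ) (n v : ℕ) : ℕ := ∑ w ∈ range n, A (v * n + w)

/-- List the units: the vertex `v` gets `K / (d(v) + 1)` of them. -/
def unitsCmd : Cmd :=
  .forTo 23 0 (.seq (.assign 6 (.const 0)) (.seq
    (.forTo 24 0 (.assign 6 (.add (.reg 6) (.get 0 (.add (.get 10 (.reg 23)) (.reg 24))))))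
    -- Division by repeated subtraction: one unit is listed each time that the degree plus one fits
    -- into the remainder.
    (.seq (.assign 7 (.reg 1)) (.loop (.lt (.reg 6) (.reg 7))
      (.seq (.assign 7 (.sub (.reg 7) (.add (.reg 6) (.const 1))))
        (.seq (.store 3 (.reg 5) (.reg 23)) (.assign 5 (.add (.reg 5) (.const 1)))))))))

theorem wp_unitsCmd (h0 : s.reg 0 ≤ N) (h1 : s.reg 1 ≤ N) (h5 : s.reg 5 = 0)
    (h10 : ∀ v < s.reg 0, s.arr 10 v = v * s.reg 0) :
    Wp N unitsCmd (fun s' => ∀ v, entryCount (s'.arr 3) (s'.reg 5) v =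
      if v < s.reg 0 then s.reg 1 / (rowSum (s.arr 0) (s.reg 0) v + 1) else 0) s := by
  refine Wp.forTo (fun i s' => ∀ v, entryCount (s'.arr 3) (s'.reg 5) v =
      if v < i then s.reg 1 / (rowSum (s.arr 0) (s.reg 0) v + 1) else 0) h0 rfl rfl
    (by simp [h5, entryCount]) ?_ fun s1 hf1 hi1 => hi1
  intro i hi s1 hf1 hx1 hi1
  have e0 : s1.reg 0 = s.reg 0 := hf1.1 0 rfl
  have e1 : s1.reg 1 = s.reg 1 := hf1.1 1 rfl
  have ea0 : s1.arr 0 = s.arr 0 := hf1.2 0 rfl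
  have ea10 : s1.arr 10 = s.arr 10 := hf1.2 10 rfl
  refine Wp.seq (Wp.assign (Wp.seq ?_))
  refine Wp.forTo (fun j s' => s'.reg 6 = ∑ w ∈ range j, s.arr 0 (i * s.reg 0 + w))
    (by simp [e0, h0]) rfl rfl (by simp [Exp.eval]) ?_ ?_
  · intro j hj s2 hf2 hx2 hi2
    have e23 : s2.reg 23 = i := (hf2.1 23 rfl).trans (by simp [hx1])
    have e0' : s2.arr 0 = s.arr 0 := (hf2.2 0 rfl).trans (by simp [ea0])
    have e10' : s2.arr 10 = s.arr 10 := (hf2.2 10 rfl).trans (by simp [ea10])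
    refine Wp.assign ?_
    simp [Exp.eval, hi2, e23, e0', e10', hx2, h10 i hi, sum_range_succ]
  intro s2 hf2 hi2
  have e6 : s2.reg 6 = rowSum (s.arr 0) (s.reg 0) i := by rw [hi2]; simp [rowSum, e0]
  have e23 : s2.reg 23 = i := (hf2.1 23 rfl).trans (by simp [hx1])
  have e1' : s2.reg 1 = s.reg 1 := (hf2.1 1 rfl).trans (by simp [e1])
  have e5' : s2.reg 5 = s1.reg 5 := (hf2.1 5 rfl).trans (by simp)
  have e3' : s2.arr 3 = s1.arr 3 := (hf2.2 3 rfl).trans (by simp)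
  set D := rowSum (s.arr 0) (s.reg 0) i
  set T := s.reg 1 / (D + 1) with hT
  have hTle : T * (D + 1) ≤ s.reg 1 := Nat.div_mul_le_self _ _
  have hTlt : s.reg 1 < (T + 1) * (D + 1) := by
    have := Nat.lt_div_mul_add (a := s.reg 1) (b := D + 1) (by omega)
    rw [hT, add_mul]; omega
  refine Wp.seq (Wp.assign (Wp.loop T (fun j s' => s'.reg 7 + j * (D + 1) = s.reg 1 ∧
    ∀ v, entryCount (s'.arr 3) (s'.reg 5) v =
      if v < i then s.reg 1 / (rowSum (s.arr 0) (s.reg 0) v + 1) else if v = i then j else 0)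
    ((Nat.div_le_self _ _).trans h1) ?_ ?_ ?_))
  · refine ⟨by simp [Exp.eval, e1'], fun v => ?_⟩
    simpa [e5', e3'] using hi1 v
  · rintro j hj s3 hf3 ⟨hi3, hi3'⟩
    have e6' : s3.reg 6 = D := (hf3.1 6 rfl).trans (by simp [e6])
    have e23' : s3.reg 23 = i := (hf3.1 23 rfl).trans (by simp [e23])
    have hjT : (j + 1) * (D + 1) ≤ s.reg 1 := (Nat.mul_le_mul_right _ hj).trans hTle
    rw [add_mul] at hjT
    refine ⟨by simp [Exp.eval, e6']; omega, ?_⟩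
    refine Wp.seq (Wp.assign (Wp.seq (Wp.store (Wp.assign ⟨?_, fun v => ?_⟩))))
    · simp [Exp.eval, e6', add_mul]; omega
    · simp only [Exp.eval, setReg_arr, setArr_arr, setReg_reg, setArr_reg, if_true]
      norm_num
      rw [entryCount_succ_update, hi3', e23']
      split_ifs <;> omega
  · rintro s3 hf3 ⟨hi3, hi3'⟩
    have e6' : s3.reg 6 = D := (hf3.1 6 rfl).trans (by simp [e6])
    refine ⟨?_, fun v => ?_⟩
    · rw [add_mul] at hTlt
      simp [Exp.eval, e6']; omega
    · simp only [setReg_arr, setReg_reg]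
      norm_num
      rw [hi3']
      by_cases hvi : v = i
      · subst hvi
        simp [hT, D]
      · simp only [hvi, if_false]
        split_ifs <;> first | rfl | omega

end RAM

/-! ### The auction -/

namespace RAM

variable {N M lam : ℕ} {E : ℕ → ℕ → Prop} {price own asg : ℕ → ℕ} {s : State}

/-- The state of an auction in which unit `x` may buy slot `y` if `E x y`: the owner of slot `y`
is the unit `own y - 1` if `own y ≠ 0`, and `asg (x + 1)` says whether unit `x` owns a slot. -/
structure AuctionInv (M lam : ℕ) (E : ℕ → ℕ → Prop) (price own asg : ℕ → ℕ) : Prop where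
  lt : ∀ x y, y < M → own y = x + 1 → x < M
  asg_ne : ∀ x y, y < M → own y = x + 1 → asg (x + 1) ≠ 0
  adj : ∀ x y, y < M → own y = x + 1 → E x y
  price_le : ∀ x y y', y < M → y' < M → own y = x + 1 → E x y' → price y ≤ price y' + 1
  inj : ∀ x y y', y < M → y' < M → own y = x + 1 → own y' = x + 1 → y = y'
  exists_own : ∀ x < M, asg (x + 1) ≠ 0 → ∃ y < M, own y = x + 1
  pos : ∀ y < M, 0 < price y → own y ≠ 0
  le_lam : ∀ y < M, price y ≤ lam

/-- No unit wants to buy another slot. -/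
def AuctionEnd (M lam : ℕ) (E : ℕ → ℕ → Prop) (price asg : ℕ → ℕ) : Prop :=
  ∀ x < M, ∀ y < M, asg (x + 1) = 0 → E x y → lam ≤ price y

theorem AuctionInv.zero (hp : ∀ y, price y = 0) (ho : ∀ y, own y = 0) (ha : ∀ x, asg x = 0) :
    AuctionInv M lam E price own asg := by
  constructor <;> simp [hp, ho, ha]

/-- The buyer takes its cheapest slot and raises the price by one; other owners see their own price
unchanged and the rest not lowered. If the slot had no owner, the eviction only touches the dummy
entry 0 of `asg`. -/
theorem AuctionInv.buy (h : AuctionInv M lam E price own asg) {x y : ℕ} (hx : x < M) (hy : y < M)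
    (hfree : asg (x + 1) = 0) (hE : E x y) (hlam : price y < lam)
    (hmin : ∀ y' < M, E x y' → price y ≤ price y') :
    AuctionInv M lam E (Function.update price y (price y + 1)) (Function.update own y (x + 1))
      (Function.update (Function.update asg (own y) 0) (x + 1) 1) := by
  have hown : ∀ x' y', y' < M → y' ≠ y → own y' = x' + 1 → x' ≠ x := by
    rintro x' y' hy' - ho rfl
    exact h.asg_ne x' y' hy' ho hfree
  constructor
  · intro x' y' hy' ho
    by_cases hyy : y' = y
    · subst hyy; rw [Function.update_self] at ho; omega
    · rw [Function.update_of_ne hyy] at ho; exact h.lt x' y' hy' ho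
  · intro x' y' hy' ho
    by_cases hyy : y' = y
    · subst hyy; rw [Function.update_self] at ho
      rw [← ho]; simp
    · rw [Function.update_of_ne hyy] at ho
      have h1 := hown x' y' hy' hyy ho
      have h2 : x' + 1 ≠ own y := fun h3 => hyy (h.inj x' y' y hy' hy ho h3.symm)
      rw [Function.update_of_ne (by omega), Function.update_of_ne h2]
      exact h.asg_ne x' y' hy' ho
  · intro x' y' hy' ho
    by_cases hyy : y' = y
    · subst hyy; rw [Function.update_self] at ho
      obtain rfl : x = x' := by omega
      exact hE
    · rw [Function.update_of_ne hyy] at ho; exact h.adj x' y' hy' ho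
  · intro x' y' z hy' hz ho hEz
    have hmono : price z ≤ Function.update price y (price y + 1) z := by
      rw [Function.update_apply]; split_ifs with hzy
      · rw [hzy]; omega
      · rfl
    by_cases hyy : y' = y
    · subst hyy; rw [Function.update_self] at ho
      obtain rfl : x = x' := by omega
      have := hmin z hz hEz
      rw [Function.update_self]; omega
    · rw [Function.update_of_ne hyy] at ho
      have := h.price_le x' y' z hy' hz ho hEz
      rw [Function.update_of_ne hyy]; omega
  · intro x' y' z hy' hz ho hoz
    by_cases hyy : y' = y
    · subst hyy
      by_cases hzy : z = y'
      · exact hzy.symm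
      · rw [Function.update_self] at ho; rw [Function.update_of_ne hzy] at hoz
        exact absurd (by omega) (hown x' z hz hzy hoz)
    · rw [Function.update_of_ne hyy] at ho
      by_cases hzy : z = y
      · subst hzy; rw [Function.update_self] at hoz
        exact absurd (by omega) (hown x' y' hy' hyy ho)
      · rw [Function.update_of_ne hzy] at hoz
        exact h.inj x' y' z hy' hz ho hoz
  · intro x' hx' ha
    by_cases hxx : x' = x
    · exact ⟨y, hy, by rw [hxx, Function.update_self]⟩
    · rw [Function.update_of_ne (by omega), Function.update_apply] at ha
      split_ifs at ha with h1
      · exact absurd rfl ha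
      · obtain ⟨y', hy', ho⟩ := h.exists_own x' hx' ha
        have hyy : y' ≠ y := by rintro rfl; exact h1 ho.symm
        exact ⟨y', hy', by rw [Function.update_of_ne hyy, ho]⟩
  · intro y' hy' hp
    by_cases hyy : y' = y
    · subst hyy; simp
    · rw [Function.update_of_ne hyy] at hp ⊢; exact h.pos y' hy' hp
  · intro y' hy'
    by_cases hyy : y' = y
    · subst hyy; rw [Function.update_self]; omega
    · rw [Function.update_of_ne hyy]; exact h.le_lam y' hy'

/-- Each purchase raises the total price by one and no price exceeds `lam`, so `M * lam` rounds
exhaust the auction. -/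
theorem AuctionInv.end_of_sum (h : AuctionInv M lam E price own asg)
    (hsum : M * lam ≤ ∑ y ∈ range M, price y) : AuctionEnd M lam E price asg := by
  intro x hx y hy _ _
  by_contra hlt
  have : ∑ y ∈ range M, price y < ∑ y ∈ range M, lam :=
    sum_lt_sum (fun z hz => h.le_lam z (mem_range.1 hz)) ⟨y, mem_range.2 hy, by omega⟩
  simp at this
  omega

/-- The pairs in `P` have been searched for the cheapest slot that a free unit can buy. -/
structure ScanInv (M lam : ℕ) (E : ℕ → ℕ → Prop) (price asg : ℕ → ℕ) (P : ℕ → ℕ → Prop)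
    (best x y : ℕ) : Prop where
  le_lam : best ≤ lam
  le_price : ∀ x' y', P x' y' → asg (x' + 1) = 0 → E x' y' → best ≤ price y'
  found : best < lam → x < M ∧ y < M ∧ asg (x + 1) = 0 ∧ E x y ∧ best = price y

theorem ScanInv.congr {P P' : ℕ → ℕ → Prop} {best x y : ℕ}
    (h : ScanInv M lam E price asg P best x y) (hP : ∀ x' y', P' x' y' → P x' y') :
    ScanInv M lam E price asg P' best x y :=
  ⟨h.le_lam, fun x' y' hp => h.le_price x' y' (hP _ _ hp), h.found⟩

/-- Two units have adjacent vertices. -/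
def UnitAdj (s : State) (x y : ℕ) : Prop := s.arr 0 (s.arr 10 (s.arr 3 x) + s.arr 3 y) ≠ 0

theorem unitAdj_congr {s s' : State} (h0 : s'.arr 0 = s.arr 0) (h3 : s'.arr 3 = s.arr 3)
    (h10 : s'.arr 10 = s.arr 10) : UnitAdj s' = UnitAdj s := by
  funext x y
  rw [UnitAdj, UnitAdj, h0, h3, h10]

/-- Find the cheapest slot that a free unit can buy. -/
def scanCmd : Cmd :=
  .seq (.assign 10 (.reg 8)) (.forTo 25 5 (.forTo 26 5
    (.branch (.get 7 (.add (.reg 25) (.const 1))) .skip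
      (.branch (.get 0 (.add (.get 10 (.get 3 (.reg 25))) (.get 3 (.reg 26))))
        (.branch (.lt (.get 5 (.reg 26)) (.reg 10))
          (.seq (.assign 10 (.get 5 (.reg 26))) (.seq (.assign 11 (.reg 25))
            (.assign 12 (.reg 26)))) .skip) .skip))))

theorem wp_scanCmd (h5 : s.reg 5 ≤ N) :
    Wp N scanCmd (fun s' => ScanInv (s.reg 5) (s.reg 8) (UnitAdj s) (s.arr 5) (s.arr 7)
      (fun x y => x < s.reg 5 ∧ y < s.reg 5) (s'.reg 10) (s'.reg 11) (s'.reg 12)) s := by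
  refine Wp.seq (Wp.assign (Wp.forTo (fun i s' => ScanInv (s.reg 5) (s.reg 8) (UnitAdj s)
    (s.arr 5) (s.arr 7) (fun x y => x < i ∧ y < s.reg 5) (s'.reg 10) (s'.reg 11) (s'.reg 12))
    (by simpa using h5) rfl rfl ⟨by simp [Exp.eval], by simp, by simp [Exp.eval]⟩ ?_ ?_))
  · intro i hi s1 hf1 hx1 hi1
    have e5 : s1.reg 5 = s.reg 5 := (hf1.1 5 rfl).trans (by simp)
    refine Wp.forTo (fun j s' => ScanInv (s.reg 5) (s.reg 8) (UnitAdj s)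
      (s.arr 5) (s.arr 7) (fun x y => x < i ∧ y < s.reg 5 ∨ x = i ∧ y < j)
      (s'.reg 10) (s'.reg 11) (s'.reg 12)) (by rw [e5]; exact h5) rfl rfl ?_ ?_ ?_
    · exact hi1.congr fun x y => by omega
    · intro j hj s2 hf2 hx2 hi2
      have hi' : i < s.reg 5 := by simpa using hi
      have hj' : j < s.reg 5 := by rw [← e5]; exact hj
      have e25 : s2.reg 25 = i := (hf2.1 25 rfl).trans hx1
      have ea (a : ℕ) (ha : scanCmd.writesArr a = false) : s2.arr a = s.arr a :=
        (hf2.2 a rfl).trans (hf1.2 a rfl)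
      have hE : UnitAdj s i j ↔ s2.arr 0 (s2.arr 10 (s2.arr 3 i) + s2.arr 3 j) ≠ 0 := by
        rw [UnitAdj, ea 0 rfl, ea 3 rfl, ea 10 rfl]
      have hstep (hle : s.arr 7 (i + 1) = 0 → UnitAdj s i j → s2.reg 10 ≤ s.arr 5 j) :
          ScanInv (s.reg 5) (s.reg 8) (UnitAdj s) (s.arr 5) (s.arr 7)
            (fun x y => x < i ∧ y < s.reg 5 ∨ x = i ∧ y < j + 1)
            (s2.reg 10) (s2.reg 11) (s2.reg 12) := by
        refine ⟨hi2.le_lam, fun x' y' hp ha hE' => ?_, hi2.found⟩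
        by_cases hxy : x' = i ∧ y' = j
        · obtain ⟨rfl, rfl⟩ := hxy
          exact hle ha hE'
        · exact hi2.le_price x' y' (by omega) ha hE'
      refine Wp.branch (fun hb => Wp.skip ?_) fun hb => Wp.branch (fun hb' => Wp.branch
        (fun hb'' => Wp.seq (Wp.assign (Wp.seq (Wp.assign (Wp.assign ?_)))))
        fun hb'' => Wp.skip ?_) fun hb' => Wp.skip ?_
      · simp only [Exp.eval, e25, ea 7 rfl] at hb
        exact hstep fun h => absurd h hb
      · simp only [Exp.eval, e25, hx2, ea 7 rfl, ea 5 rfl] at hb hb' hb''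
        have hlt : s.arr 5 j < s2.reg 10 := by by_contra h; simp [h] at hb''
        have := hi2.le_lam
        simp only [Exp.eval, setReg_reg, e25, hx2, ea 5 rfl]
        norm_num
        refine ⟨by omega, fun x' y' hp ha hE' => ?_, fun _ => ⟨hi', hj', hb, hE.2 hb', rfl⟩⟩
        by_cases hxy : x' = i ∧ y' = j
        · obtain ⟨rfl, rfl⟩ := hxy
          exact le_rfl
        · exact hlt.le.trans (hi2.le_price x' y' (by omega) ha hE')
      · simp only [Exp.eval, hx2, ea 5 rfl] at hb''
        exact hstep fun _ _ => by by_contra h; simp [not_le.1 h] at hb''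
      · simp only [Exp.eval, e25, hx2] at hb'
        exact hstep fun _ h => absurd hb' (hE.1 h)
    · intro s2 hf2 hi2
      exact hi2.congr fun x y => by omega
  · intro s1 hf1 hi1
    simpa using hi1

/-- One purchase, if it is possible. -/
def roundCmd : Cmd :=
  .seq scanCmd (.branch (.lt (.reg 10) (.reg 8))
    (.seq (.store 7 (.get 6 (.reg 12)) (.const 0))
      (.seq (.store 6 (.reg 12) (.add (.reg 11) (.const 1)))
        (.seq (.store 7 (.add (.reg 11) (.const 1)) (.const 1))
          (.store 5 (.reg 12) (.add (.reg 10) (.const 1)))))) .skip)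

theorem wp_roundCmd (h5 : s.reg 5 ≤ N)
    (h : AuctionInv (s.reg 5) (s.reg 8) (UnitAdj s) (s.arr 5) (s.arr 6) (s.arr 7)) :
    Wp N roundCmd (fun s' =>
      AuctionInv (s.reg 5) (s.reg 8) (UnitAdj s) (s'.arr 5) (s'.arr 6) (s'.arr 7) ∧
      (AuctionEnd (s.reg 5) (s.reg 8) (UnitAdj s) (s'.arr 5) (s'.arr 7) ∨
        ¬ AuctionEnd (s.reg 5) (s.reg 8) (UnitAdj s) (s.arr 5) (s.arr 7) ∧
        ∑ y ∈ range (s.reg 5), s'.arr 5 y = ∑ y ∈ range (s.reg 5), s.arr 5 y + 1)) s := by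
  refine Wp.seq ((wp_scanCmd h5).mono fun s1 hf1 h1 => Wp.branch (fun hb => ?_) fun hb => ?_)
  · have e8 : s1.reg 8 = s.reg 8 := hf1.1 8 rfl
    have hlt : s1.reg 10 < s.reg 8 := by
      by_contra hcon; simp [Exp.eval, e8, hcon] at hb
    obtain ⟨hx, hy, hfree, hE, hbest⟩ := h1.found hlt
    have hlam : s.arr 5 (s1.reg 12) < s.reg 8 := by omega
    have hbuy := h.buy hx hy hfree hE hlam fun y' hy' hE' =>
      hbest ▸ h1.le_price _ y' ⟨hx, hy'⟩ hfree hE'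
    refine Wp.seq (Wp.store (Wp.seq (Wp.store (Wp.seq (Wp.store (Wp.store ?_))))))
    simp only [Exp.eval, setArr_reg, setArr_arr]
    norm_num
    rw [hf1.2 5 rfl, hf1.2 6 rfl, hf1.2 7 rfl, hbest]
    refine ⟨hbuy, Or.inr ⟨fun hend => ?_, ?_⟩⟩
    · exact absurd (hend _ hx _ hy hfree hE) (by omega)
    · rw [sum_update_of_mem (mem_range.2 hy), ← add_sum_erase _ _ (mem_range.2 hy),
        sdiff_singleton_eq_erase]
      ring
  · have e8 : s1.reg 8 = s.reg 8 := hf1.1 8 rfl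
    have hge : s.reg 8 ≤ s1.reg 10 := by
      by_contra hcon; simp [Exp.eval, e8, not_le.1 hcon] at hb
    refine Wp.skip ?_
    rw [hf1.2 5 rfl, hf1.2 6 rfl, hf1.2 7 rfl]
    exact ⟨h, Or.inl fun x hx y hy ha hE => hge.trans (h1.le_price x y ⟨hx, hy⟩ ha hE)⟩

/-- Repeat the purchases until no free unit can afford a slot. -/
def auctionCmd : Cmd :=
  -- For M units, the gap will be at most 2M + 1, so the maximal price 2M + 4 leaves room for `g +
  -- 2`. Register 9 then counts M(2M + 4) rounds.
  .seq (.assign 8 (.add (.add (.reg 5) (.reg 5)) (.const 4)))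
    (.seq (.forTo 27 5 (.assign 9 (.add (.reg 9) (.reg 8)))) (.forTo 28 9 roundCmd))

theorem wp_auctionCmd (h5 : s.reg 5 ≤ N) (h5' : s.reg 5 * (2 * s.reg 5 + 4) ≤ N)
    (h9 : s.reg 9 = 0) (hp : ∀ y, s.arr 5 y = 0) (ho : ∀ y, s.arr 6 y = 0)
    (ha : ∀ x, s.arr 7 x = 0) :
    Wp N auctionCmd (fun s' =>
      AuctionInv (s.reg 5) (2 * s.reg 5 + 4) (UnitAdj s) (s'.arr 5) (s'.arr 6) (s'.arr 7) ∧
      AuctionEnd (s.reg 5) (2 * s.reg 5 + 4) (UnitAdj s) (s'.arr 5) (s'.arr 7)) s := by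
  refine Wp.seq (Wp.assign (Wp.seq ?_))
  refine Wp.forTo (fun i s' => s'.reg 9 = i * (2 * s.reg 5 + 4)) (by simpa) rfl rfl
    (by simpa) ?_ ?_
  · intro i hi s1 hf1 hx1 hi1
    refine Wp.assign ?_
    have e8 : s1.reg 8 = 2 * s.reg 5 + 4 := (hf1.1 8 rfl).trans (by simp [Exp.eval, two_mul])
    simp [Exp.eval, hi1, e8, add_mul]
  intro s1 hf1 hi1
  have e5 : s1.reg 5 = s.reg 5 := (hf1.1 5 rfl).trans (by simp)
  have e8 : s1.reg 8 = 2 * s.reg 5 + 4 := (hf1.1 8 rfl).trans (by simp [Exp.eval, two_mul])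
  have e9 : s1.reg 9 = s.reg 5 * (2 * s.reg 5 + 4) := by simpa using hi1
  have ea (a : ℕ) : s1.arr a = s.arr a := hf1.2 a rfl
  refine Wp.forTo (fun i s' =>
    AuctionInv (s.reg 5) (2 * s.reg 5 + 4) (UnitAdj s) (s'.arr 5) (s'.arr 6) (s'.arr 7) ∧
      (AuctionEnd (s.reg 5) (2 * s.reg 5 + 4) (UnitAdj s) (s'.arr 5) (s'.arr 7) ∨
        i ≤ ∑ y ∈ range (s.reg 5), s'.arr 5 y)) (by omega) rfl rfl ?_ ?_ ?_
  · simp only [setReg_arr, ea]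
    exact ⟨AuctionInv.zero hp ho ha, Or.inr (Nat.zero_le _)⟩
  · rintro i hi s2 hf2 hx2 ⟨hi2, hi2'⟩
    have e5' : s2.reg 5 = s.reg 5 := (hf2.1 5 rfl).trans e5
    have e8' : s2.reg 8 = 2 * s.reg 5 + 4 := (hf2.1 8 rfl).trans e8
    have hE : UnitAdj s2 = UnitAdj s := unitAdj_congr ((hf2.2 0 rfl).trans (ea 0))
      ((hf2.2 3 rfl).trans (ea 3)) ((hf2.2 10 rfl).trans (ea 10))
    refine (wp_roundCmd (s := s2) (by omega) (by rw [e5', e8', hE]; exact hi2)).mono ?_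
    rintro s3 hf3 ⟨h3, h3'⟩
    rw [e5', e8', hE] at h3 h3'
    refine ⟨h3, ?_⟩
    rcases h3' with h3' | ⟨h3', hs⟩
    · exact Or.inl h3'
    · refine Or.inr ?_
      rcases hi2' with hi2' | hi2'
      · exact absurd hi2' h3'
      · simp only [setReg_arr]; omega
  · rintro s2 hf2 ⟨hi2, hi2'⟩
    refine ⟨hi2, hi2'.elim id fun h => hi2.end_of_sum ?_⟩
    rwa [e9] at h

end RAM

/-! ### The gap in the prices and the persistent part -/

namespace RAM

variable {N : ℕ} {s : State}

/-- Find an odd number `g` such that no price is `g` or `g + 1`. -/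
def gapCmd : Cmd :=
  .seq (.assign 19 (.add (.reg 5) (.const 1))) (.forTo 29 19
    (.seq (.assign 17 (.const 1)) (.seq
      (.forTo 30 5 (.branch (.add
        (.eq (.get 5 (.reg 30)) (.add (.add (.reg 29) (.reg 29)) (.const 1)))
        (.eq (.get 5 (.reg 30)) (.add (.add (.reg 29) (.reg 29)) (.const 2))))
        (.assign 17 (.const 0)) .skip))
      (.branch (.reg 17) (.assign 16 (.add (.add (.reg 29) (.reg 29)) (.const 1))) .skip))))

/-- Pigeonhole: `M` prices cannot meet all of `M + 1` disjoint pairs {2c+1, 2c+2}. -/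
theorem exists_gap (f : ℕ → ℕ) (M : ℕ) :
    ∃ c < M + 1, ∀ y < M, f y ≠ c + c + 1 ∧ f y ≠ c + c + 2 := by
  by_contra! hcon
  have h1 : ∀ c ∈ range (M + 1), ∃ y ∈ range M, (f y - 1) / 2 = c := by
    intro c hc
    obtain ⟨y, hy, h⟩ := hcon c (mem_range.1 hc)
    exact ⟨y, mem_range.2 hy, by by_cases h' : f y = c + c + 1 <;> [skip; have := h h'] <;> omega⟩
  have h2 : range (M + 1) ⊆ (range M).image fun y => (f y - 1) / 2 := fun c hc =>
    mem_image.2 (h1 c hc)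
  have h3 := (card_le_card h2).trans card_image_le
  simp at h3

theorem wp_gapCmd (h5 : s.reg 5 + 1 ≤ N) :
    Wp N gapCmd (fun s' => ∃ c ≤ s.reg 5, s'.reg 16 = c + c + 1 ∧
      ∀ y < s.reg 5, s.arr 5 y ≠ s'.reg 16 ∧ s.arr 5 y ≠ s'.reg 16 + 1) s := by
  refine Wp.seq (Wp.assign (Wp.forTo (fun i s' => (∃ c < i,
      ∀ y < s.reg 5, s.arr 5 y ≠ c + c + 1 ∧ s.arr 5 y ≠ c + c + 2) →
    ∃ c < i, s'.reg 16 = c + c + 1 ∧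
      ∀ y < s.reg 5, s.arr 5 y ≠ c + c + 1 ∧ s.arr 5 y ≠ c + c + 2)
    (by simpa [Exp.eval]) rfl rfl (by simp) ?_ ?_))
  · intro i hi s1 hf1 hx1 hi1
    have e5 : s1.reg 5 = s.reg 5 := (hf1.1 5 rfl).trans (by simp)
    have ea : s1.arr 5 = s.arr 5 := hf1.2 5 rfl
    refine Wp.seq (Wp.assign (Wp.seq ?_))
    refine Wp.forTo (fun j s' => s'.reg 17 ≠ 0 ↔
      ∀ y < j, s.arr 5 y ≠ i + i + 1 ∧ s.arr 5 y ≠ i + i + 2) (by simp; omega) rfl rfl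
      (by simp [Exp.eval]) ?_ ?_
    · intro j hj s2 hf2 hx2 hi2
      have e29 : s2.reg 29 = i := (hf2.1 29 rfl).trans (by simp [hx1])
      have ea' : s2.arr 5 = s.arr 5 := (hf2.2 5 rfl).trans ea
      have hsucc : (∀ y < j + 1, s.arr 5 y ≠ i + i + 1 ∧ s.arr 5 y ≠ i + i + 2) ↔
          (∀ y < j, s.arr 5 y ≠ i + i + 1 ∧ s.arr 5 y ≠ i + i + 2) ∧
          (s.arr 5 j ≠ i + i + 1 ∧ s.arr 5 j ≠ i + i + 2) := Nat.forall_lt_succ_right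
      refine Wp.branch (fun hb => Wp.assign ?_) fun hb => Wp.skip ?_ <;>
        simp only [Exp.eval, e29, hx2, ea'] at hb
      · rw [hsucc]
        simp only [Exp.eval, setReg_reg]
        norm_num
        intro _ h
        by_contra h'
        simp [h, h'] at hb
      · rw [hsucc, ← hi2]
        simp only [setReg_reg]
        norm_num
        intro _
        constructor <;> intro h <;> simp [h] at hb
    · intro s2 hf2 hi2
      have e29 : s2.reg 29 = i := (hf2.1 29 rfl).trans (by simp [hx1])
      have e16 : s2.reg 16 = s1.reg 16 := (hf2.1 16 rfl).trans (by simp)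
      simp only [setReg_reg] at hi2
      norm_num [e5] at hi2
      refine Wp.branch (fun hb => Wp.assign fun _ => ⟨i, by omega, ?_, ?_⟩) fun hb => Wp.skip ?_
      · simp [Exp.eval, e29]
      · intro y hy
        by_contra h
        exact hb (by_contra fun h' => h (hi2.1 h' y hy))
      · rintro ⟨c, hc, hc'⟩
        have hci : c ≠ i := by
          rintro rfl
          exact hi2.2 hc' hb
        obtain ⟨c', hc1, hc2, hc3⟩ := hi1 ⟨c, by omega, hc'⟩
        exact ⟨c', by omega, by simpa [e16] using hc2, hc3⟩
  · intro s1 hf1 hi1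
    obtain ⟨c, hc, hc'⟩ := exists_gap (s.arr 5) (s.reg 5)
    obtain ⟨c', h1, h2, h3⟩ := hi1 ⟨c, by simpa [Exp.eval] using hc, hc'⟩
    simp [Exp.eval] at h1
    exact ⟨c', by omega, h2, by rw [h2]; exact h3⟩

/-- Mark in array `8` the vertices with a slot of high price and in array `9` the vertices with a
unit that owns no slot of low price. -/
def flagsCmd : Cmd :=
  .forTo 31 5 (.seq
    (.branch (.lt (.get 5 (.reg 31)) (.reg 16)) .skip
      (.seq (.store 8 (.get 3 (.reg 31)) (.const 1))
        -- Owners are stored shifted by one. The owner of a high slot has no other slot, so its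
        -- vertex is poor.
        (.store 9 (.get 3 (.sub (.get 6 (.reg 31)) (.const 1))) (.const 1))))
    (.branch (.get 7 (.add (.reg 31) (.const 1))) .skip
      (.store 9 (.get 3 (.reg 31)) (.const 1))))

theorem exists_lt_succ_and {P : ℕ → Prop} (i : ℕ) :
    (∃ y < i + 1, P y) ↔ (∃ y < i, P y) ∨ P i := Nat.exists_lt_succ_right

theorem wp_flagsCmd (h5 : s.reg 5 ≤ N) (h8 : ∀ v, s.arr 8 v = 0) (h9 : ∀ v, s.arr 9 v = 0) :
    Wp N flagsCmd (fun s' => ∀ v,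
      (s'.arr 8 v ≤ 1 ∧ (s'.arr 8 v = 1 ↔ ∃ y < s.reg 5, s.reg 16 ≤ s.arr 5 y ∧ s.arr 3 y = v)) ∧
      (s'.arr 9 v ≤ 1 ∧ (s'.arr 9 v = 1 ↔ ∃ y < s.reg 5,
        (s.reg 16 ≤ s.arr 5 y ∧ s.arr 3 (s.arr 6 y - 1) = v) ∨
        (s.arr 7 (y + 1) = 0 ∧ s.arr 3 y = v)))) s := by
  refine Wp.forTo (fun i s' => ∀ v,
      (s'.arr 8 v ≤ 1 ∧ (s'.arr 8 v = 1 ↔ ∃ y < i, s.reg 16 ≤ s.arr 5 y ∧ s.arr 3 y = v)) ∧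
      (s'.arr 9 v ≤ 1 ∧ (s'.arr 9 v = 1 ↔ ∃ y < i,
        (s.reg 16 ≤ s.arr 5 y ∧ s.arr 3 (s.arr 6 y - 1) = v) ∨
        (s.arr 7 (y + 1) = 0 ∧ s.arr 3 y = v)))) h5 rfl rfl (by simp [h8, h9]) ?_
    fun s1 hf1 hi1 => hi1
  intro i hi s1 hf1 hx1 hi1
  have e16 : s1.reg 16 = s.reg 16 := hf1.1 16 rfl
  have e3 : s1.arr 3 = s.arr 3 := hf1.2 3 rfl
  have e5 : s1.arr 5 = s.arr 5 := hf1.2 5 rfl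
  have e6 : s1.arr 6 = s.arr 6 := hf1.2 6 rfl
  have e7 : s1.arr 7 = s.arr 7 := hf1.2 7 rfl
  simp only [exists_lt_succ_and]
  refine Wp.seq (Wp.branch (fun hb => Wp.skip ?_) fun hb => Wp.seq (Wp.store (Wp.store ?_))) <;>
    refine Wp.branch (fun hb' => Wp.skip ?_) fun hb' => Wp.store ?_ <;> intro v <;>
    obtain ⟨⟨h1, h2⟩, h3, h4⟩ := hi1 v <;>
    simp only [Exp.eval, hx1, e16, e3, e5, e6, e7, setArr_arr, setReg_arr, setArr_reg,
      Nat.reduceEqDiff, if_true, if_false, ne_eq, ite_eq_right_iff, one_ne_zero, imp_false,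
      not_lt] at hb hb' ⊢ <;>
    simp only [← h2, ← h4, hb, hb', Function.update_apply] <;>
    grind

/-- Output the vertices that the persistent solution takes. -/
def takeCmd : Cmd :=
  -- The marks are 0 or 1, so the comparison selects the poor vertices that are not high.
  .forTo 32 0 (.branch (.lt (.get 8 (.reg 32)) (.get 9 (.reg 32)))
    (.store 1 (.reg 32) (.const 1)) .skip)

theorem wp_takeCmd (h0 : s.reg 0 ≤ N) (h1 : ∀ v, s.arr 1 v = 0) :
    Wp N takeCmd (fun s' => ∀ v < s.reg 0, s'.arr 1 v ≠ 0 ↔ s.arr 8 v < s.arr 9 v) s := by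
  refine Wp.forTo (fun i s' => ∀ v, s'.arr 1 v ≠ 0 ↔ v < i ∧ s.arr 8 v < s.arr 9 v) h0 rfl rfl
    (by simp [h1]) ?_ fun s1 hf1 hi1 v hv => by rw [hi1]; simp [hv]
  intro i hi s1 hf1 hx1 hi1
  have e8 : s1.arr 8 = s.arr 8 := hf1.2 8 rfl
  have e9 : s1.arr 9 = s.arr 9 := hf1.2 9 rfl
  refine Wp.branch (fun hb => Wp.store ?_) fun hb => Wp.skip ?_ <;> intro v <;>
    simp only [Exp.eval, hx1, e8, e9, ne_eq, ite_eq_right_iff, one_ne_zero, imp_false,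
      not_not] at hb
  · simp only [Exp.eval, setReg_arr, setArr_arr, if_true, hx1, Function.update_apply]
    split_ifs with hv
    · subst hv; simp [hb]
    · rw [hi1]
      have : v < i + 1 ↔ v < i := by omega
      rw [this]
  · simp only [setReg_arr, hi1]
    by_cases hv : v = i
    · subst hv; simp [hb]
    · have : v < i + 1 ↔ v < i := by omega
      rw [this]

end RAM

/-! ### The greedy algorithm on the random forest -/

section Greedy

variable {n p : ℕ} {G : SimpleGraph (Fin n)} {H T S : Finset (Fin n)} {σ : Equiv.Perm (Fin n)}

/-- The set `S` after the greedy algorithm, started from `T`, has treated the vertices of the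
forest in `H` at the positions from `p` on. -/
structure GreedyInv (G : SimpleGraph (Fin n)) (H T : Finset (Fin n)) (σ : Equiv.Perm (Fin n))
    (p : ℕ) (S : Finset (Fin n)) : Prop where
  subset : T ⊆ S
  mem : ∀ v ∈ S, v ∈ T ∨ v ∈ H ∧ #(earlierNbrIn G H σ v) ≤ 1 ∧ p ≤ σ v
  indep : G.IsIndepSet (S : Set (Fin n))
  blocked : ∀ v ∈ H, #(earlierNbrIn G H σ v) ≤ 1 → p ≤ σ v → v ∉ S →
    ∃ c ∈ S, c ∈ H ∧ G.Adj v c ∧ σ v < σ c ∧ #(earlierNbrIn G H σ c) ≤ 1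

theorem GreedyInv.init (hT : G.IsIndepSet (T : Set (Fin n))) : GreedyInv G H T σ n T :=
  ⟨Subset.rfl, fun _ hv => Or.inl hv, hT, fun v _ _ h => absurd (σ v).2 (by omega)⟩

theorem GreedyInv.insert (h : GreedyInv G H T σ (p + 1) S) {v : Fin n} (hσ : (σ v : ℕ) = p)
    (hv : v ∈ H) (hcard : #(earlierNbrIn G H σ v) ≤ 1) (hS : ∀ w ∈ S, ¬ G.Adj v w) :
    GreedyInv G H T σ p (insert v S) := by
  refine ⟨h.subset.trans (subset_insert _ _), fun w hw => ?_, ?_, fun w hw hwc hpw hwS => ?_⟩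
  · rcases mem_insert.1 hw with rfl | hw
    · exact Or.inr ⟨hv, hcard, hσ.ge⟩
    · exact (h.mem w hw).imp id fun h => ⟨h.1, h.2.1, by omega⟩
  · rw [coe_insert, SimpleGraph.isIndepSet_iff, Set.pairwise_insert]
    exact ⟨h.indep, fun w hw _ => ⟨hS w hw, fun h => hS w hw h.symm⟩⟩
  · rw [mem_insert, not_or] at hwS
    have hne : (σ w : ℕ) ≠ p := fun h' => hwS.1 (σ.injective (Fin.ext (h'.trans hσ.symm)))
    obtain ⟨c, hc, hc'⟩ := h.blocked w hw hwc (by omega) hwS.2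
    exact ⟨c, mem_insert_of_mem hc, hc'⟩

/-- `T` has no edges to `H`, so a neighbour in `S` that blocks a forest vertex is itself a forest
vertex at a later position, that is, a child. -/
theorem GreedyInv.skip (h : GreedyInv G H T σ (p + 1) S) {v : Fin n} (hσ : (σ v : ℕ) = p)
    (hTH : ∀ v ∈ H, ∀ w ∈ T, ¬ G.Adj v w)
    (hv : v ∈ H → #(earlierNbrIn G H σ v) ≤ 1 → ∃ w ∈ S, G.Adj v w) :
    GreedyInv G H T σ p S := by
  refine ⟨h.subset, fun w hw => (h.mem w hw).imp id fun h => ⟨h.1, h.2.1, by omega⟩, h.indep,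
    fun w hw hwc hpw hwS => ?_⟩
  by_cases hwp : (σ w : ℕ) = p
  · obtain rfl : w = v := σ.injective (Fin.ext (hwp.trans hσ.symm))
    obtain ⟨c, hc, hadj⟩ := hv hw hwc
    rcases h.mem c hc with hcT | ⟨hcH, hcc, hpc⟩
    · exact absurd hadj (hTH w hw c hcT)
    · exact ⟨c, hc, hcH, hadj, by rw [Fin.lt_def]; omega, hcc⟩
  · exact h.blocked w hw hwc (by omega) hwS

end Greedy

/-! ### The program for the greedy algorithm -/

namespace RAM

variable {N n : ℕ} {G : SimpleGraph (Fin n)} {H T : Finset (Fin n)} {σ : Equiv.Perm (Fin n)}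
  {s s' : State}

/-- The memory holds the graph, the set `H` and the order `σ`. -/
structure ForestInput (G : SimpleGraph (Fin n)) (H : Finset (Fin n)) (σ : Equiv.Perm (Fin n))
    (s : State) : Prop where
  size : s.reg 0 = n
  adj : ∀ v w : Fin n, s.arr 0 (s.arr 10 v + w) ≠ 0 ↔ G.Adj v w
  mem : ∀ v : Fin n, s.arr 8 v = s.arr 9 v ↔ v ∈ H
  pos : ∀ v : Fin n, s.arr 2 v = σ v

theorem ForestInput.congr (h : ForestInput G H σ s) (h0 : s'.reg 0 = s.reg 0)
    (ha0 : s'.arr 0 = s.arr 0) (h10 : s'.arr 10 = s.arr 10) (h8 : s'.arr 8 = s.arr 8)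
    (h9 : s'.arr 9 = s.arr 9) (h2 : s'.arr 2 = s.arr 2) : ForestInput G H σ s' :=
  ⟨h0.trans h.size, by rw [ha0, h10]; exact h.adj, by rw [h8, h9]; exact h.mem,
    by rw [h2]; exact h.pos⟩

theorem mem_vertexOutput {v : Fin n} : v ∈ vertexOutput n s ↔ s.arr 1 v ≠ 0 := by
  simp [vertexOutput]

theorem vertexOutput_congr (h : s'.arr 1 = s.arr 1) : vertexOutput n s' = vertexOutput n s := by
  rw [vertexOutput, vertexOutput, h]

/-- Find the vertex at a given position. -/
def findCmd : Cmd :=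
  .forTo 35 0 (.branch (.eq (.get 2 (.reg 35)) (.reg 34)) (.assign 36 (.reg 35)) .skip)

theorem wp_findCmd (hN : n ≤ N) (h : ForestInput G H σ s) {v : Fin n} (hv : s.reg 34 = σ v) :
    Wp N findCmd (fun s' => s'.reg 36 = v) s := by
  refine Wp.forTo (fun i s' => v < i → s'.reg 36 = v) (by rw [h.size]; exact hN) rfl rfl (by simp)
    ?_ fun s1 hf1 hi1 => hi1 (by rw [h.size]; exact v.2)
  intro i hi s1 hf1 hx1 hi1
  rw [h.size] at hi
  have e34 : s1.reg 34 = σ v := (hf1.1 34 rfl).trans hv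
  have e2 : s1.arr 2 i = σ ⟨i, hi⟩ := by rw [hf1.2 2 rfl]; exact h.pos ⟨i, hi⟩
  have hiff : σ ⟨i, hi⟩ = σ v ↔ i = v := by rw [σ.injective.eq_iff, Fin.ext_iff]
  refine Wp.branch (fun hb => Wp.assign fun _ => ?_) fun hb => Wp.skip fun hvi => ?_ <;>
    simp [Exp.eval, hx1, e34, e2, Fin.val_inj, hiff] at hb
  · simp [Exp.eval, hx1, hb]
  · simpa using hi1 (by omega)

/-- Count the earlier neighbours of a vertex in `H` and its neighbours in the output. -/
def countCmd : Cmd :=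
  .seq (.assign 37 (.const 0)) (.seq (.assign 38 (.const 0)) (.forTo 39 0
    (.branch (.get 0 (.add (.get 10 (.reg 36)) (.reg 39)))
      (.seq (.assign 38 (.add (.reg 38) (.get 1 (.reg 39))))
        (.branch (.eq (.get 8 (.reg 39)) (.get 9 (.reg 39)))
          (.branch (.lt (.get 2 (.reg 39)) (.reg 34))
            (.assign 37 (.add (.reg 37) (.const 1))) .skip) .skip)) .skip)))

open Classical in
theorem wp_countCmd (hN : n ≤ N) (h : ForestInput G H σ s) {v : Fin n} (hv : s.reg 36 = v)
    (hp : s.reg 34 = σ v) :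
    Wp N countCmd (fun s' => s'.reg 37 = #(earlierNbrIn G H σ v) ∧
      (s'.reg 38 = 0 ↔ ∀ w ∈ vertexOutput n s, ¬ G.Adj v w)) s := by
  refine Wp.seq (Wp.assign (Wp.seq (Wp.assign (Wp.forTo (fun i s' =>
    s'.reg 37 = #{w : Fin n | w ∈ earlierNbrIn G H σ v ∧ (w : ℕ) < i} ∧
      (s'.reg 38 = 0 ↔ ∀ w ∈ vertexOutput n s, (w : ℕ) < i → ¬ G.Adj v w))
    (by simp [h.size, hN]) rfl rfl (by simp [Exp.eval]) ?_ ?_))))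
  · rintro i hi s1 hf1 hx1 ⟨hi1, hi1'⟩
    have hin : i < n := by simpa [h.size] using hi
    have e36 : s1.reg 36 = v := (hf1.1 36 rfl).trans (by simp [hv])
    have e34 : s1.reg 34 = σ v := (hf1.1 34 rfl).trans (by simp [hp])
    have ea (a : ℕ) : s1.arr a = s.arr a := hf1.2 a rfl
    set u : Fin n := ⟨i, hin⟩ with hu
    have hadj : s.arr 0 (s.arr 10 v + i) ≠ 0 ↔ G.Adj v u := h.adj v u
    have hmem : s.arr 8 i = s.arr 9 i ↔ u ∈ H := h.mem u
    have hpos : s.arr 2 i = σ u := h.pos u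
    have hsplit (w : Fin n) : (w : ℕ) < i + 1 ↔ w = u ∨ (w : ℕ) < i := by
      rw [Fin.ext_iff, hu]; simp only; omega
    have hcard : #{w : Fin n | w ∈ earlierNbrIn G H σ v ∧ (w : ℕ) < i + 1} =
        #{w : Fin n | w ∈ earlierNbrIn G H σ v ∧ (w : ℕ) < i} +
          if u ∈ earlierNbrIn G H σ v then 1 else 0 := by
      simp only [hsplit]
      split_ifs with hmem'
      · rw [← card_insert_of_notMem (a := u) (by simp [hu])]
        congr 1
        ext w
        simp only [mem_filter, mem_univ, true_and, mem_insert]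
        constructor
        · rintro ⟨h1, h2⟩; exact h2.imp id fun h2 => ⟨h1, h2⟩
        · rintro (rfl | ⟨h1, h2⟩)
          · exact ⟨hmem', Or.inl rfl⟩
          · exact ⟨h1, Or.inr h2⟩
      · rw [add_zero]
        congr 1
        ext w
        simp only [mem_filter, mem_univ, true_and]
        refine and_congr_right fun hw => or_iff_right ?_
        rintro rfl; exact hmem' hw
    have hall : (∀ w ∈ vertexOutput n s, (w : ℕ) < i + 1 → ¬ G.Adj v w) ↔
        (∀ w ∈ vertexOutput n s, (w : ℕ) < i → ¬ G.Adj v w) ∧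
          (u ∈ vertexOutput n s → ¬ G.Adj v u) := by
      simp only [hsplit]
      constructor
      · exact fun h => ⟨fun w hw hwi => h w hw (Or.inr hwi), fun hw => h u hw (Or.inl rfl)⟩
      · rintro ⟨h1, h2⟩ w hw (rfl | hwi)
        · exact h2 hw
        · exact h1 w hw hwi
    have hout : u ∈ vertexOutput n s ↔ s.arr 1 i ≠ 0 := mem_vertexOutput
    simp only [mem_earlierNbrIn (w := u), Fin.lt_def (a := σ u)] at hcard
    simp only [hcard, hall, hout, ← hi1']
    refine Wp.branch (fun hb => Wp.seq (Wp.assign (Wp.branch (fun hb1 => Wp.branch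
      (fun hb2 => Wp.assign ?_) fun hb2 => Wp.skip ?_) fun hb1 => Wp.skip ?_))) fun hb =>
      Wp.skip ?_
    all_goals
      simp only [Exp.eval, hx1, e36, e34, ea, setReg_reg, setReg_arr, Nat.reduceEqDiff, if_false,
        if_true, hpos, hmem, ne_eq, ite_eq_right_iff, one_ne_zero, imp_false, not_not] at *
    · simp [← hi1, hadj.1 hb, hb1, hb2]
    · simp [← hi1, hadj.1 hb, hb2]
    · simp [← hi1, hadj.1 hb, hb1]
    · have : ¬ G.Adj v u := fun h' => hadj.2 h' hb
      simp [← hi1, this]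
  · rintro s1 hf1 ⟨hi1, hi1'⟩
    have e : ((s.setReg 37 (Exp.eval s (.const 0))).setReg 38
        (Exp.eval (s.setReg 37 (Exp.eval s (.const 0))) (.const 0))).reg 0 = n := by simp [h.size]
    rw [e] at hi1 hi1'
    exact ⟨by simpa using hi1, by simpa using hi1'⟩

/-- Treat the vertices in reverse order and add those in the forest that have no neighbour in the
output. -/
def greedyCmd : Cmd :=
  .forTo 33 0 (.seq (.assign 34 (.sub (.reg 0) (.add (.reg 33) (.const 1)))) (.seq findCmd
    (.seq countCmd (.branch (.eq (.get 8 (.reg 36)) (.get 9 (.reg 36)))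
      (.branch (.lt (.reg 37) (.const 2))
        (.branch (.reg 38) .skip (.store 1 (.reg 36) (.const 1))) .skip) .skip))))

theorem wp_greedyCmd (hN : n ≤ N) (h : ForestInput G H σ s) (hT : G.IsIndepSet (T : Set (Fin n)))
    (hTH : ∀ v ∈ H, ∀ w ∈ T, ¬ G.Adj v w) (hout : vertexOutput n s = T) :
    Wp N greedyCmd (fun s' => GreedyInv G H T σ 0 (vertexOutput n s')) s := by
  refine Wp.forTo (fun i s' => GreedyInv G H T σ (n - i) (vertexOutput n s'))
    (by rw [h.size]; exact hN) rfl rfl ?_ ?_ fun s1 hf1 hi1 => by simpa [h.size] using hi1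
  · rw [vertexOutput_congr (s' := s.setReg 33 0) (s := s) rfl, hout]
    exact GreedyInv.init hT
  intro i hi s1 hf1 hx1 hi1
  rw [h.size] at hi
  -- `p` is the position treated now; in this form the truncated subtractions are exact.
  obtain ⟨p, hp⟩ : ∃ p, n = p + (i + 1) := ⟨n - (i + 1), by omega⟩
  rw [show n - i = p + 1 by omega] at hi1
  rw [show n - (i + 1) = p by omega]
  obtain ⟨v, hv⟩ := σ.surjective ⟨p, by omega⟩
  have hv' : (σ v : ℕ) = p := by rw [hv]
  have h1 : ForestInput G H σ s1 := h.congr (hf1.1 0 rfl) (hf1.2 0 rfl) (hf1.2 10 rfl)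
    (hf1.2 8 rfl) (hf1.2 9 rfl) (hf1.2 2 rfl)
  refine Wp.seq (Wp.assign (Wp.seq ((wp_findCmd (s := s1.setReg 34 (Exp.eval s1 _)) hN (v := v)
    (h1.congr (by simp) rfl rfl rfl rfl rfl) ?_).mono fun s2 hf2 hi2 => ?_)))
  · simp [Exp.eval, hx1, h1.size, hv']; omega
  have e34 : s2.reg 34 = σ v := by
    rw [hf2.1 34 rfl]; simp [Exp.eval, hx1, h1.size, hv']; omega
  have h2 : ForestInput G H σ s2 := h1.congr ((hf2.1 0 rfl).trans (by simp)) (hf2.2 0 rfl)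
    (hf2.2 10 rfl) (hf2.2 8 rfl) (hf2.2 9 rfl) (hf2.2 2 rfl)
  refine Wp.seq ((wp_countCmd hN h2 hi2 e34).mono ?_)
  rintro s3 hf3 ⟨h37, h38⟩
  have hout2 : vertexOutput n s2 = vertexOutput n s1 := vertexOutput_congr (hf2.2 1 rfl)
  have hout3 : vertexOutput n s3 = vertexOutput n s1 := (vertexOutput_congr (hf3.2 1 rfl)).trans hout2
  have e36 : s3.reg 36 = v := (hf3.1 36 rfl).trans hi2
  have hmem : s3.arr 8 v = s3.arr 9 v ↔ v ∈ H := by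
    rw [hf3.2 8 rfl, hf3.2 9 rfl]; exact h2.mem v
  rw [hout2] at h38
  have hskip (hc : v ∈ H → #(earlierNbrIn G H σ v) ≤ 1 → ∃ w ∈ vertexOutput n s1, G.Adj v w) :
      GreedyInv G H T σ p (vertexOutput n (s3.setReg 33 (i + 1))) := by
    rw [vertexOutput_congr (s' := s3.setReg 33 (i + 1)) (s := s3) rfl, hout3]
    exact hi1.skip hv' hTH hc
  refine Wp.branch (fun hb => Wp.branch (fun hb1 => Wp.branch (fun hb2 => Wp.skip ?_)
    fun hb2 => Wp.store ?_) fun hb1 => Wp.skip ?_) fun hb => Wp.skip ?_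
  all_goals
    simp only [Exp.eval, e36, h37, hmem, ne_eq, ite_eq_right_iff, one_ne_zero, imp_false, not_not]
      at *
  · exact hskip fun _ _ => by simpa [h38] using hb2
  · have : vertexOutput n ((s3.setArr 1 v 1).setReg 33 (i + 1)) =
        insert v (vertexOutput n s1) := by
      rw [← hout3]
      ext w
      simp only [mem_vertexOutput, mem_insert, setReg_arr, setArr_arr, if_true,
        Function.update_apply, Fin.val_inj]
      split_ifs <;> simp_all
    rw [this]
    exact hi1.insert hv' hb (by omega) (h38.1 hb2)
  · exact hskip fun _ h => absurd (by omega) hb1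
  · exact hskip fun h => absurd h hb

end RAM

/-! ### The persistent solution -/

section GraphInput

variable {n : ℕ} {G : SimpleGraph (Fin n)} [DecidableRel G.Adj]

theorem graphInput_arr_zero (u v : Fin n) :
    (graphInput G).arr 0 (u * n + v) = if G.Adj u v then 1 else 0 := by
  simp only [graphInput, true_and]
  refine if_congr ⟨?_, fun h => ⟨u, v, rfl, h⟩⟩ rfl rfl
  rintro ⟨u', v', h, hadj⟩
  have hn : 0 < n := by have := u.2; omega
  have h1 : (u : ℕ) = u' := by
    have := congrArg (· / n) h
    simpa [mul_comm _ n, Nat.mul_add_div hn, Nat.div_eq_of_lt] using this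
  have h2 : (v : ℕ) = v' := by rw [h1] at h; omega
  rwa [Fin.ext h1, Fin.ext h2]

theorem rowSum_graphInput (v : Fin n) : RAM.rowSum ((graphInput G).arr 0) n v = G.degree v := by
  rw [RAM.rowSum, ← Fin.sum_univ_eq_sum_range fun w => (graphInput G).arr 0 (v * n + w)]
  simp only [graphInput_arr_zero]
  rw [← card_filter, ← G.card_neighborFinset_eq_degree]
  congr 1
  ext w
  simp

end GraphInput

/-! ### From the memory after the auction to a stable assignment -/

namespace RAM

theorem sum_entryCount (f : ℕ → ℕ) {M n : ℕ} (h : ∀ x < M, f x < n) :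
    M = ∑ v ∈ range n, entryCount f M v := by
  conv_lhs => rw [← card_range M]
  exact card_eq_sum_card_fiberwise fun x hx => by
    simpa using h x (by simpa using hx)

theorem card_fin_eq_entryCount (f : ℕ → ℕ) {M n : ℕ} (h : ∀ x < M, f x < n) (v : Fin n) :
    #{x : Fin M | (⟨f x, h x x.2⟩ : Fin n) = v} = entryCount f M v := by
  rw [entryCount, card_filter, card_filter,
    ← Fin.sum_univ_eq_sum_range fun x => if f x = v then 1 else 0]
  simp only [Fin.ext_iff]

variable {M n lam c : ℕ} {G : SimpleGraph (Fin n)} {E : ℕ → ℕ → Prop}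
  {price own asg : ℕ → ℕ} {vert : Fin M → Fin n}

/-- A unit without a slot faces prices of at least 2M + 4, and `c ≤ M` makes this exceed g + 2 = 2c
+ 3. -/
theorem AuctionInv.isStableAssignment (h : AuctionInv M (2 * M + 4) E price own asg)
    (hend : AuctionEnd M (2 * M + 4) E price asg) (hc : c ≤ M)
    (hgap : ∀ y < M, price y ≠ c + c + 1 ∧ price y ≠ c + c + 1 + 1)
    (hE : ∀ x y : Fin M, E x y ↔ G.Adj (vert x) (vert y)) (hsurj : ∀ v, ∃ x, vert x = v) :
    IsStableAssignment G vert (fun y => price y) (fun x y => own y = x + 1) (c + c + 1) where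
  surj := hsurj
  left_unique x x' y hx hx' := Fin.ext (by omega)
  right_unique x y y' hy hy' := Fin.ext (h.inj x y y' y.2 y'.2 hy hy')
  adj x y hxy := (hE x y).1 (h.adj x y y.2 hxy)
  price_le x y y' hxy hadj := h.price_le x y y' y.2 y'.2 hxy ((hE x y').2 hadj)
  owned y hy := by
    obtain ⟨x, hx⟩ := Nat.exists_eq_succ_of_ne_zero (h.pos y y.2 hy)
    exact ⟨⟨x, h.lt x y y.2 hx⟩, hx⟩
  free x y hfree hadj := by
    have h1 : asg (x + 1) = 0 := by
      by_contra hne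
      obtain ⟨z, hz, hz'⟩ := h.exists_own x x.2 hne
      exact hfree ⟨z, hz⟩ hz'
    have := hend x x.2 y y.2 h1 ((hE x y).2 hadj)
    omega
  pos := by omega
  gap y := hgap y y.2

/-- Units own at most one slot, so one without a low slot is free or owns a high one. The right-hand
side is what `flagsCmd` marks. -/
theorem AuctionInv.isPoor_iff (h : AuctionInv M lam E price own asg) {g : ℕ} (hg : 1 ≤ g)
    {f : ℕ → ℕ} (hf : ∀ x : Fin M, f x = vert x) (v : Fin n) :
    IsPoor vert (fun y => price y) (fun x y => own y = x + 1) g v ↔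
      ∃ y < M, (g ≤ price y ∧ f (own y - 1) = v) ∨ (asg (y + 1) = 0 ∧ f y = v) := by
  constructor
  · rintro ⟨x, rfl, hx⟩
    by_cases ha : asg (x + 1) = 0
    · exact ⟨x, x.2, Or.inr ⟨ha, hf x⟩⟩
    · obtain ⟨y, hy, hy'⟩ := h.exists_own x x.2 ha
      exact ⟨y, hy, Or.inl ⟨hx ⟨y, hy⟩ hy', by rw [hy', Nat.add_sub_cancel, hf]⟩⟩
  · rintro ⟨y, hy, ⟨hgy, hv⟩ | ⟨ha, hv⟩⟩
    · obtain ⟨x, hx⟩ := Nat.exists_eq_succ_of_ne_zero (h.pos y hy (by omega))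
      have hxM := h.lt x y hy hx
      refine ⟨⟨x, hxM⟩, Fin.ext ?_, fun z hz => ?_⟩
      · rw [← hf, ← hv, hx, Nat.succ_sub_one]
      · have := h.inj x y z hy z.2 hx hz
        show g ≤ price z
        rwa [← this]
    · refine ⟨⟨y, hy⟩, Fin.ext (by rw [← hf, ← hv]), fun z hz => ?_⟩
      exact absurd ha (h.asg_ne y z z.2 hz)

theorem isHigh_iff {g : ℕ} {f : ℕ → ℕ} (hf : ∀ x : Fin M, f x = vert x) (v : Fin n) :
    IsHigh vert (fun y => price y) g v ↔ ∃ y < M, g ≤ price y ∧ f y = v := by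
  constructor
  · rintro ⟨y, rfl, hy⟩
    exact ⟨y, y.2, hy, hf y⟩
  · rintro ⟨y, hy, hg, hv⟩
    exact ⟨⟨y, hy⟩, Fin.ext (by rw [← hf, ← hv]), hg⟩

/-- Compute the persistent solution. -/
def prepCmd : Cmd :=
  .seq totalCmd (.seq rowsCmd (.seq unitsCmd (.seq auctionCmd
    (.seq gapCmd (.seq flagsCmd takeCmd)))))

/-- A bound for the number of iterations of each loop. -/
noncomputable def loopBound : Polynomial ℕ :=
  400 * .X ^ 3 * (2 * (400 * .X ^ 3) + 4) + 400 * .X ^ 3 + 400 * .X ^ 2 + .X + 1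

theorem loopBound_eval (n : ℕ) : loopBound.eval n =
    400 * n ^ 3 * (2 * (400 * n ^ 3) + 4) + 400 * n ^ 3 + 400 * n ^ 2 + n + 1 := by
  simp [loopBound]

theorem wp_prepCmd (G : SimpleGraph (Fin n)) [DecidableRel G.Adj] :
    Wp (loopBound.eval n) prepCmd (fun s => ∃ (M g : ℕ) (vert : Fin M → Fin n)
      (price : Fin M → ℕ) (Owns : Fin M → Fin M → Prop), IsStableAssignment G vert price Owns g ∧
      (∀ v, #{x | vert x = v} = 400 * n ^ 2 / (G.degree v + 1)) ∧
      s.reg 0 = n ∧ (∀ v w : Fin n, s.arr 0 (s.arr 10 v + w) ≠ 0 ↔ G.Adj v w) ∧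
      (∀ v : Fin n, s.arr 8 v = s.arr 9 v ↔ v ∈ undecided vert price Owns g) ∧
      vertexOutput n s = takenPart vert price Owns g) (graphInput G) := by
  classical
  rw [loopBound_eval]
  set N := 400 * n ^ 3 * (2 * (400 * n ^ 3) + 4) + 400 * n ^ 3 + 400 * n ^ 2 + n + 1 with hN
  set s0 := graphInput G with hs0
  have hr0 : s0.reg 0 = n := rfl
  have hr (r : ℕ) (h : r ≠ 0) : s0.reg r = 0 := by simp [hs0, graphInput, h]
  have ha (a i : ℕ) (h : a ≠ 0) : s0.arr a i = 0 := by simp [hs0, graphInput, h]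
  refine Wp.seq ((wp_totalCmd (s := s0) (by rw [hr0]; omega) (hr 1 (by simp))).mono
    fun s1 hf1 h1 => ?_)
  have r10 : s1.reg 0 = n := hf1.1 0 rfl
  refine Wp.seq ((wp_rowsCmd (s := s1) (by rw [r10]; omega)
    ((hf1.1 2 rfl).trans (hr 2 (by simp)))).mono fun s2 hf2 h2 => ?_)
  have r20 : s2.reg 0 = n := (hf2.1 0 rfl).trans r10
  have r21 : s2.reg 1 = 400 * n ^ 2 := (hf2.1 1 rfl).trans h1
  have a20 : s2.arr 0 = s0.arr 0 := (hf2.2 0 rfl).trans (hf1.2 0 rfl)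
  rw [r10] at h2
  refine Wp.seq ((wp_unitsCmd (s := s2) (by rw [r20]; omega) (by rw [r21]; omega)
    ((hf2.1 5 rfl).trans ((hf1.1 5 rfl).trans (hr 5 (by simp)))) (by rwa [r20])).mono
    fun s3 hf3 h3 => ?_)
  rw [r20, r21, a20] at h3
  have r30 : s3.reg 0 = n := (hf3.1 0 rfl).trans r20
  have a30 : s3.arr 0 = s0.arr 0 := (hf3.2 0 rfl).trans a20
  have a310 : ∀ v < n, s3.arr 10 v = v * n := by rw [hf3.2 10 rfl]; exact h2
  set M := s3.reg 5 with hM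
  have hlt : ∀ x < M, s3.arr 3 x < n := by
    intro x hx
    by_contra hcon
    have := h3 (s3.arr 3 x)
    rw [if_neg hcon, entryCount, card_eq_zero] at this
    exact notMem_empty x (this ▸ mem_filter.2 ⟨mem_range.2 hx, rfl⟩)
  have hMle : M ≤ 400 * n ^ 3 := by
    rw [sum_entryCount (s3.arr 3) hlt]
    calc ∑ v ∈ range n, entryCount (s3.arr 3) M v ≤ ∑ v ∈ range n, 400 * n ^ 2 := by
          refine sum_le_sum fun v hv => ?_
          rw [h3, if_pos (mem_range.1 hv)]
          exact Nat.div_le_self _ _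
      _ = 400 * n ^ 3 := by simp; ring
  have hMN : M * (2 * M + 4) ≤ N := by
    have : M * (2 * M + 4) ≤ 400 * n ^ 3 * (2 * (400 * n ^ 3) + 4) := by gcongr
    omega
  have a3 (a : ℕ) (h : a ≠ 0) (h1 : totalCmd.writesArr a = false)
      (h2 : rowsCmd.writesArr a = false) (h3 : unitsCmd.writesArr a = false) (i : ℕ) :
      s3.arr a i = 0 := by
    rw [hf3.2 a h3, hf2.2 a h2, hf1.2 a h1]; exact ha a i h
  refine Wp.seq ((wp_auctionCmd (s := s3) (by omega) hMN
    ((hf3.1 9 rfl).trans ((hf2.1 9 rfl).trans ((hf1.1 9 rfl).trans (hr 9 (by simp)))))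
    (a3 5 (by simp) rfl rfl rfl) (a3 6 (by simp) rfl rfl rfl) (a3 7 (by simp) rfl rfl rfl)).mono ?_)
  rintro s4 hf4 ⟨h4, h4'⟩
  have r45 : s4.reg 5 = M := hf4.1 5 rfl
  refine Wp.seq ((wp_gapCmd (s := s4) (by omega)).mono ?_)
  rintro s5 hf5 ⟨c, hc, hg, hgap⟩
  rw [r45] at hc hgap
  have r55 : s5.reg 5 = M := (hf5.1 5 rfl).trans r45
  refine Wp.seq ((wp_flagsCmd (s := s5) (by omega) ?_ ?_).mono fun s6 hf6 h6 => ?_)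
  · rw [hf5.2 8 rfl, hf4.2 8 rfl]; exact a3 8 (by simp) rfl rfl rfl
  · rw [hf5.2 9 rfl, hf4.2 9 rfl]; exact a3 9 (by simp) rfl rfl rfl
  have r60 : s6.reg 0 = n := (hf6.1 0 rfl).trans ((hf5.1 0 rfl).trans ((hf4.1 0 rfl).trans r30))
  refine (wp_takeCmd (s := s6) (by rw [r60]; omega) ?_).mono fun s7 hf7 h7 => ?_
  · rw [hf6.2 1 rfl, hf5.2 1 rfl, hf4.2 1 rfl]; exact a3 1 (by simp) rfl rfl rfl
  rw [hf5.2 5 rfl, hf5.2 6 rfl, hf5.2 7 rfl, hf5.2 3 rfl, hf4.2 3 rfl, r55] at h6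
  rw [r60] at h7
  set vert : Fin M → Fin n := fun x => ⟨s3.arr 3 x, hlt x x.2⟩ with hvert
  have hcount : ∀ v, #{x | vert x = v} = 400 * n ^ 2 / (G.degree v + 1) := by
    intro v
    rw [hvert, card_fin_eq_entryCount (s3.arr 3) hlt v, h3, if_pos v.2, hs0, rowSum_graphInput]
  have hadj (v w : Fin n) : s3.arr 0 (s3.arr 10 v + w) ≠ 0 ↔ G.Adj v w := by
    rw [a30, a310 v v.2, hs0, graphInput_arr_zero]
    simp
  have hstable : IsStableAssignment G vert (fun y => s4.arr 5 y)
      (fun x y => s4.arr 6 y = x + 1) (s5.reg 16) := by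
    rw [hg] at hgap ⊢
    refine h4.isStableAssignment h4' hc hgap (fun x y => hadj (vert x) (vert y)) fun v => ?_
    have h1 : 0 < #{x | vert x = v} := by
      rw [hcount, Nat.div_pos_iff]
      refine ⟨by omega, ?_⟩
      have h2 : G.degree v < n := by simpa using G.degree_lt_card_verts v
      nlinarith
    obtain ⟨x, hx⟩ := card_pos.1 h1
    exact ⟨x, (mem_filter.1 hx).2⟩
  have hhigh (v : Fin n) : s6.arr 8 v = 1 ↔ IsHigh vert (fun y => s4.arr 5 y) (s5.reg 16) v :=
    (h6 v).1.2.trans (isHigh_iff (fun _ => rfl) v).symm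
  have hpoor (v : Fin n) : s6.arr 9 v = 1 ↔
      IsPoor vert (fun y => s4.arr 5 y) (fun x y => s4.arr 6 y = x + 1) (s5.reg 16) v :=
    (h6 v).2.2.trans (h4.isPoor_iff hstable.pos (fun _ => rfl) v).symm
  refine ⟨M, s5.reg 16, vert, _, _, hstable, hcount, (hf7.1 0 rfl).trans r60, ?_, ?_, ?_⟩
  · rw [hf7.2 0 rfl, hf6.2 0 rfl, hf5.2 0 rfl, hf4.2 0 rfl, hf7.2 10 rfl, hf6.2 10 rfl,
      hf5.2 10 rfl, hf4.2 10 rfl]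
    exact hadj
  · intro v
    rw [hf7.2 8 rfl, hf7.2 9 rfl, mem_undecided, ← hhigh, ← hpoor]
    have := (h6 v).1.1
    have := (h6 v).2.1
    omega
  · ext v
    rw [mem_vertexOutput, h7 v v.2, mem_takenPart, ← hhigh, ← hpoor]
    have := (h6 v).1.1
    have := (h6 v).2.1
    omega

end RAM

/-! ### The random order -/

section UniformPermutation

variable {i : ℕ}

/-- Extend a permutation by a fixed point at the end. -/
def extendLast (σ : Equiv.Perm (Fin i)) : Equiv.Perm (Fin (i + 1)) :=
  finSuccEquivLast.symm.permCongr (Equiv.optionCongr σ)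

@[simp] theorem extendLast_last (σ : Equiv.Perm (Fin i)) :
    extendLast σ (Fin.last i) = Fin.last i := by
  simp [extendLast, Equiv.permCongr_apply]

@[simp] theorem extendLast_castSucc (σ : Equiv.Perm (Fin i)) (v : Fin i) :
    extendLast σ v.castSucc = (σ v).castSucc := by
  simp [extendLast, Equiv.permCongr_apply]

/-- The point sent to the last one recovers the draw, and cancelling the swap recovers the
permutation. This is the inductive step of the Fisher–Yates shuffle. -/
theorem extendLast_mul_swap_bijective : Function.Bijective
    fun q : Equiv.Perm (Fin i) × Fin (i + 1) => extendLast q.1 * Equiv.swap q.2 (Fin.last i) := by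
  rw [Fintype.bijective_iff_injective_and_card]
  refine ⟨?_, by simp [Fintype.card_perm, Nat.factorial_succ, mul_comm]⟩
  rintro ⟨σ, r⟩ ⟨σ', r'⟩ h
  simp only at h
  have h1 := Equiv.congr_fun h r
  simp only [Equiv.Perm.mul_apply, Equiv.swap_apply_left, extendLast_last] at h1
  have h2 : r = r' := by
    have h3 : Equiv.swap r' (Fin.last i) r = Fin.last i :=
      (extendLast σ').injective (h1.symm.trans (extendLast_last σ').symm)
    rw [← Equiv.swap_apply_self r' (Fin.last i) r, h3, Equiv.swap_apply_right]
  subst h2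
  have h3 := mul_right_cancel h
  refine Prod.ext (Equiv.ext fun v => ?_) rfl
  have h4 := Equiv.congr_fun h3 v.castSucc
  simpa using h4

theorem uniform_bind_uniform {α β γ δ : Type*} [Fintype α] [Nonempty α] [Fintype β] [Nonempty β]
    [Fintype γ] [Nonempty γ] (e : α × β ≃ γ) (F : γ → PMF δ) :
    ((PMF.uniformOfFintype α).bind fun a => (PMF.uniformOfFintype β).bind fun b => F (e (a, b))) =
      (PMF.uniformOfFintype γ).bind F := by
  ext d
  simp only [PMF.bind_apply, tsum_fintype, PMF.uniformOfFintype_apply, ← mul_sum]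
  rw [← e.sum_comp, Fintype.sum_prod_type, ← mul_assoc, ← Fintype.card_congr e, Fintype.card_prod,
    Nat.cast_mul, ENNReal.mul_inv (by simp) (by simp)]

theorem expectedSize_uniform_map {n : ℕ} (S : Equiv.Perm (Fin n) → Finset (Fin n)) :
    expectedSize ((PMF.uniformOfFintype (Equiv.Perm (Fin n))).map S) =
      permMean fun σ => (#(S σ) : ℝ) := by
  have h (A : Finset (Fin n)) : ((PMF.uniformOfFintype (Equiv.Perm (Fin n))).map S A).toReal =
      ∑ σ, if A = S σ then (n.factorial : ℝ)⁻¹ else 0 := by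
    rw [PMF.map_apply, tsum_fintype, ENNReal.toReal_sum (by
      intro σ _; split_ifs <;> simp [PMF.uniformOfFintype_apply])]
    refine sum_congr rfl fun σ _ => ?_
    split_ifs <;> simp [PMF.uniformOfFintype_apply, Fintype.card_perm]
  simp only [expectedSize, h, sum_mul, permMean, sum_div]
  rw [sum_comm]
  refine sum_congr rfl fun σ _ => ?_
  simp [ite_mul, div_eq_inv_mul]

end UniformPermutation

/-! ### The shuffle program and its distribution -/

namespace RAM

variable {n : ℕ} {s : State}

/-- The body of the loop that builds the random order. -/
def insertCmd : Cmd :=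
  .seq (.seq (.draw 41 (.reg 40)) (.seq (.store 2 (.reg 40) (.get 2 (.reg 41)))
    (.store 2 (.reg 41) (.reg 40)))) (.assign 40 (.add (.reg 40) (.const 1)))

/-- The loop that builds the random order. -/
def shuffleLoop : Cmd := .loop (.lt (.reg 40) (.reg 0)) insertCmd

/-- Build a random order of the vertices. -/
def shuffleCmd : Cmd := .seq (.assign 40 (.const 0)) shuffleLoop

/-- The memory after the step that draws `r`. -/
def insertState (s : State) (r : ℕ) : State :=
  ((((s.setReg 41 r).setArr 2 (s.reg 40) (s.arr 2 r)).setArr 2 r (s.reg 40)).setReg 40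
    (s.reg 40 + 1))

theorem runFrom_shuffleLoop_step {i : ℕ} (hi : s.reg 40 = i) (h : s.reg 40 < s.reg 0)
    (k : List Cmd) (T : ℕ) :
    runFrom ⟨shuffleLoop :: k, s⟩ (8 + T) = (PMF.uniformOfFintype (Fin (i + 1))).bind
      fun r => runFrom ⟨shuffleLoop :: k, insertState s r⟩ T := by
  subst hi
  -- One iteration has eight steps: the loop test, three sequencings, the draw, two stores and the
  -- increment.
  rw [show 8 + T = T + 4 + 1 + 1 + 1 + 1 by ring,
    runFrom_of_step (D := ⟨insertCmd :: shuffleLoop :: k, s⟩)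
      (by simp [step, shuffleLoop, Exp.eval, h]), insertCmd,
    runFrom_of_step (by rfl), runFrom_of_step (by rfl), runFrom]
  simp only [step]
  rw [PMF.bind_map]
  congr 1
  funext r
  simp only [Function.comp]
  rw [runFrom_of_step (by rfl), runFrom_of_step (by rfl), runFrom_of_step (by rfl),
    runFrom_of_step (by rfl)]
  congr 2

/-- The states agree except on what the shuffle writes. -/
def SameInput (s s' : State) : Prop := s'.reg 0 = s.reg 0 ∧ ∀ a, a ≠ 2 → s'.arr a = s.arr a

/-- All draws are gathered into one uniform permutation, of which the memory is a deterministic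
function; later programs can then be analysed for each permutation separately. -/
theorem runFrom_shuffleLoop (h40 : s.reg 40 = 0) (k : List Cmd) (i : ℕ) (hi : i ≤ s.reg 0) :
    ∃ f : Equiv.Perm (Fin i) → State, (∀ σ, SameInput s (f σ) ∧ (f σ).reg 40 = i ∧
        ∀ v : Fin i, (f σ).arr 2 v = σ v) ∧
      ∀ T, runFrom ⟨shuffleLoop :: k, s⟩ (8 * i + T) =
        (PMF.uniformOfFintype (Equiv.Perm (Fin i))).bind
          fun σ => runFrom ⟨shuffleLoop :: k, f σ⟩ T := by
  induction i with
  | zero =>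
    exact ⟨fun _ => s, fun σ => ⟨⟨rfl, fun _ _ => rfl⟩, h40, fun v => v.elim0⟩,
      fun T => by simp⟩
  | succ i ih =>
    obtain ⟨f, hf, hrun⟩ := ih (by omega)
    set e := Equiv.ofBijective _ (extendLast_mul_swap_bijective (i := i))
    refine ⟨fun τ => insertState (f (e.symm τ).1) (e.symm τ).2, fun τ => ?_, fun T => ?_⟩
    · obtain ⟨⟨σ, r⟩, rfl⟩ := e.surjective τ
      simp only [e.symm_apply_apply]
      obtain ⟨⟨h1, h2⟩, h3, h4⟩ := hf σ
      refine ⟨⟨by simp [insertState, h1], fun a ha => by simp [insertState, ha, h2]⟩,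
        by simp [insertState, h3], fun v => ?_⟩
      have hv : e (σ, r) v = extendLast σ (Equiv.swap r (Fin.last i) v) := rfl
      rw [hv]
      simp only [insertState, setReg_arr, setArr_arr, if_true, h3, Function.update_apply,
        Fin.val_inj]
      split_ifs with hvr hvi
      · simp [hvr]
      · obtain rfl : v = Fin.last i := Fin.ext hvi
        rw [Equiv.swap_apply_right]
        obtain ⟨u, rfl⟩ := Fin.exists_castSucc_eq.2 (Ne.symm hvr)
        simp [h4]
      · have hvl : v ≠ Fin.last i := fun h => hvi (by rw [h]; rfl)
        rw [Equiv.swap_apply_of_ne_of_ne hvr hvl]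
        obtain ⟨u, rfl⟩ := Fin.exists_castSucc_eq.2 hvl
        simp [h4]
    · rw [show 8 * (i + 1) + T = 8 * i + (8 + T) by ring, hrun, ← uniform_bind_uniform e]
      congr 1
      funext σ
      obtain ⟨⟨h1, h2⟩, h3, h4⟩ := hf σ
      rw [runFrom_shuffleLoop_step h3 (by omega)]
      congr 1
      funext r
      simp only [e.symm_apply_apply]

theorem runFrom_shuffleCmd (hn : s.reg 0 = n) (k : List Cmd) :
    ∃ f : Equiv.Perm (Fin n) → State, (∀ σ, SameInput s (f σ) ∧ ∀ v : Fin n, (f σ).arr 2 v = σ v) ∧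
      ∀ T, runFrom ⟨shuffleCmd :: k, s⟩ (8 * n + 3 + T) =
        (PMF.uniformOfFintype (Equiv.Perm (Fin n))).bind fun σ => runFrom ⟨k, f σ⟩ T := by
  obtain ⟨f, hf, hrun⟩ := runFrom_shuffleLoop (s := s.setReg 40 0) (by simp) k n (by simp [hn])
  refine ⟨f, fun σ => ⟨⟨by simpa using (hf σ).1.1, by simpa using (hf σ).1.2⟩, (hf σ).2.2⟩,
    fun T => ?_⟩
  rw [show 8 * n + 3 + T = 8 * n + (T + 1) + 1 + 1 by ring, shuffleCmd, runFrom_of_step (by rfl),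
    runFrom_of_step (D := ⟨shuffleLoop :: k, s.setReg 40 0⟩) (by rfl), hrun]
  congr 1
  funext σ
  refine runFrom_of_step (D := ⟨k, f σ⟩) ?_ T
  have h0 : (f σ).reg 0 = n := by simpa [hn] using (hf σ).1.1
  simp [step, shuffleLoop, Exp.eval, h0, (hf σ).2.1]

/-! ### The algorithm -/

/-- The algorithm for the maximum independent set problem. -/
def independentSetCmd : Cmd := .seq prepCmd (.seq shuffleCmd greedyCmd)

/-- A bound for the running time. -/
noncomputable def timeBound : Polynomial ℕ :=
  prepCmd.cost.comp loopBound + greedyCmd.cost.comp loopBound + 8 * .X + 5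

theorem exists_run_independentSetCmd (G : SimpleGraph (Fin n)) [DecidableRel G.Adj] :
    ∃ f : Equiv.Perm (Fin n) → State,
      run independentSetCmd (graphInput G) (timeBound.eval n) =
        (PMF.uniformOfFintype (Equiv.Perm (Fin n))).map (fun σ => ⟨[], f σ⟩) ∧
      (∀ σ, G.IsIndepSet (vertexOutput n (f σ) : Set (Fin n))) ∧
      ∀ I : Finset (Fin n), G.IsIndepSet (I : Set (Fin n)) →
        ∑ v ∈ I, canonicalValue (7 / 3) (G.degree v) ≤
          permMean fun σ => (#(vertexOutput n (f σ)) : ℝ) := by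
  obtain ⟨s1, t1, hexec, ht1, M, g, vert, price, Owns, hst, hcount, h0, hadj, hmem, hout⟩ :=
    wp_prepCmd G
  obtain ⟨f1, hf1, hrun⟩ := runFrom_shuffleCmd h0 [greedyCmd]
  have hN : n ≤ loopBound.eval n := by rw [loopBound_eval]; omega
  have hgreedy (σ : Equiv.Perm (Fin n)) : Wp (loopBound.eval n) greedyCmd
      (fun s' => GreedyInv G (undecided vert price Owns g) (takenPart vert price Owns g) σ 0
        (vertexOutput n s')) (f1 σ) := by
    obtain ⟨⟨h1, h2⟩, h3⟩ := hf1 σ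
    refine wp_greedyCmd hN ⟨h1.trans h0, ?_, ?_, h3⟩ ?_ ?_ ?_
    · rw [h2 0 (by simp), h2 10 (by simp)]; exact hadj
    · rw [h2 8 (by simp), h2 9 (by simp)]; exact hmem
    · intro v hv w hw _ hvw
      have h4 := mem_takenPart.1 (mem_coe.1 hw)
      have h5 := mem_rejectedPart.1 (hst.rejected_of_adj (mem_coe.1 hv) hvw)
      exact h5.1 h4.1
    · intro v hv w hw hvw
      have h4 := mem_undecided.1 hv
      have h5 := mem_rejectedPart.1 (hst.rejected_of_adj hw hvw.symm)
      exact h5.1 (h4.2 h5.2)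
    · rw [vertexOutput_congr (h2 1 (by simp)), hout]
  choose f t hf ht hinv using hgreedy
  refine ⟨f, ?_, fun σ => (hinv σ).indep, fun I hI => ?_⟩
  -- `R` is the time that the preparation leaves unused. Halted configurations do not change, so
  -- runs of different lengths can be compared at a common time.
  · obtain ⟨R, hR⟩ : ∃ R, timeBound.eval n =
        t1 + ((8 * n + 3 + (greedyCmd.cost.eval (loopBound.eval n) + R)) + 1) + 1 := by
      refine ⟨prepCmd.cost.eval (loopBound.eval n) - t1, ?_⟩
      simp only [timeBound, Polynomial.eval_add, Polynomial.eval_comp, Polynomial.eval_mul,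
        Polynomial.eval_X, Polynomial.eval_ofNat]
      omega
    rw [hR, run_eq_runFrom, independentSetCmd, runFrom_of_step (by rfl), hexec.runFrom_eq,
      runFrom_of_step (by rfl), hrun, PMF.map]
    congr 1
    funext σ
    obtain ⟨R', hR'⟩ := Nat.exists_eq_add_of_le (ht σ)
    rw [hR', add_assoc, (hf σ).runFrom_eq, runFrom_halted]
    rfl
  · exact hst.sum_canonicalValue_le hcount hI
      (fun σ v hv hc hvS => (hinv σ).blocked v hv hc (Nat.zero_le _) hvS) fun σ => (hinv σ).subset

end RAM

theorem mainTheorem1 :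
    ∃ (c : RAM.Cmd) (p : Polynomial ℕ),
      HaltsWithin c (fun n => p.eval n) ∧
      ∀ (n : ℕ) (G : SimpleGraph (Fin n)) [DecidableRel G.Adj],
        (∀ S ∈ (outputDist c G (p.eval n)).support, G.IsIndepSet (S : Set (Fin n))) ∧
        ∀ I : Finset (Fin n), G.IsIndepSet (I : Set (Fin n)) →
          ∑ v ∈ I, canonicalValue (7 / 3) (G.degree v) ≤
            expectedSize (outputDist c G (p.eval n)) := by
  refine ⟨RAM.independentSetCmd, RAM.timeBound, fun n G _ C hC => ?_, fun n G _ => ?_⟩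
  · obtain ⟨f, hrun, -⟩ := RAM.exists_run_independentSetCmd G
    simp only [hrun] at hC
    obtain ⟨σ, -, rfl⟩ := (PMF.mem_support_map_iff _ _ _).1 hC
    rfl
  · obtain ⟨f, hrun, hindep, hsum⟩ := RAM.exists_run_independentSetCmd G
    have hdist : outputDist RAM.independentSetCmd G (RAM.timeBound.eval n) =
        (PMF.uniformOfFintype (Equiv.Perm (Fin n))).map fun σ => vertexOutput n (f σ) := by
      rw [outputDist, hrun, PMF.map_comp]
      rfl
    rw [hdist]
    refine ⟨fun S hS => ?_, fun I hI => ?_⟩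
    · obtain ⟨σ, -, rfl⟩ := (PMF.mem_support_map_iff _ _ _).1 hS
      exact hindep σ
    · rw [expectedSize_uniform_map]
      exact hsum I hI
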